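/- An instance of \textsc{MaxCDDP} consists of a finite set $C$ of $q$ colors, a finite simple undirected graph $G=(V,E)$ on $n$ vertices, a map $f_C\colon E\to 2^C$ that assigns a set of colors to every edge, and two distinct vertices $s,t\in V$. A simple $st$-path is colored by $c\in C$ if $c\in f_C(e)$ for each of its edges $e$. A solution is a set of distinct $st$-paths, pairwise without a common internal vertex, together with pairwise different colors, one for each path, such that every path is colored by its color. Let $\mathrm{opt}(I)$ be the maximum number of paths in a solution of the instance $I$, let $\mathrm{vc}(I)$ be the size of a smallest vertex cover of $G$, and let $|I|$ be the length of the encoding of $I$ by the numbers $n,q,s,t$, the adjacency matrix of $G$, and a bit for every pair of vertices and every color that tells whether the pair is an edge having that color. **Theorem.** \textsc{MaxCDDP} admits a fixed-parameter approximation algorithm of factor $\frac12$ parameterized by the size of the vertex cover of the input graph. That is, there are a deterministic algorithm $\mathcal A$ (a program of a random access machine with addition and truncated subtraction of natural numbers at unit cost), a computable function $f\colon\mathbb N\to\mathbb N$ and a constant $c\in\mathbb N$ such that on every instance $I$ the algorithm $\mathcal A$ halts after at most $f(\mathrm{vc}(I))\cdot|I|^{c}$ steps and outputs a solution (the paths as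 vertex sequences, with their colors) consisting of at least $\frac12\,\mathrm{opt}(I)$ paths. -/

import Mathlib

/-! ### A deterministic random access machine with a step count

The machine stores natural numbers in arrays `0, 1, 2, …`, each indexed by `ℕ`. A program is a finite
text and so mentions only finitely many arrays; a scalar variable is a cell with a fixed address.
The arithmetic is addition and truncated subtraction at unit cost (no multiplication), so that the
machine and multitape Turing machines simulate each other with polynomial overhead. -/

namespace RAM

/-- The memory: `σ a i` is the content of cell `i` of array `a`. -/
abbrev State : Type := ℕ → ℕ → ℕ

/-- Expressions: constants, the content of a cell whose address is computed, sums, and truncated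
differences. -/
inductive Expr : Type
  | lit (k : ℕ)
  | get (a : ℕ) (i : Expr)
  | add (x y : Expr)
  | sub (x y : Expr)

namespace Expr

/-- The value of an expression in a given memory. -/
def eval (σ : State) : Expr → ℕ
  | lit k => k
  | get a i => σ a (i.eval σ)
  | add x y => x.eval σ + y.eval σ
  | sub x y => x.eval σ - y.eval σ

/-- The number of elementary operations made when an expression is evaluated. -/
def cost : Expr → ℕ
  | lit _ => 1
  | get _ i => i.cost + 1
  | add x y => x.cost + y.cost + 1
  | sub x y => x.cost + y.cost + 1

end Expr

/-- Programs. A number counts as true when it is not `0`. -/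
inductive Prog : Type
  /-- do nothing -/
  | nop
  /-- write the value of `e` into the cell of array `a` whose index is the value of `i` -/
  | assign (a : ℕ) (i e : Expr)
  /-- first `P`, then `Q` -/
  | seq (P Q : Prog)
  /-- `P` if `b` is true, otherwise `Q` -/
  | cond (b : Expr) (P Q : Prog)
  /-- repeat `P` while `b` is true -/
  | loop (b : Expr) (P : Prog)

/-- `Exec P σ T τ`: started in the memory `σ`, the program `P` halts after exactly `T` elementary
steps, and the memory is then `τ`. -/
inductive Exec : Prog → State → ℕ → State → Prop
  | nop (σ : State) : Exec Prog.nop σ 1 σ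
  | assign (a : ℕ) (i e : Expr) (σ : State) :
      Exec (Prog.assign a i e) σ (i.cost + e.cost + 1)
        (Function.update σ a (Function.update (σ a) (i.eval σ) (e.eval σ)))
  | seq {P Q : Prog} {σ τ υ : State} {T U : ℕ} :
      Exec P σ T τ → Exec Q τ U υ → Exec (Prog.seq P Q) σ (T + U) υ
  | condTrue {b : Expr} {P Q : Prog} {σ τ : State} {T : ℕ} :
      b.eval σ ≠ 0 → Exec P σ T τ → Exec (Prog.cond b P Q) σ (b.cost + 1 + T) τ
  | condFalse {b : Expr} {P Q : Prog} {σ τ : State} {T : ℕ} :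
      b.eval σ = 0 → Exec Q σ T τ → Exec (Prog.cond b P Q) σ (b.cost + 1 + T) τ
  | loopStop {b : Expr} {P : Prog} {σ : State} :
      b.eval σ = 0 → Exec (Prog.loop b P) σ (b.cost + 1) σ
  | loopStep {b : Expr} {P : Prog} {σ τ υ : State} {T U : ℕ} :
      b.eval σ ≠ 0 → Exec P σ T τ → Exec (Prog.loop b P) τ U υ →
        Exec (Prog.loop b P) σ (b.cost + 1 + T + U) υ

/-- The initial memory on the input word `w`: array `0` holds the length of `w` followed by the
entries of `w`, and all other cells are `0`. -/
def init (w : List ℕ) : State :=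
  fun a i => if a = 0 then (w.length :: w).getD i 0 else 0

/-- `RunsTo P w v T`: on the input word `w`, the program `P` halts after exactly `T` steps with
output `v`, that is, array `1` then holds the length of `v` followed by the entries of `v`. -/
def RunsTo (P : Prog) (w v : List ℕ) (T : ℕ) : Prop :=
  ∃ τ : State, Exec P (init w) T τ ∧
    ∀ i, ∀ h : i < (v.length :: v).length, τ 1 i = (v.length :: v)[i]

end RAM

/-! ### Instances and solutions of MaxCDDP -/

/-- An instance of MaxCDDP: a set of `q` colors, an undirected graph on `n` vertices, a set of colors
for every edge, and two distinct vertices `s` and `t`. -/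
structure CDDP : Type where
  /-- number of vertices -/
  n : ℕ
  /-- number of colors -/
  q : ℕ
  /-- the graph -/
  G : SimpleGraph (Fin n)
  /-- the coloring of the edges -/
  col : G.edgeSet → Finset (Fin q)
  /-- the source -/
  s : Fin n
  /-- the target -/
  t : Fin n
  s_ne_t : s ≠ t

namespace CDDP

/-- `uv` is an edge, and `c` is one of its colors. -/
def HasColor (I : CDDP) (u v : Fin I.n) (c : Fin I.q) : Prop :=
  ∃ h : I.G.Adj u v, c ∈ I.col ⟨s(u, v), h⟩

/-- The (simple) `st`-path `p` is colored by `c`: every edge of `p` has the color `c`. -/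
def ColoredBy (I : CDDP) (p : I.G.Path I.s I.t) (c : Fin I.q) : Prop :=
  ∀ e, ∀ h : e ∈ p.1.edges, c ∈ I.col ⟨e, p.1.edges_subset_edgeSet h⟩

/-- Two `st`-paths that share no internal vertex. -/
def InternallyDisjoint (I : CDDP) (p p' : I.G.Path I.s I.t) : Prop :=
  ∀ v, v ∈ p.1.support → v ∈ p'.1.support → v = I.s ∨ v = I.t

/-- A solution: a set (listed in some order) of pairwise distinct and internally disjoint uni-color
`st`-paths, each given with a color by which it is colored, these colors being pairwise different. -/
def IsSolution (I : CDDP) (S : List (I.G.Path I.s I.t × Fin I.q)) : Prop :=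
  (∀ x ∈ S, I.ColoredBy x.1 x.2) ∧
    S.Pairwise fun x y => x.1 ≠ y.1 ∧ I.InternallyDisjoint x.1 y.1 ∧ x.2 ≠ y.2

/-- The maximum number of color disjoint uni-color `st`-paths. -/
noncomputable def opt (I : CDDP) : ℕ :=
  sSup {k | ∃ S, I.IsSolution S ∧ S.length = k}

theorem opt_isGreatest (I : CDDP) : IsGreatest {k | ∃ S, I.IsSolution S ∧ S.length = k} I.opt := by
  have hne : {k | ∃ S, I.IsSolution S ∧ S.length = k}.Nonempty := ⟨0, [], by simp [IsSolution]⟩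
  have hbd : BddAbove {k | ∃ S, I.IsSolution S ∧ S.length = k} := by
    refine ⟨I.q, ?_⟩
    rintro k ⟨S, hS, rfl⟩
    have hn : (S.map Prod.snd).Nodup := by
      rw [List.Nodup, List.pairwise_map]
      exact hS.2.imp fun h => h.2.2
    simpa using hn.length_le_card
  exact ⟨Nat.sSup_mem hne hbd, fun k hk => le_csSup hbd hk⟩

/-- The size of a smallest vertex cover of the graph. -/
noncomputable def vc (I : CDDP) : ℕ := I.G.vertexCoverNum.toNat

theorem coe_vc (I : CDDP) : (I.vc : ℕ∞) = I.G.vertexCoverNum := by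
  refine ENat.natCast_toNat (ne_top_of_le_ne_top ?_
    (iInf₂_le (f := fun (s : Set (Fin I.n)) (_ : I.G.IsVertexCover s) => s.encard)
      Set.univ SimpleGraph.isVertexCover_univ))
  simp

open Classical in
/-- The input word of an instance: the numbers `n`, `q`, `s`, `t` and then, for all pairs `(u, v)` of
vertices in lexicographic order, a bit for the adjacency of `u` and `v` followed by `q` bits for the
colors of the edge `uv`. -/
noncomputable def encode (I : CDDP) : List ℕ :=
  [I.n, I.q, (I.s : ℕ), (I.t : ℕ)] ++
    (List.finRange I.n).flatMap fun u => (List.finRange I.n).flatMap fun v =>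
      (if I.G.Adj u v then 1 else 0) ::
        (List.finRange I.q).map fun c => if I.HasColor u v c then 1 else 0

/-- The size `|I|` of an instance: the length of its input word. -/
noncomputable def size (I : CDDP) : ℕ := I.encode.length

/-- The output word of a solution: the number of paths and then, for each path, its color, its number
of vertices, and its vertices in the order from `s` to `t`. -/
def encodeSolution (I : CDDP) (S : List (I.G.Path I.s I.t × Fin I.q)) : List ℕ :=
  S.length :: S.flatMap fun x =>
    (x.2 : ℕ) :: x.1.1.support.length :: x.1.1.support.map fun v => (v : ℕ)

end CDDP

/-! Let `C` be the set of ends of a greedily built maximal matching of the graph, and let `m` be its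
size. It is a vertex cover with at most twice the minimum number of vertices. Every path has at most
`2 * m + 1` vertices, and a path without an internal vertex in `C` has at most one internal vertex.
Such short paths amount to edges between vertices and colors, where the vertex `t` stands for the
edge `st`, and compatible short paths form a matching in this bipartite graph.

If `opt > 4 * m`, at most `m` paths of an optimal solution have an internal vertex in `C`, so the
others form a matching of at least `opt - m` edges (`Covers.split`). A matching that admits no
augmenting path with one or three edges has at least two thirds of the maximum size
(`IsStable.two_card_le`), and `2/3 * (opt - m) > 1/2 * opt`. Local search finds such a matching in
polynomial time.

If `opt ≤ 4 * m`, an exhaustive search finds an optimal solution. The shape of a path is guessed as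
a list of at most `m + 1` steps, each giving the next cover vertex (or `t`) and telling whether it
is reached directly or through the `r`-th common neighbor in the color of the path. Outside the
cover only the avoidance of a bounded set matters, so a bounded rank `r` suffices (`exists_steps`).
The color cannot be guessed within the time bound, because the number of colors is not bounded in
`m`. Instead, the first color whose path of the guessed shape is valid and avoids a set `X` of
forbidden colors and vertices is taken. If this path meets the rest `Y` of the optimal solution, one
common element, located by a guessed digit, is added to `X`, and the search is repeated. The set `X`
remains inside the union of `Y` and what is in use, so the optimal color stays available; each
repetition shrinks `Y \ X`, so after boundedly many rounds the path found is disjoint from `Y` and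
can replace the optimal one (`exists_search`, `exists_guess`). Wrong guesses do no harm, because
only valid and compatible paths are ever added. The number of guesses depends on `m` alone.

The algorithm is written in a language with counting loops only. Its meaning is a function on
memories, which makes loop invariants available, and its running time is bounded by a power of the
largest loop limit (`exec_den`). The product of a computable function of the vertex cover number and
the input size bounds all limits. -/

namespace RAM

/-! ### Programs with bounded loops, their denotation and their running time -/

/-- Programs in which every loop is a counting loop. The loop `rep x lim P` keeps its counter in
cell `0` of array `x` and its limit in cell `1` of array `x`. -/
inductive Cmd : Type
  | skip
  | set (a : ℕ) (i e : Expr)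
  | seq (P Q : Cmd)
  | ite (b : Expr) (P Q : Cmd)
  | rep (x : ℕ) (lim : Expr) (P : Cmd)

/-- The memory after writing `v` into cell `i` of array `a`. -/
def put (σ : State) (a i v : ℕ) : State := Function.update σ a (Function.update (σ a) i v)

theorem put_ne {σ : State} {a b i v : ℕ} (h : b ≠ a) : put σ a i v b = σ b := by
  simp [put, h]

theorem put_apply {σ : State} {a b i v j : ℕ} :
    put σ a i v b j = if b = a then if j = i then v else σ a j else σ b j := by
  by_cases h : b = a
  · subst h; simp [put, Function.update_apply]
  · simp [put, h]

theorem put_self {σ : State} {a i v j : ℕ} :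
    put σ a i v a j = if j = i then v else σ a j := by simp [put_apply]

/-- The arrays read by an expression. -/
def Expr.reads : Expr → List ℕ
  | lit _ => []
  | get a i => a :: i.reads
  | add x y => x.reads ++ y.reads
  | sub x y => x.reads ++ y.reads

theorem Expr.eval_congr {σ τ : State} (e : Expr) (h : ∀ a ∈ e.reads, τ a = σ a) :
    e.eval τ = e.eval σ := by
  induction e with
  | lit k => rfl
  | get a i ih =>
    simp only [Expr.reads, List.mem_cons, forall_eq_or_imp] at h
    simp [Expr.eval, h.1, ih h.2]
  | add x y ihx ihy =>
    simp only [Expr.reads, List.mem_append] at h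
    simp [Expr.eval, ihx fun a ha => h a (.inl ha), ihy fun a ha => h a (.inr ha)]
  | sub x y ihx ihy =>
    simp only [Expr.reads, List.mem_append] at h
    simp [Expr.eval, ihx fun a ha => h a (.inl ha), ihy fun a ha => h a (.inr ha)]

namespace Cmd

/-- The effect of a program on the memory. -/
def den : Cmd → State → State
  | skip, σ => σ
  | set a i e, σ => put σ a (i.eval σ) (e.eval σ)
  | seq P Q, σ => Q.den (P.den σ)
  | ite b P Q, σ => if b.eval σ ≠ 0 then P.den σ else Q.den σ
  | .rep x lim P, σ =>
    (fun τ => put (P.den τ) x 0 (P.den τ x 0 + 1))^[lim.eval σ]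
      (put (put σ x 1 (lim.eval σ)) x 0 0)

theorem den_seq (P Q : Cmd) (σ : State) : (seq P Q).den σ = Q.den (P.den σ) := rfl

theorem den_ite (b : Expr) (P Q : Cmd) (σ : State) :
    (ite b P Q).den σ = if b.eval σ ≠ 0 then P.den σ else Q.den σ := rfl

/-- The translation into programs of the machine. -/
def toProg : Cmd → Prog
  | skip => .nop
  | set a i e => .assign a i e
  | seq P Q => .seq P.toProg Q.toProg
  | ite b P Q => .cond b P.toProg Q.toProg
  | .rep x lim P =>
    -- The limit is stored before the counter is cleared, so it is evaluated in the memory in which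
    -- the loop starts. Truncated subtraction of the counter from the limit vanishes exactly when
    -- the loop has to stop.
    .seq (.assign x (.lit 1) lim) (.seq (.assign x (.lit 0) (.lit 0))
      (.loop (.sub (.get x (.lit 1)) (.get x (.lit 0)))
        (.seq P.toProg (.assign x (.lit 0) (.add (.get x (.lit 0)) (.lit 1))))))

/-- The arrays written by a program. -/
def writes : Cmd → List ℕ
  | skip => []
  | set a _ _ => [a]
  | seq P Q => P.writes ++ Q.writes
  | ite _ P Q => P.writes ++ Q.writes
  | .rep x _ P => x :: P.writes

/-- The limits of the loops of a program. -/
def lims : Cmd → List Expr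
  | skip => []
  | set _ _ _ => []
  | seq P Q => P.lims ++ Q.lims
  | ite _ P Q => P.lims ++ Q.lims
  | .rep _ lim P => lim :: P.lims

/-- The arrays read by the limits of the loops of a program. -/
def limReads (P : Cmd) : List ℕ := P.lims.flatMap Expr.reads

/-- Loop counters are not written by the bodies of their loops, and the limits of the loops
are not changed by the program. -/
def Ok : Cmd → Prop
  | skip => True
  | set _ _ _ => True
  | seq P Q => P.Ok ∧ Q.Ok ∧ ∀ a ∈ P.writes, a ∉ Q.limReads
  | ite _ P Q => P.Ok ∧ Q.Ok
  | .rep x _ P => P.Ok ∧ x ∉ P.writes ∧ ∀ a ∈ x :: P.writes, a ∉ P.limReads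

instance decidableOk : (P : Cmd) → Decidable P.Ok
  | skip => .isTrue trivial
  | set _ _ _ => .isTrue trivial
  | seq P Q =>
    have := decidableOk P
    have := decidableOk Q
    inferInstanceAs (Decidable (P.Ok ∧ Q.Ok ∧ ∀ a ∈ P.writes, a ∉ Q.limReads))
  | ite _ P Q =>
    have := decidableOk P
    have := decidableOk Q
    inferInstanceAs (Decidable (P.Ok ∧ Q.Ok))
  | .rep x _ P =>
    have := decidableOk P
    inferInstanceAs (Decidable (P.Ok ∧ x ∉ P.writes ∧ ∀ a ∈ x :: P.writes, a ∉ P.limReads))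

theorem den_frame (P : Cmd) {σ : State} {a : ℕ} (h : a ∉ P.writes) : P.den σ a = σ a := by
  induction P generalizing σ with
  | skip => rfl
  | set b i e => exact put_ne (by simpa [writes] using h)
  | seq P Q ihP ihQ =>
    simp only [writes, List.mem_append, not_or] at h
    rw [den, ihQ h.2, ihP h.1]
  | ite b P Q ihP ihQ =>
    simp only [writes, List.mem_append, not_or] at h
    rw [den]
    split
    exacts [ihP h.1, ihQ h.2]
  | rep x lim P ih =>
    simp only [writes, List.mem_cons, not_or] at h
    rw [den]
    have h0 : (put (put σ x 1 (lim.eval σ)) x 0 0) a = σ a := by rw [put_ne h.1, put_ne h.1]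
    rw [← h0]
    generalize (put (put σ x 1 (lim.eval σ)) x 0 0) = ρ
    generalize lim.eval σ = N
    induction N generalizing ρ with
    | zero => rfl
    | succ N ihN =>
      rw [Function.iterate_succ_apply, ihN, put_ne h.1, ih h.2]

/-- One round of a counting loop. -/
def round (x : ℕ) (P : Cmd) (τ : State) : State := put (P.den τ) x 0 (P.den τ x 0 + 1)

/-- The memory after `k` rounds of a counting loop with limit `N`. -/
def rounds (x : ℕ) (P : Cmd) (N : ℕ) (σ : State) (k : ℕ) : State :=
  (round x P)^[k] (put (put σ x 1 N) x 0 0)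

theorem den_for (x : ℕ) (lim : Expr) (P : Cmd) (σ : State) :
    (Cmd.rep x lim P).den σ = rounds x P (lim.eval σ) σ (lim.eval σ) := rfl

theorem rounds_succ (x : ℕ) (P : Cmd) (N : ℕ) (σ : State) (k : ℕ) :
    rounds x P N σ (k + 1) = round x P (rounds x P N σ k) := Function.iterate_succ_apply' ..

theorem rounds_frame {x : ℕ} {P : Cmd} {N : ℕ} {σ : State} {k a : ℕ} (h : a ∉ x :: P.writes) :
    rounds x P N σ k a = σ a := by
  simp only [List.mem_cons, not_or] at h
  induction k with
  | zero => rw [rounds, Function.iterate_zero_apply, put_ne h.1, put_ne h.1]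
  | succ k ih => rw [rounds_succ, round, put_ne h.1, den_frame _ h.2, ih]

theorem rounds_counter {x : ℕ} {P : Cmd} {N : ℕ} {σ : State} {k : ℕ} (h : x ∉ P.writes) :
    rounds x P N σ k x 0 = k ∧ rounds x P N σ k x 1 = N := by
  induction k with
  | zero => simp [rounds, put_self]
  | succ k ih => simp [rounds_succ, round, put_self, den_frame _ h, ih]

/-- The rule for counting loops: an invariant that ignores the counter. -/
theorem for_rule {x : ℕ} {lim : Expr} {P : Cmd} {σ : State} (J : ℕ → State → Prop)
    (hx : x ∉ P.writes)
    (hJ : ∀ k τ i v, J k τ → J k (put τ x i v))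
    (h0 : J 0 σ)
    (hs : ∀ k < lim.eval σ, ∀ τ : State, (∀ a, a ∉ x :: P.writes → τ a = σ a) → τ x 0 = k →
      J k τ → J (k + 1) (P.den τ)) :
    J (lim.eval σ) ((Cmd.rep x lim P).den σ) := by
  rw [den_for]
  suffices h : ∀ k ≤ lim.eval σ, J k (rounds x P (lim.eval σ) σ k) from h _ le_rfl
  intro k
  induction k with
  | zero => exact fun _ => hJ _ _ _ _ (hJ _ _ _ _ h0)
  | succ k ih =>
    intro hk
    rw [rounds_succ]
    exact hJ _ _ _ _ (hs k hk _ (fun a ha => rounds_frame ha) (rounds_counter hx).1 (ih (by omega)))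

/-! ### Running time of programs with counting loops -/

/-- A factor of the bound on the running time. -/
def coeff : Cmd → ℕ
  | skip => 1
  | set _ i e => i.cost + e.cost + 1
  | seq P Q => P.coeff + Q.coeff
  | ite b P Q => b.cost + 1 + P.coeff + Q.coeff
  | .rep _ lim P => lim.cost + 30 + P.coeff

/-- The nesting depth of the loops. -/
def depth : Cmd → ℕ
  | skip => 0
  | set _ _ _ => 0
  | seq P Q => max P.depth Q.depth
  | ite _ P Q => max P.depth Q.depth
  | .rep _ _ P => P.depth + 1

/-- Unrolling the first round shifts the sequence of memories by one. The test is evaluated once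
more than the body, which gives the summand outside the product. -/
theorem exec_loop {b : Expr} {P : Prog} {N t : ℕ} (τ : ℕ → State)
    (hb : ∀ k < N, b.eval (τ k) ≠ 0) (hN : b.eval (τ N) = 0)
    (hs : ∀ k < N, ∃ T, Exec P (τ k) T (τ (k + 1)) ∧ T ≤ t) :
    ∃ T, Exec (.loop b P) (τ 0) T (τ N) ∧ T ≤ N * (b.cost + 1 + t) + (b.cost + 1) := by
  induction N generalizing τ with
  | zero => exact ⟨_, .loopStop hN, by omega⟩
  | succ N ih =>
    obtain ⟨T, hT, hle⟩ := hs 0 (by omega)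
    obtain ⟨U, hU, hle'⟩ := ih (fun k => τ (k + 1)) (fun k hk => hb _ (by omega)) hN
      (fun k hk => hs _ (by omega))
    refine ⟨_, .loopStep (hb 0 (by omega)) hT hU, ?_⟩
    rw [Nat.succ_mul]
    omega

/-- A program whose loop limits are at most `M` halts after `O(M ^ depth)` steps. -/
theorem exec_den (P : Cmd) (hP : P.Ok) {M : ℕ} (hM : 1 ≤ M) (σ : State)
    (hl : ∀ e ∈ P.lims, e.eval σ ≤ M) :
    ∃ T, Exec P.toProg σ T (P.den σ) ∧ T ≤ P.coeff * M ^ P.depth := by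
  induction P generalizing σ with
  | skip => exact ⟨_, .nop σ, by simp [coeff, depth]⟩
  | set a i e => exact ⟨_, .assign a i e σ, by simp [coeff, depth]⟩
  | seq P Q ihP ihQ =>
    obtain ⟨h1, h2, h3⟩ := hP
    simp only [lims, List.mem_append] at hl
    obtain ⟨T, hT, hTle⟩ := ihP h1 σ fun e he => hl e (.inl he)
    -- The limits of `Q` are bounded in `σ`, but `Q` starts in `P.den σ`. By `Ok`, `P` writes no
    -- array that these limits read, so their values are the same in both memories.
    obtain ⟨U, hU, hUle⟩ := ihQ h2 (P.den σ) fun e he => by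
      rw [Expr.eval_congr (σ := σ) e fun a ha => ?_]
      · exact hl e (.inr he)
      · exact den_frame _ fun hw => h3 a hw (List.mem_flatMap.2 ⟨e, he, ha⟩)
    refine ⟨_, .seq hT hU, ?_⟩
    have e1 : M ^ P.depth ≤ M ^ (max P.depth Q.depth) := Nat.pow_le_pow_right hM (le_max_left ..)
    have e2 : M ^ Q.depth ≤ M ^ (max P.depth Q.depth) := Nat.pow_le_pow_right hM (le_max_right ..)
    calc T + U ≤ P.coeff * M ^ P.depth + Q.coeff * M ^ Q.depth := by omega
      _ ≤ P.coeff * M ^ (max P.depth Q.depth) + Q.coeff * M ^ (max P.depth Q.depth) := by gcongr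
      _ = _ := by simp [coeff, depth, add_mul]
  | ite b P Q ihP ihQ =>
    obtain ⟨h1, h2⟩ := hP
    simp only [lims, List.mem_append] at hl
    have e0 : 1 ≤ M ^ (max P.depth Q.depth) := Nat.one_le_pow _ _ hM
    have e1 : M ^ P.depth ≤ M ^ (max P.depth Q.depth) := Nat.pow_le_pow_right hM (le_max_left ..)
    have e2 : M ^ Q.depth ≤ M ^ (max P.depth Q.depth) := Nat.pow_le_pow_right hM (le_max_right ..)
    simp only [coeff, depth, den, toProg]
    by_cases hb : b.eval σ ≠ 0
    · obtain ⟨T, hT, hTle⟩ := ihP h1 σ fun e he => hl e (.inl he)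
      rw [if_pos hb]
      refine ⟨_, .condTrue hb hT, ?_⟩
      have := Nat.mul_le_mul_left P.coeff e1
      have := Nat.mul_le_mul_left (b.cost + 1) e0
      simp only [add_mul] at *
      omega
    · obtain ⟨T, hT, hTle⟩ := ihQ h2 σ fun e he => hl e (.inr he)
      rw [if_neg hb]
      refine ⟨_, .condFalse (by simpa using hb) hT, ?_⟩
      have := Nat.mul_le_mul_left Q.coeff e2
      have := Nat.mul_le_mul_left (b.cost + 1) e0
      simp only [add_mul] at *
      omega
  | rep x lim P ih =>
    obtain ⟨h1, h2, h3⟩ := hP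
    simp only [lims, List.mem_cons, forall_eq_or_imp] at hl
    have hbody : ∀ k < lim.eval σ, ∃ T,
        Exec (.seq P.toProg (.assign x (.lit 0) (.add (.get x (.lit 0)) (.lit 1))))
          (rounds x P (lim.eval σ) σ k) T (rounds x P (lim.eval σ) σ (k + 1)) ∧
          T ≤ P.coeff * M ^ P.depth + 6 := by
      intro k _
      obtain ⟨T, hT, hTle⟩ := ih h1 (rounds x P (lim.eval σ) σ k) fun e he => by
        rw [Expr.eval_congr (σ := σ) e fun a ha => ?_]
        · exact hl.2 e he
        · exact rounds_frame fun hw => h3 a hw (List.mem_flatMap.2 ⟨e, he, ha⟩)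
      rw [rounds_succ]
      exact ⟨_, .seq hT (.assign ..), by simp only [Expr.cost]; omega⟩
    obtain ⟨T, hT, hTle⟩ := exec_loop (b := .sub (.get x (.lit 1)) (.get x (.lit 0)))
      (rounds x P (lim.eval σ) σ)
      (fun k hk => by simp only [Expr.eval, rounds_counter h2]; omega)
      (by simp only [Expr.eval, rounds_counter h2]; omega) hbody
    refine ⟨_, .seq (.assign ..) (.seq (.assign ..) hT), ?_⟩
    -- Each round has an overhead of 12 steps for the test and the counter; the two assignments and
    -- the last test add 11 steps and the cost of the limit. The constant 30 in `coeff` covers both.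
    simp only [Expr.cost, coeff, depth, pow_succ] at hTle ⊢
    have e0 : 1 ≤ M ^ P.depth := Nat.one_le_pow _ _ hM
    have e1 := Nat.mul_le_mul_right (1 + 1 + (1 + 1) + 1 + 1 + (P.coeff * M ^ P.depth + 6)) hl.1
    have e2 : M * 1 ≤ M * (M ^ P.depth) := by gcongr
    have e3 : 1 ≤ M * M ^ P.depth := Nat.mul_pos hM e0
    have e4 : lim.cost * 1 ≤ lim.cost * (M * M ^ P.depth) := by gcongr
    rw [mul_comm (M ^ P.depth) M, add_mul, add_mul]
    have e5 : M * (1 + 1 + (1 + 1) + 1 + 1 + (P.coeff * M ^ P.depth + 6)) =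
        12 * M + P.coeff * (M * M ^ P.depth) := by ring
    omega

end Cmd
end RAM

/-! ### Solutions as lists of natural numbers -/

namespace CDDP

variable (I : CDDP)

/-- `uv` is an edge of color `c`; vertices and colors are given as natural numbers. -/
def Col (c u v : ℕ) : Prop :=
  ∃ (hu : u < I.n) (hv : v < I.n) (hc : c < I.q), I.HasColor ⟨u, hu⟩ ⟨v, hv⟩ ⟨c, hc⟩

variable {I}

theorem Col.symm {c u v : ℕ} (h : I.Col c u v) : I.Col c v u := by
  obtain ⟨hu, hv, hc, ha, h⟩ := h
  refine ⟨hv, hu, hc, ha.symm, ?_⟩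
  have : (⟨s(⟨v, hv⟩, ⟨u, hu⟩), ha.symm⟩ : I.G.edgeSet) = ⟨s(⟨u, hu⟩, ⟨v, hv⟩), ha⟩ :=
    Subtype.ext Sym2.eq_swap
  rwa [this]

theorem Col.ne {c u v : ℕ} (h : I.Col c u v) : u ≠ v := by
  rintro rfl
  obtain ⟨hu, hv, hc, ha, -⟩ := h
  exact ha.ne rfl

variable (I)

/-- The list `l` of vertices is an `st`-path colored by `c`. -/
structure IsRoute (c : ℕ) (l : List ℕ) : Prop where
  nodup : l.Nodup
  head : l.head? = some (I.s : ℕ)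
  last : l.getLast? = some (I.t : ℕ)
  chain : l.IsChain (I.Col c)

/-- What a path occupies: its color (shifted by the number of vertices), and its internal vertices
or, if it has none, the vertex `t`. -/
def keys (p : ℕ × List ℕ) : List ℕ :=
  (I.n + p.1) :: (p.2.drop 1).take (max 1 (p.2.length - 2))

/-- Lists of vertex lists with colors that are solutions. -/
def IsPacking (S : List (ℕ × List ℕ)) : Prop :=
  (∀ p ∈ S, I.IsRoute p.1 p.2) ∧ S.Pairwise fun p p' => (I.keys p).Disjoint (I.keys p')

/-- The output word of a packing. -/
def word (S : List (ℕ × List ℕ)) : List ℕ :=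
  S.length :: S.flatMap fun p => p.1 :: p.2.length :: p.2

/-- The underlying list of a colored path. -/
def raw (x : I.G.Path I.s I.t × Fin I.q) : ℕ × List ℕ := (x.2, x.1.1.support.map Fin.val)

theorem encodeSolution_eq (S : List (I.G.Path I.s I.t × Fin I.q)) :
    I.encodeSolution S = word (S.map I.raw) := by
  simp only [encodeSolution, word, List.flatMap_map, raw, List.length_map, List.cons.injEq,
    true_and]
  congr 1
  funext x
  simp [List.map_eq_flatMap]

variable {I}

theorem mem_keys {p : ℕ × List ℕ} {x : ℕ} : x ∈ I.keys p ↔ x = I.n + p.1 ∨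
    ∃ i, (i = 1 ∨ 1 ≤ i ∧ i + 1 < p.2.length) ∧ p.2[i]? = some x := by
  simp only [keys, List.mem_cons]
  refine or_congr_right ?_
  rw [List.mem_iff_getElem?]
  simp only [List.getElem?_take, List.getElem?_drop]
  constructor
  · rintro ⟨i, hi⟩
    split_ifs at hi with h
    exact ⟨1 + i, by omega, hi⟩
  · rintro ⟨i, hi, h⟩
    refine ⟨i - 1, ?_⟩
    rw [if_pos (by omega), ← h]
    congr 1
    omega

theorem IsRoute.two_le {c : ℕ} {l : List ℕ} (h : I.IsRoute c l) : 2 ≤ l.length := by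
  obtain ⟨-, h1, h2, -⟩ := h
  match l, h1, h2 with
  | [], h1, _ => simp at h1
  | [x], h1, h2 =>
    simp only [List.head?_cons, Option.some.injEq, List.getLast?_singleton] at h1 h2
    exact absurd (Fin.ext (h1.symm.trans h2)) I.s_ne_t
  | _ :: _ :: _, _, _ => simp

theorem IsRoute.head_get {c : ℕ} {l : List ℕ} (h : I.IsRoute c l) : l[0]? = some (I.s : ℕ) := by
  rw [← h.head, List.head?_eq_getElem?]

theorem IsRoute.last_get {c : ℕ} {l : List ℕ} (h : I.IsRoute c l) :
    l[l.length - 1]? = some (I.t : ℕ) := by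
  rw [← h.last, List.getLast?_eq_getElem?]

theorem IsRoute.col {c : ℕ} {l : List ℕ} (h : I.IsRoute c l) {i : ℕ} (hi : i + 1 < l.length) :
    I.Col c l[i] l[i + 1] := h.chain.getElem i hi

theorem IsRoute.color_lt {c : ℕ} {l : List ℕ} (h : I.IsRoute c l) : c < I.q :=
  (h.col (i := 0) h.two_le).2.2.1

theorem IsRoute.lt {c : ℕ} {l : List ℕ} (h : I.IsRoute c l) {x : ℕ} (hx : x ∈ l) : x < I.n := by
  obtain ⟨i, hi, rfl⟩ := List.getElem_of_mem hx
  have := h.two_le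
  rcases Nat.lt_or_ge (i + 1) l.length with h' | h'
  · exact (h.col h').1
  · obtain ⟨j, rfl⟩ : ∃ j, i = j + 1 := ⟨i - 1, by omega⟩
    exact (h.col hi).2.1

theorem IsRoute.length_le {c : ℕ} {l : List ℕ} (h : I.IsRoute c l) : l.length ≤ I.n := by
  have := List.Subperm.length_le (h.nodup.subperm (l₂ := List.range I.n)
    fun x hx => List.mem_range.2 (h.lt hx))
  simpa using this

theorem IsRoute.second_mem {c : ℕ} {l : List ℕ} (h : I.IsRoute c l) :
    l[1]'h.two_le ∈ I.keys (c, l) :=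
  mem_keys.2 (.inr ⟨1, .inl rfl, List.getElem?_eq_getElem _⟩)

theorem color_mem_keys (p : ℕ × List ℕ) : I.n + p.1 ∈ I.keys p := List.mem_cons_self

theorem isRoute_raw {x : I.G.Path I.s I.t × Fin I.q} (h : I.ColoredBy x.1 x.2) :
    I.IsRoute (I.raw x).1 (I.raw x).2 where
  nodup := (List.nodup_map_iff Fin.val_injective).2 x.1.2.support_nodup
  head := by
    rw [raw, List.head?_map, List.head?_eq_some_head x.1.1.support_ne_nil]
    simp
  last := by
    rw [raw, List.getLast?_map, List.getLast?_eq_some_getLast x.1.1.support_ne_nil]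
    simp
  chain := by
    obtain ⟨⟨p, hp⟩, c⟩ := x
    simp only [raw]
    rw [List.isChain_map]
    have key : ∀ {u v : Fin I.n} (p : I.G.Walk u v),
        (∀ e, ∀ h : e ∈ p.edges, c ∈ I.col ⟨e, p.edges_subset_edgeSet h⟩) →
        p.support.IsChain fun a b : Fin I.n => I.Col c a b := by
      intro u v p
      induction p with
      | nil => simp
      | cons ha p ih =>
        intro h
        rw [SimpleGraph.Walk.support_cons, List.isChain_cons]
        refine ⟨?_, ih fun e he => h e (by simp [he])⟩
        intro y hy
        rw [List.head?_eq_some_head p.support_ne_nil] at hy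
        simp only [SimpleGraph.Walk.head_support, Option.mem_def, Option.some.injEq] at hy
        subst hy
        exact ⟨Fin.is_lt _, Fin.is_lt _, Fin.is_lt _, ha, h _ (by simp)⟩
    exact key p h

/-- The walk is rebuilt edge by edge along the list, with the endpoints generalized for the
induction. Together with `isRoute_raw` this permits working with lists of numbers, as the machine
does. -/
theorem IsRoute.exists_raw {c : ℕ} {l : List ℕ} (h : I.IsRoute c l) :
    ∃ x : I.G.Path I.s I.t × Fin I.q, I.ColoredBy x.1 x.2 ∧ I.raw x = (c, l) := by
  have hc := h.color_lt
  have key : ∀ (l : List ℕ) (u v : Fin I.n), l.head? = some (u : ℕ) →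
      l.getLast? = some (v : ℕ) → l.IsChain (I.Col c) → ∃ p : I.G.Walk u v,
      p.support.map Fin.val = l ∧
      ∀ e, ∀ h : e ∈ p.edges, (⟨c, hc⟩ : Fin I.q) ∈ I.col ⟨e, p.edges_subset_edgeSet h⟩ := by
    intro l
    induction l with
    | nil => simp
    | cons a l ih =>
      intro u v h1 h2 h3
      simp only [List.head?_cons, Option.some.injEq] at h1
      subst h1
      cases l with
      | nil =>
        simp only [List.getLast?_singleton, Option.some.injEq] at h2
        obtain rfl := Fin.ext h2
        exact ⟨.nil, by simp, by simp⟩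
      | cons b l =>
        rw [List.isChain_cons_cons] at h3
        obtain ⟨hu, hb, hc', ha, hcol⟩ := h3.1
        obtain ⟨p, hp, hpc⟩ := ih ⟨b, hb⟩ v rfl (by simpa using h2) h3.2
        refine ⟨.cons ha p, by simp [hp], ?_⟩
        intro e he
        simp only [SimpleGraph.Walk.edges_cons, List.mem_cons] at he
        rcases he with rfl | he
        · exact hcol
        · exact hpc e he
  obtain ⟨p, hp, hpc⟩ := key l I.s I.t h.head h.last h.chain
  refine ⟨⟨⟨p, ?_⟩, ⟨c, hc⟩⟩, hpc, by simp [raw, hp]⟩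
  rw [SimpleGraph.Walk.isPath_def, ← List.nodup_map_iff Fin.val_injective, hp]
  exact h.nodup

/-- A vertex among the keys of a path that is not internal is the vertex `t` of the path `st`. -/
theorem IsRoute.eq_of_key {c : ℕ} {l : List ℕ} (h : I.IsRoute c l) {i x : ℕ}
    (hi : i = 1 ∨ 1 ≤ i ∧ i + 1 < l.length) (hx : l[i]? = some x) :
    x ≠ I.s ∧ (x = I.t → l = [(I.s : ℕ), (I.t : ℕ)]) := by
  have h0 := h.head_get
  have h1 := h.last_get
  have h2 := h.two_le
  obtain ⟨hil, rfl⟩ := List.getElem?_eq_some_iff.1 hx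
  constructor
  · intro he
    rw [← he] at h0
    have := ((List.getElem?_inj (by omega) h.nodup).1 (h0.trans hx.symm) : 0 = i)
    omega
  · intro he
    rw [← he] at h1
    have h3 := ((List.getElem?_inj (by omega) h.nodup).1 (h1.trans hx.symm) : l.length - 1 = i)
    have h4 : l.length = 2 := by omega
    obtain ⟨a, b, rfl⟩ := List.length_eq_two.1 h4
    have h5 := h.head_get
    have h6 := h.last_get
    simp at h5 h6
    simp [h5, h6]

theorem mem_keys_of_internal {c : ℕ} {l : List ℕ} (h : I.IsRoute c l) {x : ℕ} (hx : x ∈ l)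
    (hs : x ≠ I.s) (ht : x ≠ I.t) : x ∈ I.keys (c, l) := by
  obtain ⟨i, hi, rfl⟩ := List.getElem_of_mem hx
  refine mem_keys.2 (.inr ⟨i, .inr ⟨?_, ?_⟩, List.getElem?_eq_getElem _⟩)
  · by_contra! h0
    obtain rfl : i = 0 := by omega
    have := h.head_get
    rw [List.getElem?_eq_getElem hi] at this
    exact hs (by simpa using this)
  · by_contra h0
    change ¬ (i + 1 < l.length) at h0
    obtain rfl : i = l.length - 1 := by omega
    have := h.last_get
    rw [List.getElem?_eq_getElem hi] at this
    exact ht (by simpa using this)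

/-- Keys merge the three demands on a pair of paths into one. The shift by `n` separates colors from
vertices. Equal paths share their second vertex, which is always a key. Conversely, `t` is a key
only of the path `st`, so a common key `t` would force equal paths, and any other common vertex
among the keys is internal to both. -/
theorem keys_disjoint_iff {x y : I.G.Path I.s I.t × Fin I.q} (hx : I.ColoredBy x.1 x.2)
    (hy : I.ColoredBy y.1 y.2) : (I.keys (I.raw x)).Disjoint (I.keys (I.raw y)) ↔
      x.1 ≠ y.1 ∧ I.InternallyDisjoint x.1 y.1 ∧ x.2 ≠ y.2 := by
  have hx' := isRoute_raw hx
  have hy' := isRoute_raw hy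
  constructor
  · intro h
    refine ⟨?_, ?_, ?_⟩
    · intro he
      have he' : (I.raw x).2 = (I.raw y).2 := by simp [raw, he]
      have h1 := hx'.second_mem
      have h2 := hy'.second_mem
      simp only [← he'] at h2
      refine h h1 (mem_keys.2 (.inr ?_))
      rw [← he']
      exact ⟨1, .inl rfl, List.getElem?_eq_getElem _⟩
    · intro v hv hv'
      by_contra! hne
      exact h (mem_keys_of_internal hx' (List.mem_map_of_mem hv)
          (fun h => hne.1 (Fin.ext h)) (fun h => hne.2 (Fin.ext h)))
        (mem_keys_of_internal hy' (List.mem_map_of_mem hv')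
          (fun h => hne.1 (Fin.ext h)) (fun h => hne.2 (Fin.ext h)))
    · intro he
      have h1 := color_mem_keys (I := I) (I.raw x)
      have h2 := color_mem_keys (I := I) (I.raw y)
      have h3 : (I.raw x).1 = (I.raw y).1 := by simp [raw, he]
      rw [h3] at h1
      exact h h1 h2
  · rintro ⟨h1, h2, h3⟩ k hk hk'
    rw [mem_keys] at hk hk'
    rcases hk with rfl | ⟨i, hi, hik⟩ <;> rcases hk' with hk' | ⟨j, hj, hjk⟩
    · exact h3 (Fin.ext (by simpa [raw] using hk'))
    · have := hy'.lt (List.mem_of_getElem? hjk)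
      omega
    · have := hx'.lt (List.mem_of_getElem? hik)
      omega
    · have h4 := hx'.eq_of_key hi hik
      have h5 := hy'.eq_of_key hj hjk
      obtain ⟨v, hv, rfl⟩ := List.mem_map.1 (List.mem_of_getElem? hik)
      obtain ⟨w, hw, hwv⟩ := List.mem_map.1 (List.mem_of_getElem? hjk)
      obtain rfl := Fin.ext hwv
      rcases h2 _ hv hw with rfl | rfl
      · exact h4.1 rfl
      · apply h1
        have he : (I.raw x).2 = (I.raw y).2 := (h4.2 rfl).trans (h5.2 rfl).symm
        exact Subtype.ext (SimpleGraph.Walk.ext_support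
          (List.map_injective_iff.2 Fin.val_injective he))

theorem IsSolution.isPacking {S : List (I.G.Path I.s I.t × Fin I.q)} (h : I.IsSolution S) :
    I.IsPacking (S.map I.raw) := by
  refine ⟨?_, ?_⟩
  · intro p hp
    obtain ⟨x, hx, rfl⟩ := List.mem_map.1 hp
    exact isRoute_raw (h.1 x hx)
  · rw [List.pairwise_map]
    exact h.2.imp_of_mem fun hx hy hxy => (keys_disjoint_iff (h.1 _ hx) (h.1 _ hy)).2 hxy

theorem IsPacking.exists_solution {S : List (ℕ × List ℕ)} (h : I.IsPacking S) :
    ∃ S' : List (I.G.Path I.s I.t × Fin I.q), I.IsSolution S' ∧ S'.map I.raw = S := by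
  have h1 : ∀ S : List (ℕ × List ℕ), (∀ p ∈ S, I.IsRoute p.1 p.2) →
      ∃ S' : List (I.G.Path I.s I.t × Fin I.q), (∀ x ∈ S', I.ColoredBy x.1 x.2) ∧
        S'.map I.raw = S := by
    intro S
    induction S with
    | nil => exact fun _ => ⟨[], by simp⟩
    | cons p S ih =>
      intro h
      obtain ⟨x, hx, hxp⟩ := (h p (by simp)).exists_raw
      obtain ⟨S', hS', rfl⟩ := ih fun p hp => h p (by simp [hp])
      exact ⟨x :: S', by simpa using ⟨hx, by simpa using hS'⟩, by simp [hxp]⟩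
  obtain ⟨S', hS', rfl⟩ := h1 S h.1
  refine ⟨S', ⟨hS', ?_⟩, rfl⟩
  have := h.2
  rw [List.pairwise_map] at this
  exact this.imp_of_mem fun hx hy hxy => (keys_disjoint_iff (hS' _ hx) (hS' _ hy)).1 hxy

end CDDP

/-! ### Two- and three-step matchings between vertices and colors -/

namespace CDDP

variable {I : CDDP}

variable (I) in
/-- The vertex `x` and the color `c` give a path with at most one internal vertex; `x = t` stands
for the edge `st`. -/
def Short (x c : ℕ) : Prop := I.Col c I.s x ∧ (x = I.t ∨ I.Col c x I.t)

variable (I) in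
/-- The path given by a vertex. -/
def shortPath (x : ℕ) : List ℕ := if x = I.t then [(I.s : ℕ), (I.t : ℕ)] else [(I.s : ℕ), x, (I.t : ℕ)]

theorem Short.isRoute {x c : ℕ} (h : I.Short x c) : I.IsRoute c (I.shortPath x) := by
  have hst : (I.s : ℕ) ≠ I.t := fun h => I.s_ne_t (Fin.ext h)
  unfold shortPath
  split_ifs with hx
  · subst hx
    exact ⟨by simpa using hst, rfl, rfl, by simpa using h.1⟩
  · have h2 := h.2.resolve_left hx
    exact ⟨by simp [hst, h.1.ne, h2.ne], rfl, rfl, by simpa using ⟨h.1, h2⟩⟩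

theorem keys_shortPath (x c : ℕ) : I.keys (c, I.shortPath x) = [I.n + c, x] := by
  unfold shortPath keys
  split_ifs with hx <;> simp [hx]

variable (I) in
/-- `mc` describes a matching: `mc c = x + 1` if `c` is matched with `x`, and `0` if `c` is free. -/
structure IsMatch (mc : ℕ → ℕ) : Prop where
  short : ∀ c < I.q, ∀ x, mc c = x + 1 → I.Short x c
  inj : ∀ c < I.q, ∀ d < I.q, mc c ≠ 0 → mc c = mc d → c = d

/-- The number of colors below `q` matched by `mc`. -/
def matchSize (q : ℕ) (mc : ℕ → ℕ) : ℕ := ((Finset.range q).filter fun c => mc c ≠ 0).card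

variable (I) in
/-- No augmentation by one or three edges is possible. -/
structure IsStable (mc : ℕ → ℕ) : Prop where
  one : ∀ d < I.q, ∀ y, mc d = 0 → (∀ c < I.q, mc c ≠ y + 1) → ¬ I.Short y d
  three : ∀ c < I.q, ∀ d < I.q, ∀ x y, mc c = x + 1 → mc d = 0 → (∀ c < I.q, mc c ≠ y + 1) →
    I.Short y c → ¬ I.Short x d

/-- Call a vertex or a color matched if `mc` covers it. At most `|M|` edges of `A` have a matched
color, and at most `|M|` have a matched vertex. An edge with a free end has its other end matched,
and the matching edges at these other ends are pairwise different, since a coincidence would give an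
augmenting path with three edges; so at most `|M|` edges have a free end. Adding the three estimates
counts every edge of `A` twice. -/
theorem IsStable.two_card_le {mc : ℕ → ℕ} (hs : I.IsStable mc) (hm : I.IsMatch mc)
    (A : Finset (ℕ × ℕ)) (hA : ∀ p ∈ A, I.Short p.1 p.2)
    (h1 : Set.InjOn Prod.fst (A : Set (ℕ × ℕ))) (h2 : Set.InjOn Prod.snd (A : Set (ℕ × ℕ))) :
    2 * A.card ≤ 3 * matchSize I.q mc := by
  classical
  set M := (Finset.range I.q).filter fun c => mc c ≠ 0 with hM
  -- The elements of `V` are the matched vertices shifted by one, as in the values of `mc`.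
  set V := M.image mc with hV
  have hq : ∀ p ∈ A, p.2 < I.q := fun p hp => (hA p hp).1.2.2.1
  have hVM : V.card = M.card := by
    refine Finset.card_image_of_injOn ?_
    intro c hc d hd h
    simp only [hM, Finset.coe_filter, Finset.mem_range, Set.mem_ofPred_eq] at hc hd
    exact hm.inj c hc.1 d hd.1 hc.2 h
  have hMmem : ∀ c, c ∈ M ↔ c < I.q ∧ mc c ≠ 0 := by simp [hM]
  have hVmem : ∀ y, y + 1 ∈ V ↔ ∃ c < I.q, mc c = y + 1 := by
    intro y
    simp only [hV, Finset.mem_image, hMmem]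
    constructor
    · rintro ⟨c, hc, h⟩; exact ⟨c, hc.1, h⟩
    · rintro ⟨c, hc, h⟩; exact ⟨c, ⟨hc, by omega⟩, h⟩
  set A1 := A.filter fun p => p.2 ∈ M with hA1
  set A2 := A.filter fun p => p.1 + 1 ∈ V with hA2
  set B1 := A.filter fun p => p.1 + 1 ∉ V with hB1
  set B2 := A.filter fun p => p.2 ∉ M with hB2
  have e1 : A1.card ≤ M.card := by
    refine Finset.card_le_card_of_injOn Prod.snd (fun p hp => (Finset.mem_filter.1 hp).2) ?_
    exact h2.mono fun p hp => (Finset.mem_filter.1 hp).1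
  have e2 : A2.card ≤ V.card := by
    refine Finset.card_le_card_of_injOn (fun p => p.1 + 1) (fun p hp => (Finset.mem_filter.1 hp).2) ?_
    intro p hp p' hp' h
    exact h1 (Finset.mem_filter.1 hp).1 (Finset.mem_filter.1 hp').1 (by simpa using h)
  have hone : ∀ p ∈ A, p.2 ∈ M ∨ p.1 + 1 ∈ V := by
    intro p hp
    by_contra! h
    refine hs.one p.2 (hq p hp) p.1 ?_ ?_ (hA p hp)
    · by_contra h'
      exact h.1 ((hMmem _).2 ⟨hq p hp, h'⟩)
    · intro c hc h'
      exact h.2 ((hVmem _).2 ⟨c, hc, h'⟩)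
  -- Edges in `B1` have a free vertex and are charged to the mate of their color; edges in `B2` have
  -- a free color and are charged to their own vertex. If both charges coincide at some `x`, the
  -- free vertex of the first edge, its color, `x`, and the free color of the second edge form an
  -- augmenting path.
  have e3 : B1.card + B2.card ≤ V.card := by
    have hB1M : ∀ p ∈ B1, p ∈ A ∧ p.2 ∈ M ∧ p.1 + 1 ∉ V := by
      intro p hp
      obtain ⟨hp, h⟩ := Finset.mem_filter.1 hp
      exact ⟨hp, (hone p hp).resolve_right h, h⟩
    have hB2V : ∀ p ∈ B2, p ∈ A ∧ p.2 ∉ M ∧ p.1 + 1 ∈ V := by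
      intro p hp
      obtain ⟨hp, h⟩ := Finset.mem_filter.1 hp
      exact ⟨hp, h, (hone p hp).resolve_left h⟩
    have i1 : (B1.image fun p => mc p.2).card = B1.card := by
      refine Finset.card_image_of_injOn ?_
      intro p hp p' hp' h
      obtain ⟨ha, hm1, -⟩ := hB1M p hp
      obtain ⟨ha', hm1', -⟩ := hB1M p' hp'
      rw [hMmem] at hm1 hm1'
      exact h2 ha ha' (hm.inj _ hm1.1 _ hm1'.1 hm1.2 h)
    have i2 : (B2.image fun p => p.1 + 1).card = B2.card := by
      refine Finset.card_image_of_injOn ?_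
      intro p hp p' hp' h
      exact h1 (hB2V p hp).1 (hB2V p' hp').1 (by simpa using h)
    rw [← i1, ← i2, ← Finset.card_union_of_disjoint]
    · refine Finset.card_le_card (Finset.union_subset ?_ ?_)
      · intro y hy
        obtain ⟨p, hp, rfl⟩ := Finset.mem_image.1 hy
        exact Finset.mem_image_of_mem _ (hB1M p hp).2.1
      · intro y hy
        obtain ⟨p, hp, rfl⟩ := Finset.mem_image.1 hy
        exact (hB2V p hp).2.2
    · rw [Finset.disjoint_left]
      intro y hy hy'
      obtain ⟨p, hp, rfl⟩ := Finset.mem_image.1 hy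
      obtain ⟨p', hp', h⟩ := Finset.mem_image.1 hy'
      obtain ⟨ha, hm1, hv⟩ := hB1M p hp
      obtain ⟨ha', hm1', -⟩ := hB2V p' hp'
      rw [hMmem] at hm1 hm1'
      rw [hVmem] at hv
      refine hs.three p.2 hm1.1 p'.2 (hq p' ha') p'.1 p.1 h.symm ?_ (fun c hc h' => hv ⟨c, hc, h'⟩)
        (hA p ha) (hA p' ha')
      by_contra h'
      exact hm1' ⟨hq p' ha', h'⟩
  have f1 : A2.card + B1.card = A.card := Finset.card_filter_add_card_filter_not ..
  have f2 : A1.card + B2.card = A.card := Finset.card_filter_add_card_filter_not ..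
  have : matchSize I.q mc = M.card := rfl
  omega

/-! ### Vertex covers and paths -/

/-- A set of vertices that contains an end of every colored edge. -/
def Covers (I : CDDP) (C : Finset ℕ) : Prop := ∀ c u v, I.Col c u v → u ∈ C ∨ v ∈ C

/-- Of two consecutive vertices one lies in the cover. The recursion removes either one cover vertex
or a pair whose second vertex is in the cover. -/
theorem Covers.length_le_filter {C : Finset ℕ} (hC : I.Covers C) {c : ℕ} : ∀ l : List ℕ,
    l.IsChain (I.Col c) → l.length ≤ 2 * (l.filter (· ∈ C)).length + 1
  | [], _ => by simp
  | [x], _ => by simp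
  | x :: y :: l, h => by
    rw [List.isChain_cons_cons] at h
    by_cases hx : x ∈ C
    · have := hC.length_le_filter (y :: l) h.2
      rw [List.filter_cons_of_pos (by simpa using hx)]
      simp only [List.length_cons] at this ⊢
      omega
    · have hy := (hC c x y h.1).resolve_left hx
      have := hC.length_le_filter l h.2.of_cons
      rw [List.filter_cons_of_neg (by simpa using hx), List.filter_cons_of_pos (by simpa using hy)]
      simp only [List.length_cons] at this ⊢
      omega

theorem length_filter_mem_le {C : Finset ℕ} {l : List ℕ} (h : l.Nodup) :
    (l.filter (· ∈ C)).length ≤ C.card := by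
  rw [← List.toFinset_card_of_nodup (h.filter _)]
  exact Finset.card_le_card fun x hx => by simpa using (List.mem_filter.1 (List.mem_toFinset.1 hx)).2

theorem Covers.length_le {C : Finset ℕ} (hC : I.Covers C) {c : ℕ} {l : List ℕ}
    (h : I.IsRoute c l) : l.length ≤ 2 * C.card + 1 := by
  have := hC.length_le_filter l h.chain
  have := length_filter_mem_le (C := C) h.nodup
  omega

theorem length_keys_le {c : ℕ} {l : List ℕ} (h : I.IsRoute c l) :
    (I.keys (c, l)).length ≤ l.length := by
  have := h.two_le
  simp only [keys, List.length_cons, List.length_take, List.length_drop]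
  omega

/-- A path without internal vertices in the cover has at most one internal vertex. -/
theorem Covers.short_of_keys {C : Finset ℕ} (hC : I.Covers C) {c : ℕ} {l : List ℕ}
    (h : I.IsRoute c l) (hl : ∀ x ∈ l, x ∈ C → x = I.s ∨ x = I.t) :
    ∃ x, x ∈ I.keys (c, l) ∧ I.Short x c := by
  have h2 := h.two_le
  have hlast := h.last
  have hhead := h.head
  match l, h with
  | [a, b], h =>
    refine ⟨b, h.second_mem, ?_⟩
    simp only [List.head?_cons, Option.some.injEq, List.getLast?_cons_cons,
      List.getLast?_singleton] at hhead hlast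
    have := h.chain
    simp only [List.isChain_cons_cons] at this
    exact ⟨hhead ▸ this.1, .inl hlast⟩
  | [a, b, d], h =>
    refine ⟨b, h.second_mem, ?_⟩
    simp only [List.head?_cons, Option.some.injEq, List.getLast?_cons_cons,
      List.getLast?_singleton] at hhead hlast
    have := h.chain
    simp only [List.isChain_cons_cons] at this
    exact ⟨hhead ▸ this.1, .inr (hlast ▸ this.2.1)⟩
  -- With four or more vertices, `b` and `d` are adjacent internal vertices, and the cover contains
  -- one of them.
  | a :: b :: d :: e :: l, h =>
    exfalso
    have hnd := h.nodup
    have hch := h.chain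
    simp only [List.head?_cons, Option.some.injEq, List.getLast?_cons_cons] at hhead hlast
    have ht : (I.t : ℕ) ∈ e :: l := List.mem_of_getLast? hlast
    simp only [List.isChain_cons_cons] at hch
    simp only [List.nodup_cons, List.mem_cons, not_or] at hnd
    have hb : b ≠ I.t := by rintro rfl; simp only [List.mem_cons] at ht; tauto
    have hd : d ≠ I.t := by rintro rfl; simp only [List.mem_cons] at ht; tauto
    have hb' : b ≠ I.s := by rintro rfl; tauto
    have hd' : d ≠ I.s := by rintro rfl; tauto
    rcases hC _ _ _ hch.2.1 with h' | h'
    · have := hl b (by simp) h'; tauto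
    · have := hl d (by simp) h'; tauto

/-- At most as many paths as there are cover vertices have an internal vertex in the cover; the
others form a matching. -/
theorem Covers.split {C : Finset ℕ} (hC : I.Covers C) {S : List (ℕ × List ℕ)}
    (hS : I.IsPacking S) : ∃ A : Finset (ℕ × ℕ), (∀ p ∈ A, I.Short p.1 p.2) ∧
      Set.InjOn Prod.fst (A : Set (ℕ × ℕ)) ∧ Set.InjOn Prod.snd (A : Set (ℕ × ℕ)) ∧
      S.length ≤ C.card + A.card := by
  classical
  -- For the induction, every element of `A` and of `D` is traced back to keys of a path in `S`. As
  -- the keys of a new path are disjoint from these, its edge of the matching or its cover vertex is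
  -- new.
  have key : ∀ S : List (ℕ × List ℕ), I.IsPacking S → ∃ (A : Finset (ℕ × ℕ)) (D : Finset ℕ),
      (∀ p ∈ A, I.Short p.1 p.2) ∧ D ⊆ C ∧
      (∀ p ∈ A, ∃ x ∈ S, p.1 ∈ I.keys x ∧ I.n + p.2 ∈ I.keys x) ∧
      (∀ v ∈ D, ∃ x ∈ S, v ∈ I.keys x) ∧
      Set.InjOn Prod.fst (A : Set (ℕ × ℕ)) ∧ Set.InjOn Prod.snd (A : Set (ℕ × ℕ)) ∧
      S.length ≤ D.card + A.card := by
    intro S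
    induction S with
    | nil => exact fun _ => ⟨∅, ∅, by simp⟩
    | cons p S ih =>
      intro hS
      obtain ⟨A, D, h1, h2, h3, h4, h5, h6, h7⟩ := ih
        ⟨fun x hx => hS.1 x (by simp [hx]), (List.pairwise_cons.1 hS.2).2⟩
      have hd := (List.pairwise_cons.1 hS.2).1
      have hp := hS.1 p (by simp)
      obtain ⟨c, l⟩ := p
      by_cases hl : ∀ x ∈ l, x ∈ C → x = I.s ∨ x = I.t
      · obtain ⟨x, hx, hxs⟩ := hC.short_of_keys hp hl
        have hf : ∀ p ∈ A, p.1 ≠ x ∧ p.2 ≠ c := by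
          intro p hpA
          obtain ⟨y, hy, hy1, hy2⟩ := h3 p hpA
          constructor
          · rintro rfl; exact hd y hy hx hy1
          · rintro rfl; exact hd y hy (color_mem_keys _) hy2
        have hnot : (x, c) ∉ A := fun h => (hf _ h).1 rfl
        refine ⟨insert (x, c) A, D, ?_, h2, ?_, ?_, ?_, ?_, ?_⟩
        · simpa using ⟨hxs, by simpa using h1⟩
        · intro p hpA
          rcases Finset.mem_insert.1 hpA with rfl | hpA
          · exact ⟨_, List.mem_cons_self, hx, color_mem_keys _⟩
          · obtain ⟨y, hy, h⟩ := h3 p hpA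
            exact ⟨y, by simp [hy], h⟩
        · intro v hv
          obtain ⟨y, hy, h⟩ := h4 v hv
          exact ⟨y, by simp [hy], h⟩
        · rw [Finset.coe_insert, Set.injOn_insert (by simpa using hnot)]
          refine ⟨h5, ?_⟩
          rintro ⟨p, hpA, h⟩
          exact (hf p hpA).1 h
        · rw [Finset.coe_insert, Set.injOn_insert (by simpa using hnot)]
          refine ⟨h6, ?_⟩
          rintro ⟨p, hpA, h⟩
          exact (hf p hpA).2 h
        · rw [Finset.card_insert_of_notMem hnot, List.length_cons]
          omega
      · push Not at hl
        obtain ⟨x, hx, hxC, hxs, hxt⟩ := hl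
        have hxk := mem_keys_of_internal hp hx hxs hxt
        have hnot : x ∉ D := by
          intro h
          obtain ⟨y, hy, h⟩ := h4 x h
          exact hd y hy hxk h
        refine ⟨A, insert x D, h1, ?_, ?_, ?_, h5, h6, ?_⟩
        · exact Finset.insert_subset hxC h2
        · intro p hpA
          obtain ⟨y, hy, h⟩ := h3 p hpA
          exact ⟨y, by simp [hy], h⟩
        · intro v hv
          rcases Finset.mem_insert.1 hv with rfl | hv
          · exact ⟨_, List.mem_cons_self, hxk⟩
          · obtain ⟨y, hy, h⟩ := h4 v hv
            exact ⟨y, by simp [hy], h⟩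
        · rw [Finset.card_insert_of_notMem hnot, List.length_cons]
          omega
  obtain ⟨A, D, h1, h2, -, -, h5, h6, h7⟩ := key S hS
  exact ⟨A, h1, h5, h6, h7.trans (by have := Finset.card_le_card h2; omega)⟩

end CDDP

/-! ### Guessing the shape of a path -/

namespace CDDP

variable (I : CDDP)

open Classical in
/-- The common neighbors of `u` and `v` in color `c`. -/
noncomputable def between (c u v : ℕ) : List ℕ :=
  (List.range I.n).filter fun x => I.Col c u x ∧ I.Col c x v

/-- The connection from `u` to `v`: direct if `r = 0`, and through the `r`-th common neighbor
otherwise. -/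
noncomputable def via (c u v r : ℕ) : List ℕ :=
  if r = 0 then [] else ((I.between c u v)[r - 1]?).toList

/-- The continuation from the vertex `u` that is described by a list of steps `(j, r)`: go to the
vertex `tg j` by the connection `r`, and stop if `j = 0`. -/
noncomputable def expand (tg : ℕ → ℕ) (c : ℕ) : ℕ → List (ℕ × ℕ) → List ℕ
  | _, [] => []
  | u, (j, r) :: L => I.via c u (tg j) r ++ tg j :: if j = 0 then [] else expand tg c (tg j) L

/-- The path that is described by a list of steps. -/
noncomputable def walk (tg : ℕ → ℕ) (L : List (ℕ × ℕ)) (c : ℕ) : List ℕ := I.s :: I.expand tg c I.s L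

variable {I}

/-- By counting, `|F| + 1` different entries cannot all lie in `F`; if `N` is shorter than that, `x`
itself is among the entries examined. -/
theorem exists_rank {N : List ℕ} (hN : N.Nodup) (F : Finset ℕ) {x : ℕ} (hx : x ∈ N) (hxF : x ∉ F) :
    ∃ r, 1 ≤ r ∧ r ≤ F.card + 1 ∧ ∃ y, N[r - 1]? = some y ∧ y ∉ F := by
  by_contra! h
  have h1 : ∀ y ∈ N.take (F.card + 1), y ∈ F := by
    intro y hy
    obtain ⟨i, hi⟩ := List.mem_iff_getElem?.1 hy
    rw [List.getElem?_take] at hi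
    split_ifs at hi with hlt
    exact h (i + 1) (by omega) (by omega) y (by simpa using hi)
  have h2 : (N.take (F.card + 1)).length ≤ F.card := by
    rw [← List.toFinset_card_of_nodup (hN.sublist (List.take_sublist ..))]
    exact Finset.card_le_card fun y hy => h1 y (List.mem_toFinset.1 hy)
  rw [List.length_take] at h2
  rw [List.take_of_length_le (by omega)] at h1
  exact hxF (h1 x hx)

theorem between_nodup (c u v : ℕ) : (I.between c u v).Nodup := List.nodup_range.filter _

theorem mem_between {c u v x : ℕ} : x ∈ I.between c u v ↔ I.Col c u x ∧ I.Col c x v := by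
  simp only [between, List.mem_filter, List.mem_range, decide_eq_true_eq, and_iff_right_iff_imp]
  exact fun h => h.2.1

/-- Every path can be replaced by one of the same length that avoids the same set and is described
by few steps with small ranks. -/
theorem exists_steps {C : Finset ℕ} (hC : I.Covers C) {tg : ℕ → ℕ} {m : ℕ} (h0 : tg 0 = I.t)
    (htg : ∀ v ∈ C, ∃ j ≤ m, tg j = v ∧ j ≠ 0) {c : ℕ} (k : ℕ) : ∀ (l : List ℕ) (u : ℕ)
    (Z : Finset ℕ), l.length ≤ k → l ≠ [] → (u :: l).IsChain (I.Col c) → (u :: l).Nodup →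
      (u :: l).getLast? = some (I.t : ℕ) → (∀ x ∈ l, x ≠ I.t → x ∉ Z) →
      ∃ (L : List (ℕ × ℕ)) (l' : List ℕ), (∀ P, I.expand tg c u (L ++ P) = l') ∧
        l'.length = l.length ∧
        (u :: l').IsChain (I.Col c) ∧ (u :: l').Nodup ∧ (u :: l').getLast? = some (I.t : ℕ) ∧
        (∀ x ∈ l', x ≠ I.t → x ∉ Z) ∧ L.length ≤ (l.filter (· ∈ C)).length + 1 ∧
        ∀ p ∈ L, p.1 ≤ m ∧ p.2 ≤ Z.card + l.length + 1 := by
  induction k with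
  | zero => intro l u Z hl hne; simp_all
  | succ k ih =>
    intro l u Z hlen hne hch hnd hlast hZ
    obtain ⟨v, rest, rfl⟩ := List.exists_cons_of_ne_nil hne
    rw [List.isChain_cons_cons] at hch
    have hlast' : (v :: rest).getLast? = some (I.t : ℕ) := by simpa using hlast
    have htl : (I.t : ℕ) ∈ v :: rest := List.mem_of_getLast? hlast'
    have hut : u ≠ I.t := by rintro rfl; exact (List.nodup_cons.1 hnd).1 htl
    -- Reaching `t` is encoded by the target number 0, which makes `expand` stop. This is why the
    -- steps found may be followed by an arbitrary list `P`.
    by_cases hvt : v = I.t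
    · have hrest : rest = [] := by
        by_contra hne'
        have h1 : rest.getLast? = some (I.t : ℕ) := by
          obtain ⟨w, r', rfl⟩ := List.exists_cons_of_ne_nil hne'
          simpa using hlast'
        have := List.mem_of_getLast? h1
        simp only [List.nodup_cons] at hnd
        exact hnd.2.1 (hvt ▸ this)
      subst hrest
      refine ⟨[(0, 0)], [v], ?_, rfl, ?_, hnd, hlast, hZ, by simp, by simp⟩
      · intro P
        simp [expand, via, h0, hvt]
      · simpa using hch.1
    by_cases hvC : v ∈ C
    · obtain ⟨j, hj, hjv, hj0⟩ := htg v hvC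
      have hrne : rest ≠ [] := by
        rintro rfl
        simp only [List.getLast?_singleton, Option.some.injEq] at hlast'
        exact hvt hlast'
      -- A cover vertex is kept and reached directly. Forbidding `u` prevents the replaced remainder
      -- from returning to it. The growth of `Z` is paid for by the vertex removed from the list, so
      -- the bound on the ranks persists.
      obtain ⟨L, l', hL, hl', g1, g2, g3, g4, g5, g6⟩ := ih rest v (insert u Z)
        (by simpa using hlen) hrne hch.2 (List.nodup_cons.1 hnd).2 hlast' (by
          intro x hx hxt
          simp only [Finset.mem_insert, not_or]
          refine ⟨?_, hZ x (by simp [hx]) hxt⟩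
          rintro rfl
          exact (List.nodup_cons.1 hnd).1 (by simp [hx]))
      have hul : u ∉ v :: l' := by
        simp only [List.mem_cons, not_or]
        refine ⟨hch.1.ne, fun h => ?_⟩
        exact g4 u h hut (Finset.mem_insert_self ..)
      refine ⟨(j, 0) :: L, v :: l', ?_, by simp [hl'], ?_, ?_, ?_, ?_, ?_, ?_⟩
      · intro P
        simp [expand, via, hjv, hj0, hL]
      · exact List.isChain_cons_cons.2 ⟨hch.1, g1⟩
      · exact List.nodup_cons.2 ⟨hul, g2⟩
      · simpa using g3
      · intro x hx hxt
        rcases List.mem_cons.1 hx with rfl | hx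
        · exact hZ x (by simp) hxt
        · exact fun h => g4 x hx hxt (Finset.mem_insert_of_mem h)
      · rw [List.filter_cons_of_pos (by simpa using hvC)]
        simpa using g5
      · intro p hp
        have hcard := Finset.card_insert_le u Z
        rcases List.mem_cons.1 hp with rfl | hp
        · exact ⟨hj, by simp⟩
        · have := g6 p hp
          simp only [List.length_cons]
          omega
    · have hrne : rest ≠ [] := by
        rintro rfl
        simp only [List.getLast?_singleton, Option.some.injEq] at hlast'
        exact hvt hlast'
      obtain ⟨w, rest, rfl⟩ := List.exists_cons_of_ne_nil hrne
      have hch2 := (List.isChain_cons_cons.1 hch.2)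
      have hwC := (hC _ _ _ hch2.1).resolve_left hvC
      -- The vertex `v` is outside the cover, so its successor `w` lies in it, and any common
      -- neighbor of `u` and `w` can play the role of `v` unless it is in `F`. The rest of the old
      -- path is included to keep the substituted path simple; the rest may still be changed
      -- afterwards, and for this the chosen `y` joins the forbidden set.
      set F : Finset ℕ := insert u (Z ∪ (w :: rest).toFinset) with hF
      have hFcard : F.card ≤ Z.card + (w :: rest).length + 1 := by
        have h1 := Finset.card_insert_le u (Z ∪ (w :: rest).toFinset)
        have h2 := Finset.card_union_le Z (w :: rest).toFinset
        have h3 := List.toFinset_card_le (w :: rest)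
        rw [hF]
        omega
      have hnd' := hnd
      simp only [List.nodup_cons, List.mem_cons, not_or] at hnd'
      obtain ⟨r, hr1, hr2, y, hy, hyF⟩ := exists_rank (between_nodup c u w) F (x := v)
        (mem_between.2 ⟨hch.1, hch2.1⟩) (by
          simp only [hF, Finset.mem_insert, Finset.mem_union, List.mem_toFinset, List.mem_cons,
            not_or]
          exact ⟨hch.1.symm.ne, hZ v (by simp) hvt, hnd'.2.1⟩)
      have hyc := mem_between.1 (List.mem_of_getElem? hy)
      simp only [hF, Finset.mem_insert, Finset.mem_union, List.mem_toFinset, not_or] at hyF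
      have hvia : I.via c u w r = [y] := by
        rw [via, if_neg (by omega), hy]
        rfl
      have hlastw : (w :: rest).getLast? = some (I.t : ℕ) := by simpa using hlast'
      have htw : (I.t : ℕ) ∈ w :: rest := List.mem_of_getLast? hlastw
      have hyt : y ≠ I.t := by rintro rfl; exact hyF.2.2 htw
      by_cases hwt : w = I.t
      · have hrest : rest = [] := by
          by_contra hne'
          have h1 : rest.getLast? = some (I.t : ℕ) := by
            obtain ⟨w, r', rfl⟩ := List.exists_cons_of_ne_nil hne'
            simpa using hlastw
          have := List.mem_of_getLast? h1
          exact hnd'.2.2.1 (hwt ▸ this)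
        subst hrest
        refine ⟨[(0, r)], [y, w], ?_, rfl, ?_, ?_, hlast, ?_, by simp, ?_⟩
        · intro P
          simp [expand, h0, ← hwt, hvia]
        · simpa using hyc
        · simp [hyc.1.ne, hyc.2.ne, hnd'.1.2.1]
        · intro x hx hxt
          simp only [List.mem_cons, List.not_mem_nil, or_false] at hx
          rcases hx with rfl | rfl
          · exact hyF.2.1
          · exact absurd hwt hxt
        · intro p hp
          simp only [List.mem_singleton] at hp
          subst hp
          simp only [List.length_cons] at hFcard ⊢
          exact ⟨by omega, by omega⟩
      · obtain ⟨j, hj, hjv, hj0⟩ := htg w hwC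
        have hrne : rest ≠ [] := by
          rintro rfl
          simp only [List.getLast?_singleton, Option.some.injEq] at hlastw
          exact hwt hlastw
        have hyr : y ∉ rest := fun h => hyF.2.2 (by simp [h])
        obtain ⟨L, l', hL, hl', g1, g2, g3, g4, g5, g6⟩ := ih rest w (insert u (insert y Z))
          (by simp only [List.length_cons] at hlen; omega) hrne hch2.2 (by simp [hnd'.2.2])
          hlastw (by
            intro x hx hxt
            simp only [Finset.mem_insert, not_or]
            refine ⟨?_, ?_, hZ x (by simp [hx]) hxt⟩
            · rintro rfl; exact hnd'.1.2.2 hx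
            · rintro rfl; exact hyr hx)
        have hul : u ∉ l' := fun h => g4 u h hut (by simp)
        have hyl : y ∉ l' := fun h => g4 y h hyt (by simp)
        refine ⟨(j, r) :: L, y :: w :: l', ?_, by simp [hl'], ?_, ?_, ?_, ?_, ?_, ?_⟩
        · intro P
          simp [expand, hjv, hvia, hj0, hL]
        · simpa [hyc] using g1
        · simp only [List.nodup_cons, List.mem_cons, not_or]
          exact ⟨⟨hyc.1.ne, hnd'.1.2.1, hul⟩, ⟨hyc.2.ne, hyl⟩, by simpa using g2⟩
        · simpa using g3
        · intro x hx hxt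
          simp only [List.mem_cons] at hx
          rcases hx with rfl | rfl | hx
          · exact hyF.2.1
          · exact hZ x (by simp) hxt
          · exact fun h => g4 x hx hxt (by simp [h])
        · rw [List.filter_cons_of_neg (by simpa using hvC),
            List.filter_cons_of_pos (by simpa using hwC)]
          simpa using g5
        · intro p hp
          have hcard := Finset.card_insert_le u (insert y Z)
          have hcard' := Finset.card_insert_le y Z
          simp only [List.length_cons] at hFcard ⊢
          rcases List.mem_cons.1 hp with rfl | hp
          · exact ⟨hj, by omega⟩
          · have := g6 p hp
            omega

variable (I) in
/-- The path `p` is valid and avoids the set `X`. -/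
def Free (X : Finset ℕ) (p : ℕ × List ℕ) : Prop := I.IsRoute p.1 p.2 ∧ ∀ x ∈ I.keys p, x ∉ X

/-- The version for whole paths, with a fixed number of steps. -/
theorem Free.exists_walk {C : Finset ℕ} (hC : I.Covers C) {tg : ℕ → ℕ} (h0 : tg 0 = I.t)
    (htg : ∀ v ∈ C, ∃ j ≤ C.card, tg j = v ∧ j ≠ 0) {Z : Finset ℕ} {p : ℕ × List ℕ}
    (hp : I.Free Z p) : ∃ L : List (ℕ × ℕ), L.length = C.card + 1 ∧
      (∀ q ∈ L, q.1 ≤ C.card ∧ q.2 ≤ Z.card + 2 * C.card + 1) ∧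
      I.Free Z (p.1, I.walk tg L p.1) := by
  obtain ⟨c, l⟩ := p
  obtain ⟨hr, hZ⟩ := hp
  have h2 := hr.two_le
  obtain ⟨a, l, rfl⟩ : ∃ a l', l = a :: l' := List.exists_cons_of_ne_nil (by rintro rfl; simp at h2)
  obtain rfl : a = I.s := by simpa using hr.head
  have hsl : ∀ x ∈ l, x ≠ I.s := by
    rintro x hx rfl
    exact (List.nodup_cons.1 hr.nodup).1 hx
  have hlen := hC.length_le hr
  simp only [List.length_cons] at h2 hlen
  obtain ⟨L, l', hL, hl', g1, g2, g3, g4, g5, g6⟩ := exists_steps hC h0 htg l.length l I.s Z le_rfl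
    (by rintro rfl; simp at h2) hr.chain hr.nodup hr.last
    (fun x hx hxt => hZ x (mem_keys_of_internal hr (by simp [hx]) (hsl x hx) hxt))
  have hfl := length_filter_mem_le (C := C) (List.nodup_cons.1 hr.nodup).2
  have hr' : I.IsRoute c (I.s :: l') := ⟨g2, rfl, g3, g1⟩
  -- Padding gives all shapes the same number of digits; `expand` has stopped before it reaches the
  -- padding.
  refine ⟨L ++ List.replicate (C.card + 1 - L.length) (0, 0), ?_, ?_, ?_⟩
  · simp only [List.length_append, List.length_replicate]
    omega
  · intro q hq
    rcases List.mem_append.1 hq with hq | hq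
    · have := g6 q hq
      omega
    · obtain rfl := List.eq_of_mem_replicate hq
      simp
  · simp only [walk, hL]
    refine ⟨hr', ?_⟩
    intro x hx
    rcases mem_keys.1 hx with rfl | ⟨i, hi, hix⟩
    · exact hZ _ (color_mem_keys _)
    · have h3 := hr'.eq_of_key hi hix
      by_cases hxt : x = I.t
      · have h4 := h3.2 hxt
        simp only [List.cons.injEq, true_and] at h4
        obtain ⟨b, rfl⟩ := List.length_eq_one_iff.1 (by rw [← hl', h4]; rfl : l.length = 1)
        have h5 : b = I.t := by simpa using hr.last
        subst h5
        exact hxt ▸ hZ _ hr.second_mem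
      · have : x ∈ (I.s : ℕ) :: l' := List.mem_of_getElem? hix
        exact g4 x ((List.mem_cons.1 this).resolve_left h3.1) hxt

end CDDP

/-! ### The search for a packing along a guess -/

namespace CDDP

variable (I : CDDP)

open Classical in
/-- The first color below `k` whose path, described by `L`, is valid and avoids `X`. -/
noncomputable def pickBelow (tg : ℕ → ℕ) (L : List (ℕ × ℕ)) (X : Finset ℕ) :
    ℕ → Option (ℕ × List ℕ)
  | 0 => none
  | k + 1 => match pickBelow tg L X k with
    | some p => some p
    | none => if I.Free X (k, I.walk tg L k) then some (k, I.walk tg L k) else none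

/-- Add to `X` the key of `p` that is selected by `e`. -/
def mark (e : ℕ) (p : Option (ℕ × List ℕ)) (X : Finset ℕ) : Finset ℕ :=
  match p with
  | none => X
  | some p => if e = 0 then X else if e = 1 then insert (I.n + p.1) X else
    match p.2[e - 1]? with
    | some v => insert v X
    | none => X

/-- One round of the search. -/
noncomputable def searchStep (tg : ℕ → ℕ) (L : List (ℕ × ℕ))
    (x : Finset ℕ × Option (ℕ × List ℕ)) (e : ℕ) : Finset ℕ × Option (ℕ × List ℕ) :=
  (I.mark e (I.pickBelow tg L x.1 I.q) x.1, I.pickBelow tg L x.1 I.q)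

/-- The vertices and colors in use. -/
def used (S : List (ℕ × List ℕ)) : Finset ℕ := (S.flatMap I.keys).toFinset

/-- The packing after one more path has been searched for. -/
noncomputable def extend (tg : ℕ → ℕ) (S : List (ℕ × List ℕ)) (g : List (ℕ × ℕ) × List ℕ) :
    List (ℕ × List ℕ) :=
  S ++ (g.2.foldl (I.searchStep tg g.1) (I.used S, none)).2.toList

variable {I}

theorem mem_used {S : List (ℕ × List ℕ)} {x : ℕ} : x ∈ I.used S ↔ ∃ p ∈ S, x ∈ I.keys p := by
  simp [used]

theorem used_append (S S' : List (ℕ × List ℕ)) : I.used (S ++ S') = I.used S ∪ I.used S' := by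
  ext; simp [used]

theorem used_singleton (p : ℕ × List ℕ) : I.used [p] = (I.keys p).toFinset := by
  ext; simp [used]

theorem isPacking_append_singleton {S : List (ℕ × List ℕ)} {p : ℕ × List ℕ} (hS : I.IsPacking S)
    (hp : I.Free (I.used S) p) : I.IsPacking (S ++ [p]) := by
  refine ⟨?_, ?_⟩
  · intro x hx
    rcases List.mem_append.1 hx with hx | hx
    · exact hS.1 x hx
    · obtain rfl := List.mem_singleton.1 hx
      exact hp.1
  · rw [List.pairwise_append]
    refine ⟨hS.2, List.pairwise_singleton .., ?_⟩
    intro x hx y hy k hk hk'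
    obtain rfl := List.mem_singleton.1 hy
    exact hp.2 k hk' (mem_used.2 ⟨x, hx, hk⟩)

theorem IsPacking.tail {p : ℕ × List ℕ} {S : List (ℕ × List ℕ)} (h : I.IsPacking (p :: S)) :
    I.IsPacking S :=
  ⟨fun x hx => h.1 x (by simp [hx]), (List.pairwise_cons.1 h.2).2⟩

theorem free_of_pickBelow {tg : ℕ → ℕ} {L : List (ℕ × ℕ)} {X : Finset ℕ} {k : ℕ}
    {p : ℕ × List ℕ} (h : I.pickBelow tg L X k = some p) :
    I.Free X p ∧ p.2 = I.walk tg L p.1 := by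
  induction k with
  | zero => simp [pickBelow] at h
  | succ k ih =>
    rw [pickBelow] at h
    split at h
    · rename_i p' hp'
      exact ih (by rw [hp', h])
    · split_ifs at h with hf
      obtain rfl := Option.some.inj h
      exact ⟨hf, rfl⟩

theorem pickBelow_isSome {tg : ℕ → ℕ} {L : List (ℕ × ℕ)} {X : Finset ℕ} {k c : ℕ} (hc : c < k)
    (h : I.Free X (c, I.walk tg L c)) : ∃ p, I.pickBelow tg L X k = some p := by
  induction k with
  | zero => omega
  | succ k ih =>
    rw [pickBelow]
    rcases Nat.lt_succ_iff_lt_or_eq.1 hc with hc | rfl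
    · obtain ⟨p, hp⟩ := ih hc
      exact ⟨p, by rw [hp]⟩
    · split
      · exact ⟨_, rfl⟩
      · exact ⟨_, if_pos h⟩

theorem subset_mark (e : ℕ) (p : Option (ℕ × List ℕ)) (X : Finset ℕ) : X ⊆ I.mark e p X := by
  unfold mark
  split
  · rfl
  · split_ifs
    · rfl
    · exact Finset.subset_insert ..
    · split
      · exact Finset.subset_insert ..
      · rfl

theorem Free.anti {X Y : Finset ℕ} {p : ℕ × List ℕ} (h : I.Free Y p) (hXY : X ⊆ Y) : I.Free X p :=
  ⟨h.1, fun x hx hX => h.2 x hx (hXY hX)⟩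

/-- Marking only enlarges the forbidden set. Hence a path found under any guess, right or wrong,
avoids what is in use. -/
theorem free_of_search {tg : ℕ → ℕ} {L : List (ℕ × ℕ)} {U : Finset ℕ} (ds : List ℕ) :
    ∀ x : Finset ℕ × Option (ℕ × List ℕ), U ⊆ x.1 → (∀ p, x.2 = some p → I.Free U p) →
      ∀ p, (ds.foldl (I.searchStep tg L) x).2 = some p → I.Free U p := by
  induction ds with
  | nil => exact fun x _ h => h
  | cons e ds ih =>
    intro x hx h p hp
    exact ih _ (hx.trans (subset_mark ..))
      (fun p hp => (free_of_pickBelow hp).1.anti hx) p hp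

theorem isPacking_extend {tg : ℕ → ℕ} {S : List (ℕ × List ℕ)} (hS : I.IsPacking S)
    (g : List (ℕ × ℕ) × List ℕ) : I.IsPacking (I.extend tg S g) := by
  unfold extend
  cases h : (g.2.foldl (I.searchStep tg g.1) (I.used S, none)).2 with
  | none => simpa using hS
  | some p =>
    exact isPacking_append_singleton hS
      (free_of_search (U := I.used S) g.2 (I.used S, none) subset_rfl (by simp) p h)

theorem length_extend (tg : ℕ → ℕ) (S : List (ℕ × List ℕ)) (g : List (ℕ × ℕ) × List ℕ) :
    S.length ≤ (I.extend tg S g).length := by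
  simp [extend]

/-- Here `U` stands for what is in use and `Y` for the keys of the remaining optimal paths. As long
as `X ⊆ U ∪ Y`, the color `c` is a candidate, so something is picked. A pick that meets `Y` does so
outside `X`, and marking the common key lowers `|Y \ X|`. The second alternative of the hypothesis
covers the rounds after success. -/
theorem exists_search {tg : ℕ → ℕ} {L : List (ℕ × ℕ)} {Y U : Finset ℕ} {c b : ℕ}
    (hfree : I.Free (U ∪ Y) (c, I.walk tg L c)) (hb : ∀ c, (I.walk tg L c).length ≤ b) (R : ℕ) :
    ∀ (X : Finset ℕ) (o : Option (ℕ × List ℕ)), X ⊆ U ∪ Y →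
      ((Y \ X).card < R ∨ 1 ≤ R ∧ ∃ p, I.pickBelow tg L X I.q = some p ∧ I.Free Y p) →
      ∃ ds : List ℕ, ds.length = R ∧ (∀ e ∈ ds, e ≤ b + 1) ∧
        ∃ p, (ds.foldl (I.searchStep tg L) (X, o)).2 = some p ∧ I.Free Y p := by
  induction R with
  | zero => intro X o _ h; omega
  | succ R ih =>
    intro X o hX h
    obtain ⟨p, hp⟩ := pickBelow_isSome hfree.1.color_lt (hfree.anti hX)
    obtain ⟨hpf, hpw⟩ := free_of_pickBelow hp
    by_cases hpY : I.Free Y p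
    · by_cases hR : R = 0
      · subst hR
        exact ⟨[0], rfl, by simp, p, by simp [searchStep, hp], hpY⟩
      -- The digit 0 marks nothing, so the same pick is repeated until the fixed number of rounds is
      -- used up.
      · obtain ⟨ds, h1, h2, h3⟩ := ih X (some p) hX (.inr ⟨by omega, p, hp, hpY⟩)
        refine ⟨0 :: ds, by simp [h1], by simpa using h2, ?_⟩
        have : I.searchStep tg L (X, o) 0 = (X, some p) := by simp [searchStep, hp, mark]
        rw [List.foldl_cons, this]
        exact h3
    · have hcard : (Y \ X).card < R + 1 := by
        rcases h with h | ⟨-, p', hp', hf⟩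
        · exact h
        · rw [hp] at hp'
          obtain rfl := Option.some.inj hp'
          exact absurd hf hpY
      obtain ⟨x, hx, hxY⟩ : ∃ x ∈ I.keys p, x ∈ Y := by
        by_contra! h'
        exact hpY ⟨hpf.1, h'⟩
      have hxX := hpf.2 x hx
      have hcard' : (Y \ insert x X).card < R := by
        have : Y \ insert x X ⊂ Y \ X := by
          rw [Finset.ssubset_iff_of_subset (Finset.sdiff_subset_sdiff subset_rfl
            (Finset.subset_insert ..))]
          exact ⟨x, by simp [hxY, hxX], by simp⟩
        have := Finset.card_lt_card this
        omega
      -- The color has digit 1, and the vertex at position `i` has digit `i + 1`. These do not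
      -- collide, since position 0, the vertex `s`, is never a key.
      obtain ⟨e, he, hmark⟩ : ∃ e ≤ b + 1, I.mark e (some p) X = insert x X := by
        rcases mem_keys.1 hx with rfl | ⟨i, hi, hix⟩
        · exact ⟨1, by omega, by simp [mark]⟩
        · have hlen := hb p.1
          rw [← hpw] at hlen
          have := (List.getElem?_eq_some_iff.1 hix).1
          refine ⟨i + 1, by omega, ?_⟩
          simp only [mark]
          rw [if_neg (by omega), if_neg (by omega)]
          simp [hix]
      obtain ⟨ds, h1, h2, h3⟩ := ih (insert x X) (some p)
        (Finset.insert_subset (Finset.mem_union_right _ hxY) hX) (.inl hcard')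
      refine ⟨e :: ds, by simp [h1], by simpa [he] using h2, ?_⟩
      have : I.searchStep tg L (X, o) e = (insert x X, some p) := by simp [searchStep, hp, hmark]
      rw [List.foldl_cons, this]
      exact h3

theorem length_expand_le (tg : ℕ → ℕ) (c : ℕ) (L : List (ℕ × ℕ)) : ∀ u,
    (I.expand tg c u L).length ≤ 2 * L.length := by
  induction L with
  | nil => simp [expand]
  | cons p L ih =>
    intro u
    obtain ⟨j, r⟩ := p
    have h1 : (I.via c u (tg j) r).length ≤ 1 := by
      unfold via
      split_ifs
      · simp
      · cases (I.between c u (tg j))[r - 1]? <;> simp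
    have := ih (tg j)
    rw [expand, List.length_append, List.length_cons, List.length_cons]
    split_ifs
    · simp only [List.length_nil]; omega
    · omega

theorem card_used_le {C : Finset ℕ} (hC : I.Covers C) {S : List (ℕ × List ℕ)}
    (hS : I.IsPacking S) : (I.used S).card ≤ S.length * (2 * C.card + 1) := by
  induction S with
  | nil => simp [used]
  | cons p S ih =>
    have h1 := ih hS.tail
    have h2 : (I.keys p).length ≤ 2 * C.card + 1 :=
      (length_keys_le (hS.1 p (by simp))).trans (hC.length_le (hS.1 p (by simp)))
    have h3 : I.used (p :: S) = (I.keys p).toFinset ∪ I.used S := by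
      rw [← List.singleton_append, used_append, used_singleton]
    rw [h3, List.length_cons, add_mul, one_mul]
    have := Finset.card_union_le (I.keys p).toFinset (I.used S)
    have := List.toFinset_card_le (I.keys p)
    omega

/-- Some guess leads to a packing with as many paths as a given one. -/
theorem exists_guess {C : Finset ℕ} (hC : I.Covers C) {tg : ℕ → ℕ} (h0 : tg 0 = I.t)
    (htg : ∀ v ∈ C, ∃ j ≤ C.card, tg j = v ∧ j ≠ 0) {R : ℕ} : ∀ (O S : List (ℕ × List ℕ)),
    I.IsPacking O → I.IsPacking S → Disjoint (I.used S) (I.used O) →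
    (S.length + O.length) * (2 * C.card + 1) < R →
    ∃ gs : List (List (ℕ × ℕ) × List ℕ), gs.length = O.length ∧
      (∀ g ∈ gs, g.1.length = C.card + 1 ∧ g.2.length = R ∧
        (∀ q ∈ g.1, q.1 ≤ C.card ∧ q.2 ≤ R + 2 * C.card + 1) ∧ ∀ e ∈ g.2, e ≤ 2 * C.card + 4) ∧
      (gs.foldl (I.extend tg) S).length = S.length + O.length := by
  intro O
  induction O with
  | nil => exact fun S _ _ _ _ => ⟨[], by simp⟩
  | cons p O ih =>
    intro S hO hS hd hR
    have huO := card_used_le hC hO.tail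
    have huS := card_used_le hC hS
    rw [List.length_cons] at hR
    -- This one inequality bounds both the number of marks that can be needed and the ranks in the
    -- shape.
    have hsum : (I.used S).card + (I.used O).card < R := by
      have : (S.length + (O.length + 1)) * (2 * C.card + 1) = S.length * (2 * C.card + 1) +
        O.length * (2 * C.card + 1) + (2 * C.card + 1) := by ring
      omega
    have hcons : I.used (p :: O) = (I.keys p).toFinset ∪ I.used O := by
      rw [← List.singleton_append, used_append, used_singleton]
    rw [hcons, Finset.disjoint_union_right] at hd
    have hpfree : I.Free (I.used S ∪ I.used O) p := by
      refine ⟨hO.1 p (by simp), ?_⟩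
      intro x hx hx'
      rcases Finset.mem_union.1 hx' with hx' | hx'
      · exact Finset.disjoint_left.1 hd.1 hx' (List.mem_toFinset.2 hx)
      · obtain ⟨y, hy, hxy⟩ := mem_used.1 hx'
        exact (List.pairwise_cons.1 hO.2).1 y hy hx hxy
    obtain ⟨L, hL1, hL2, hL3⟩ := hpfree.exists_walk hC h0 htg
    have hcu := Finset.card_union_le (I.used S) (I.used O)
    -- A walk has the vertex `s` and at most two further vertices for each of its `|C| + 1` steps.
    obtain ⟨ds, hd1, hd2, p', hp', hf⟩ := exists_search (b := 2 * C.card + 3) hL3 (by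
        intro c
        have := length_expand_le (I := I) tg c L I.s
        simp only [walk, List.length_cons]
        omega) R (I.used S) none Finset.subset_union_left (.inl (by
          have := Finset.card_le_card (Finset.sdiff_subset (s := I.used O) (t := I.used S))
          omega))
    have hext : I.extend tg S (L, ds) = S ++ [p'] := by simp [extend, hp']
    have hp'S : I.Free (I.used S) p' :=
      free_of_search (U := I.used S) ds (I.used S, none) subset_rfl (by simp) p' hp'
    -- This is the exchange: `p'` may differ from `p` in color and vertices, but it is disjoint from
    -- the rest of the optimal solution, which is all that the induction needs.
    obtain ⟨gs, g1, g2, g3⟩ := ih (S ++ [p']) hO.tail (isPacking_append_singleton hS hp'S) (by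
        rw [used_append, used_singleton, Finset.disjoint_union_left]
        refine ⟨hd.2, Finset.disjoint_left.2 ?_⟩
        intro x hx
        exact hf.2 x (List.mem_toFinset.1 hx)) (by
          rw [List.length_append, List.length_singleton, add_assoc, add_comm 1]
          exact hR)
    refine ⟨(L, ds) :: gs, by simp [g1], ?_, ?_⟩
    · intro g hg
      rcases List.mem_cons.1 hg with rfl | hg
      · refine ⟨hL1, hd1, ?_, hd2⟩
        intro q hq
        have := hL2 q hq
        omega
      · exact g2 g hg
    · rw [List.foldl_cons, hext, g3, List.length_append, List.length_singleton, List.length_cons]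
      omega

theorem isPacking_foldl_extend {tg : ℕ → ℕ} (gs : List (List (ℕ × ℕ) × List ℕ)) :
    ∀ {S : List (ℕ × List ℕ)}, I.IsPacking S → I.IsPacking (gs.foldl (I.extend tg) S) := by
  induction gs with
  | nil => exact fun h => h
  | cons g gs ih => exact fun h => ih (isPacking_extend h g)

end CDDP

/-! ### Access to the input -/

namespace RAM

/-- The array `f` starts with the entries of `l`. -/
def Holds (f : ℕ → ℕ) (l : List ℕ) : Prop := ∀ i x, l[i]? = some x → f i = x

theorem Holds.congr {f g : ℕ → ℕ} {l : List ℕ} (h : Holds f l) (hfg : ∀ i < l.length, g i = f i) :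
    Holds g l := by
  intro i x hx
  rw [hfg i (List.getElem?_eq_some_iff.1 hx).1, h i x hx]

theorem Holds.get {f : ℕ → ℕ} {l : List ℕ} (h : Holds f l) {i : ℕ} (hi : i < l.length) :
    f i = l[i] := h i _ (List.getElem?_eq_getElem hi)

theorem holds_append {f : ℕ → ℕ} {l l' : List ℕ} :
    Holds f (l ++ l') ↔ Holds f l ∧ Holds (fun i => f (l.length + i)) l' := by
  constructor
  · refine fun h => ⟨fun i x hx => h i x ?_, fun i x hx => h _ x ?_⟩
    · rw [List.getElem?_append_left (List.getElem?_eq_some_iff.1 hx).1, hx]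
    · rw [List.getElem?_append_right (by omega), Nat.add_sub_cancel_left, hx]
  · rintro ⟨h, h'⟩ i x hx
    rcases Nat.lt_or_ge i l.length with hi | hi
    · rw [List.getElem?_append_left hi] at hx
      exact h i x hx
    · rw [List.getElem?_append_right hi] at hx
      have := h' _ x hx
      simpa [Nat.add_sub_cancel' hi] using this

theorem holds_cons {f : ℕ → ℕ} {a : ℕ} {l : List ℕ} :
    Holds f (a :: l) ↔ f 0 = a ∧ Holds (fun i => f (i + 1)) l := by
  constructor
  · exact fun h => ⟨h 0 a rfl, fun i x hx => h (i + 1) x (by simpa using hx)⟩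
  · rintro ⟨h, h'⟩ i x hx
    cases i with
    | zero => simpa [h] using hx
    | succ i => exact h' i x (by simpa using hx)

theorem holds_nil {f : ℕ → ℕ} : Holds f [] := by simp [Holds]

namespace Expr

/-- The scalar variable `a`. -/
abbrev var (a : ℕ) : Expr := .get a (.lit 0)

/-- Negation. -/
abbrev not (x : Expr) : Expr := .sub (.lit 1) x

/-- Equality. -/
abbrev eq (x y : Expr) : Expr := .not (.add (.sub x y) (.sub y x))

/-- Conjunction. -/
abbrev and (x y : Expr) : Expr := .not (.add (.not x) (.not y))

/-- The number of vertices. -/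
abbrev nE : Expr := .get 0 (.lit 1)

/-- The number of colors. -/
abbrev qE : Expr := .get 0 (.lit 2)

/-- The source. -/
abbrev sE : Expr := .get 0 (.lit 3)

/-- The target. -/
abbrev tE : Expr := .get 0 (.lit 4)

/-- The bit for the adjacency of `u` and `v`. -/
abbrev adj (u v : Expr) : Expr := .get 0 (.add (.get 2 u) (.get 3 v))

/-- The bit for the color `c` of `uv`. -/
abbrev hasCol (c u v : Expr) : Expr := .get 0 (.add (.add (.get 2 u) (.get 3 v)) (.add c (.lit 1)))

/-- A test whether a vertex and a color are matched by a short path. -/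
abbrev short (x c : Expr) : Expr := .and (.hasCol c .sE x) (.add (.eq x .tE) (.hasCol c x .tE))

variable {σ : State} {x y : Expr}

theorem eval_not : (Expr.not x).eval σ ≠ 0 ↔ x.eval σ = 0 := by
  simp only [eval]; omega

theorem eval_not' : (Expr.not x).eval σ = 0 ↔ x.eval σ ≠ 0 := by
  simp only [eval]; omega

theorem eval_eq : (Expr.eq x y).eval σ ≠ 0 ↔ x.eval σ = y.eval σ := by
  simp only [eval]; omega

theorem eval_and : (Expr.and x y).eval σ ≠ 0 ↔ x.eval σ ≠ 0 ∧ y.eval σ ≠ 0 := by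
  simp only [eval]; omega

theorem eval_or : (Expr.add x y).eval σ ≠ 0 ↔ x.eval σ ≠ 0 ∨ y.eval σ ≠ 0 := by
  simp only [eval]; omega

theorem eval_lt : (Expr.sub y x).eval σ ≠ 0 ↔ x.eval σ < y.eval σ := by
  simp only [eval]; omega

end Expr

infixr:60 " ;; " => Cmd.seq

/-- The part of the memory that describes the instance. -/
structure Tab (I : CDDP) (σ : State) : Prop where
  n : σ 0 1 = I.n
  q : σ 0 2 = I.q
  s : σ 0 3 = I.s
  t : σ 0 4 = I.t
  adj : ∀ u v : Fin I.n, σ 0 (σ 2 u + σ 3 v) ≠ 0 ↔ I.G.Adj u v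
  col : ∀ u < I.n, ∀ v < I.n, ∀ c < I.q, σ 0 (σ 2 u + σ 3 v + (c + 1)) ≠ 0 ↔ I.Col c u v

theorem Tab.congr {I : CDDP} {σ τ : State} (h : Tab I σ) (h0 : τ 0 = σ 0) (h2 : τ 2 = σ 2)
    (h3 : τ 3 = σ 3) : Tab I τ where
  n := by rw [h0, h.n]
  q := by rw [h0, h.q]
  s := by rw [h0, h.s]
  t := by rw [h0, h.t]
  adj u v := by rw [h0, h2, h3, h.adj]
  col u hu v hv c hc := by rw [h0, h2, h3, h.col u hu v hv c hc]

theorem Tab.short {I : CDDP} {σ : State} (h : Tab I σ) {x c : Expr} (hx : x.eval σ < I.n)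
    (hc : c.eval σ < I.q) :
    (Expr.short x c).eval σ ≠ 0 ↔ I.Short (x.eval σ) (c.eval σ) := by
  rw [Expr.eval_and, Expr.eval_or, Expr.eval_eq]
  simp only [Expr.eval, h.s, h.t]
  rw [h.col _ I.s.2 _ hx _ hc, h.col _ hx _ I.t.2 _ hc]
  rfl

end RAM

namespace CDDP

open RAM

theorem getElem?_flatMap_const {α β : Type*} (f : α → List β) {L : ℕ} : ∀ (l : List α),
    (∀ a ∈ l, (f a).length = L) → ∀ {i j : ℕ} {a : α}, l[i]? = some a → j < L →
      (l.flatMap f)[i * L + j]? = (f a)[j]? := by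
  intro l
  induction l with
  | nil => simp
  | cons b l ih =>
    intro h i j a hi hj
    have hb := h b (by simp)
    rw [List.flatMap_cons]
    cases i with
    | zero =>
      obtain rfl : b = a := by simpa using hi
      rw [zero_mul, zero_add, List.getElem?_append_left (by omega)]
    | succ i =>
      rw [List.getElem?_append_right (by rw [hb, Nat.succ_mul]; omega), hb]
      rw [show (i + 1) * L + j - L = i * L + j by rw [Nat.succ_mul]; omega]
      exact ih (fun a ha => h a (by simp [ha])) (by simpa using hi) hj

theorem length_flatMap_const {α β : Type*} (f : α → List β) {L : ℕ} (l : List α)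
    (h : ∀ a ∈ l, (f a).length = L) : (l.flatMap f).length = l.length * L := by
  induction l with
  | nil => simp
  | cons b l ih =>
    rw [List.flatMap_cons, List.length_append, ih fun a ha => h a (by simp [ha]), h b (by simp),
      List.length_cons]
    ring

variable (I : CDDP)

open Classical in
/-- The bits of the pair `uv`. -/
noncomputable def block (u v : Fin I.n) : List ℕ :=
  (if I.G.Adj u v then 1 else 0) ::
    (List.finRange I.q).map fun c => if I.HasColor u v c then 1 else 0

theorem length_block (u v : Fin I.n) : (I.block u v).length = I.q + 1 := by simp [block]

theorem encode_eq : I.encode = [I.n, I.q, (I.s : ℕ), (I.t : ℕ)] ++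
    (List.finRange I.n).flatMap fun u => (List.finRange I.n).flatMap fun v => I.block u v := rfl

theorem size_eq : I.size = 4 + I.n * (I.n * (I.q + 1)) := by
  rw [size, encode_eq, List.length_append, length_flatMap_const _ (L := I.n * (I.q + 1))]
  · simp
  · intro u _
    rw [length_flatMap_const _ (L := I.q + 1)]
    · simp
    · intro v _
      exact I.length_block u v

theorem encode_get (u v : Fin I.n) {j : ℕ} (hj : j < I.q + 1) :
    I.encode[4 + (u * (I.n * (I.q + 1)) + (v * (I.q + 1) + j))]? = (I.block u v)[j]? := by
  have hv : (v : ℕ) * (I.q + 1) + j < I.n * (I.q + 1) := by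
    calc (v : ℕ) * (I.q + 1) + j < v * (I.q + 1) + (I.q + 1) := by omega
      _ = (v + 1) * (I.q + 1) := by ring
      _ ≤ _ := Nat.mul_le_mul_right _ v.2
  have hget : ∀ w : Fin I.n, (List.finRange I.n)[(w : ℕ)]? = some w := by
    intro w
    rw [List.getElem?_eq_getElem (by simp)]
    simp
  rw [encode_eq, List.getElem?_append_right (by simp), List.length_cons, List.length_cons,
    List.length_cons, List.length_cons, List.length_nil, Nat.add_sub_cancel_left]
  rw [getElem?_flatMap_const (L := I.n * (I.q + 1)) _ _ ?_ (hget u) hv]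
  · rw [getElem?_flatMap_const (L := I.q + 1) _ _ ?_ (hget v) hj]
    intro v _
    exact I.length_block u v
  · intro u _
    rw [length_flatMap_const _ (L := I.q + 1)]
    · simp
    · intro v _
      exact I.length_block u v

/-- The offset 5 skips the length of the word and the four numbers in front of the bits. Splitting
an address into a summand for each vertex avoids multiplication in later lookups. -/
theorem tab_of_init {σ : State} (h0 : σ 0 = init I.encode 0)
    (h2 : ∀ u < I.n, σ 2 u = 5 + u * (I.n * (I.q + 1))) (h3 : ∀ v < I.n, σ 3 v = v * (I.q + 1)) :
    Tab I σ := by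
  have hcell : ∀ i, σ 0 (i + 1) = (I.encode[i]?).getD 0 := by
    intro i
    rw [h0, init, if_pos rfl, List.getD_cons_succ, List.getD_eq_getElem?_getD]
  have hbit : ∀ (u v : Fin I.n) j, j < I.q + 1 →
      σ 0 (σ 2 u + σ 3 v + j) = ((I.block u v)[j]?).getD 0 := by
    intro u v j hj
    rw [← I.encode_get u v hj, ← hcell, h2 u u.2, h3 v v.2]
    congr 1
    ring
  constructor
  · exact hcell 0
  · exact hcell 1
  · exact hcell 2
  · exact hcell 3
  · intro u v
    have := hbit u v 0 (by omega)
    rw [add_zero] at this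
    rw [this]
    by_cases h : I.G.Adj u v <;> simp [block, h]
  · intro u hu v hv c hc
    rw [show u = ((⟨u, hu⟩ : Fin I.n) : ℕ) from rfl, show v = ((⟨v, hv⟩ : Fin I.n) : ℕ) from rfl,
      hbit _ _ _ (by omega)]
    rw [block, List.getElem?_cons_succ, List.getElem?_map, List.getElem?_eq_getElem (by simpa)]
    by_cases h : I.HasColor ⟨u, hu⟩ ⟨v, hv⟩ ⟨c, hc⟩ <;> simp [h, Col, hu, hv, hc]

end CDDP

/-! ### Preparations: tables, vertex cover, matching -/

namespace RAM

open RAM.Expr (var nE qE sE tE)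

/-- Tables for the addresses of the bits. -/
def tables : Cmd :=
  .rep 40 nE (.set 3 (.add (var 40) (.lit 1))
    (.add (.get 3 (var 40)) (.add qE (.lit 1)))) ;;
  .set 2 (.lit 0) (.lit 5) ;;
  .rep 40 nE (.set 2 (.add (var 40) (.lit 1)) (.add (.get 2 (var 40)) (.get 3 nE)))

theorem tables_spec {I : CDDP} {σ : State} (h0 : σ 0 = init I.encode 0) (h3 : σ 3 0 = 0) :
    Tab I (tables.den σ) := by
  have hn : σ 0 1 = I.n := by rw [h0]; rfl
  have hq : σ 0 2 = I.q := by rw [h0]; rfl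
  rw [tables, Cmd.den, Cmd.den]
  set σ1 := Cmd.den (.rep 40 nE (.set 3 (.add (var 40) (.lit 1))
    (.add (.get 3 (var 40)) (.add qE (.lit 1))))) σ with hσ1
  -- The entry at `n` is not the offset of a vertex: it is the length of a whole row, by which the
  -- second loop increments.
  have h1 : ∀ v ≤ I.n, σ1 3 v = v * (I.q + 1) := by
    have := Cmd.for_rule (x := 40) (lim := nE) (P := .set 3 (.add (var 40) (.lit 1))
      (.add (.get 3 (var 40)) (.add qE (.lit 1)))) (σ := σ)
      (fun k τ => ∀ v ≤ k, τ 3 v = v * (I.q + 1)) (by decide)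
      (by intro k τ i v h; simpa [put_apply] using h) (by simpa using h3)
      (by
        intro k _ τ hτ hk h v hv
        have h0' : τ 0 = σ 0 := hτ 0 (by decide)
        simp only [Cmd.den, Expr.eval, hk, put_self, h0', hq]
        split_ifs with hvk
        · rw [h k le_rfl, hvk]; ring
        · exact h v (by omega))
    simpa [Expr.eval, hn] using this
  have e0 : σ1 0 = σ 0 := Cmd.den_frame _ (by decide)
  set σ2 := Cmd.den (.set 2 (.lit 0) (.lit 5)) σ1 with hσ2
  have e0' : σ2 0 = σ 0 := (Cmd.den_frame _ (by decide)).trans e0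
  have e3' : σ2 3 = σ1 3 := Cmd.den_frame _ (by decide)
  have h2 := Cmd.for_rule (x := 40) (lim := nE)
    (P := .set 2 (.add (var 40) (.lit 1)) (.add (.get 2 (var 40)) (.get 3 nE))) (σ := σ2)
    (fun k τ => ∀ u ≤ k, τ 2 u = 5 + u * (I.n * (I.q + 1))) (by decide)
    (by intro k τ i v h; simpa [put_apply] using h)
    (by simp [hσ2, Cmd.den, Expr.eval, put_self])
    (by
      intro k _ τ hτ hk h v hv
      have h0' : τ 0 = σ 0 := (hτ 0 (by decide)).trans e0'
      have h3' : τ 3 = σ1 3 := (hτ 3 (by decide)).trans e3'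
      simp only [Cmd.den, Expr.eval, hk, put_self, h0', hn, h3', h1 _ le_rfl]
      split_ifs with hvk
      · rw [h k le_rfl, hvk]; ring
      · exact h v (by omega))
  simp only [Expr.eval, e0', hn] at h2
  refine CDDP.tab_of_init I ?_ (fun u hu => h2 u hu.le) ?_
  · rw [Cmd.den_frame _ (by decide), e0', h0]
  · intro v hv
    rw [Cmd.den_frame _ (by decide), e3', h1 v hv.le]

/-! ### A vertex cover from a maximal matching -/

/-- A step of the search for a maximal matching in the graph. -/
def coverStep : Cmd :=
  .ite (.and (.adj (var 40) (var 41)) (.and (.not (.get 4 (var 40))) (.not (.get 4 (var 41)))))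
    (.set 4 (var 40) (.lit 1) ;; .set 4 (var 41) (.lit 1) ;;
      .set 5 (.add (var 6) (.lit 1)) (var 40) ;; .set 5 (.add (var 6) (.lit 2)) (var 41) ;;
      .set 6 (.lit 0) (.add (var 6) (.lit 2)))
    .skip

/-- A vertex cover, made of the ends of a maximal matching. -/
def cover : Cmd := .set 5 (.lit 0) tE ;; .rep 40 nE (.rep 41 nE coverStep)

/-- The state of the search for a vertex cover: the set `C` has been found. -/
structure CovInv (I : CDDP) (C : Finset ℕ) (σ : State) : Prop where
  flag : ∀ v, σ 4 v ≠ 0 ↔ v ∈ C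
  card : σ 6 0 = C.card
  zero : σ 5 0 = I.t
  lt : ∀ j, σ 5 j < I.n
  list : ∀ v ∈ C, ∃ j ≤ C.card, σ 5 j = v ∧ j ≠ 0
  small : ∀ V : Set (Fin I.n), I.G.IsVertexCover V → ∃ D ⊆ C, C.card ≤ 2 * D.card ∧
    ∀ x ∈ D, ∃ h : x < I.n, ⟨x, h⟩ ∈ V

theorem CovInv.congr {I : CDDP} {C : Finset ℕ} {σ τ : State} (h : CovInv I C σ)
    (h4 : τ 4 = σ 4) (h5 : τ 5 = σ 5) (h6 : τ 6 = σ 6) : CovInv I C τ where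
  flag := by rw [h4]; exact h.flag
  card := by rw [h6]; exact h.card
  zero := by rw [h5]; exact h.zero
  lt := by rw [h5]; exact h.lt
  list := by rw [h5]; exact h.list
  small := h.small

/-- An edge with two unmarked ends adds both of them to `C`. Any vertex cover contains one of the
two, and this one is new for `D` because `D ⊆ C`; so the factor 2 in the invariant is maintained. -/
theorem coverStep_spec {I : CDDP} {σ : State} {C : Finset ℕ} (ht : Tab I σ) (h : CovInv I C σ)
    (u v : Fin I.n) (hu : σ 40 0 = u) (hv : σ 41 0 = v) :
    ∃ C', C ⊆ C' ∧ CovInv I C' (coverStep.den σ) ∧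
      (I.G.Adj u v → (u : ℕ) ∈ C' ∨ (v : ℕ) ∈ C') := by
  rw [coverStep, Cmd.den]
  split_ifs with hb
  · rw [Expr.eval_and, Expr.eval_and, Expr.eval_not, Expr.eval_not] at hb
    simp only [Expr.eval, hu, hv] at hb
    rw [ht.adj] at hb
    obtain ⟨hadj, hu0, hv0⟩ := hb
    have huC : (u : ℕ) ∉ C := fun hC => (h.flag u).2 hC hu0
    have hvC : (v : ℕ) ∉ C := fun hC => (h.flag v).2 hC hv0
    have huv : (u : ℕ) ≠ v := fun h => hadj.ne (Fin.ext h)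
    have hcard : (insert (u : ℕ) (insert (v : ℕ) C)).card = C.card + 2 := by
      rw [Finset.card_insert_of_notMem (by simp [huv, huC]), Finset.card_insert_of_notMem hvC]
    refine ⟨insert (u : ℕ) (insert (v : ℕ) C), ?_, ?_, fun _ => by simp⟩
    · exact (Finset.subset_insert ..).trans (Finset.subset_insert ..)
    constructor
    · intro x
      simp only [Cmd.den, Expr.eval, put_apply, hu, hv, Finset.mem_insert, ← h.flag]
      simp
      split_ifs <;> simp_all
    · simp [Cmd.den, Expr.eval, put_apply, hcard, h.card]
    · simp [Cmd.den, Expr.eval, put_apply, h.zero]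
    · intro j
      simp only [Cmd.den, Expr.eval, put_apply, hu, hv]
      simp
      split_ifs
      exacts [v.2, u.2, h.lt j]
    · intro x hx
      rw [hcard]
      simp only [Finset.mem_insert] at hx
      simp only [Cmd.den, Expr.eval, put_apply, hu, hv, h.card]
      simp
      rcases hx with rfl | rfl | hx
      · exact ⟨C.card + 1, by omega, by simp, by omega⟩
      · exact ⟨C.card + 2, by omega, by simp, by omega⟩
      · obtain ⟨j, hj, hjx, hj0⟩ := h.list x hx
        refine ⟨j, by omega, ?_, hj0⟩
        rw [if_neg (by omega), if_neg (by omega), hjx]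
    · intro V hV
      obtain ⟨D, hD, hDc, hDV⟩ := h.small V hV
      rcases hV hadj with hm | hm
      · refine ⟨insert (u : ℕ) D, ?_, ?_, ?_⟩
        · exact Finset.insert_subset_insert _ (hD.trans (Finset.subset_insert ..))
        · rw [hcard, Finset.card_insert_of_notMem fun h => huC (hD h)]
          omega
        · intro x hx
          rcases Finset.mem_insert.1 hx with rfl | hx
          exacts [⟨u.2, hm⟩, hDV x hx]
      · refine ⟨insert (v : ℕ) D, ?_, ?_, ?_⟩
        · exact (Finset.insert_subset_insert _ hD).trans (Finset.subset_insert ..)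
        · rw [hcard, Finset.card_insert_of_notMem fun h => hvC (hD h)]
          omega
        · intro x hx
          rcases Finset.mem_insert.1 hx with rfl | hx
          exacts [⟨v.2, hm⟩, hDV x hx]
  · refine ⟨C, subset_rfl, h, fun hadj => ?_⟩
    rw [Expr.eval_and, Expr.eval_and, Expr.eval_not, Expr.eval_not] at hb
    simp only [Expr.eval, hu, hv] at hb
    rw [ht.adj] at hb
    by_contra! hC
    rw [← h.flag, ← h.flag] at hC
    push Not at hC
    exact hb ⟨hadj, hC⟩

theorem cover_spec {I : CDDP} {σ : State} (ht : Tab I σ) (h4 : σ 4 = fun _ => 0)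
    (h5 : σ 5 = fun _ => 0) (h6 : σ 6 = fun _ => 0) :
    ∃ C : Finset ℕ, CovInv I C (cover.den σ) ∧
      ∀ u v : Fin I.n, I.G.Adj u v → (u : ℕ) ∈ C ∨ (v : ℕ) ∈ C := by
  rw [cover, Cmd.den]
  set σ1 := Cmd.den (.set 5 (.lit 0) tE) σ with hσ1
  have ht1 : Tab I σ1 := ht.congr (Cmd.den_frame _ (by decide)) (Cmd.den_frame _ (by decide))
    (Cmd.den_frame _ (by decide))
  -- Unused cells of the target list contain 0, which is a vertex because `n` is positive. Digits
  -- beyond the list therefore still name a vertex.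
  have hinit : CovInv I ∅ σ1 := by
    constructor <;> simp [hσ1, Cmd.den, Expr.eval, put_apply, h4, h5, h6, ht.t]
    intro j
    split_ifs
    exacts [I.t.2, I.t.pos]
  have houter := Cmd.for_rule (x := 40) (lim := nE) (P := .rep 41 nE coverStep) (σ := σ1)
    (fun k τ => ∃ C, CovInv I C τ ∧ ∀ u v : Fin I.n, (u : ℕ) < k → I.G.Adj u v →
      (u : ℕ) ∈ C ∨ (v : ℕ) ∈ C) (by decide) ?_ ⟨∅, hinit, by simp⟩ ?_
  · obtain ⟨C, h1, h2⟩ := houter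
    simp only [Expr.eval, ht1.n] at h2
    exact ⟨C, h1, fun u v => h2 u v u.2⟩
  · rintro k τ i v ⟨C, h1, h2⟩
    exact ⟨C, h1.congr (put_ne (by decide)) (put_ne (by decide)) (put_ne (by decide)), h2⟩
  · rintro k hk τ hτ hkτ ⟨C, h1, h2⟩
    have ht2 : Tab I τ := ht1.congr (hτ 0 (by decide)) (hτ 2 (by decide)) (hτ 3 (by decide))
    simp only [Expr.eval, ht1.n] at hk
    have hinner := Cmd.for_rule (x := 41) (lim := nE) (P := coverStep) (σ := τ)
      (fun l τ => ∃ C, CovInv I C τ ∧ ∀ u v : Fin I.n, ((u : ℕ) < k ∨ (u : ℕ) = k ∧ (v : ℕ) < l) →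
        I.G.Adj u v → (u : ℕ) ∈ C ∨ (v : ℕ) ∈ C) (by decide) ?_
        ⟨C, h1, fun u v h => h2 u v (by omega)⟩ ?_
    · obtain ⟨C, h1, h2⟩ := hinner
      simp only [Expr.eval, ht2.n] at h2
      exact ⟨C, h1, fun u v h => h2 u v (by have := v.2; omega)⟩
    · rintro k τ i v ⟨C, h1, h2⟩
      exact ⟨C, h1.congr (put_ne (by decide)) (put_ne (by decide)) (put_ne (by decide)), h2⟩
    · rintro l hl ρ hρ hlρ ⟨C, h1, h2⟩
      have ht3 : Tab I ρ := ht2.congr (hρ 0 (by decide)) (hρ 2 (by decide)) (hρ 3 (by decide))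
      simp only [Expr.eval, ht2.n] at hl
      obtain ⟨C', hC', h1', h2'⟩ := coverStep_spec ht3 h1 ⟨k, hk⟩ ⟨l, hl⟩
        (by rw [hρ 40 (by decide), hkτ]) hlρ
      refine ⟨C', h1', fun u v huv hadj => ?_⟩
      by_cases hlast : (u : ℕ) = k ∧ (v : ℕ) = l
      · obtain rfl : u = ⟨k, hk⟩ := Fin.ext hlast.1
        obtain rfl : v = ⟨l, hl⟩ := Fin.ext hlast.2
        exact h2' hadj
      · exact (h2 u v (by omega) hadj).imp (fun h => hC' h) (fun h => hC' h)

theorem CovInv.card_le {I : CDDP} {C : Finset ℕ} {σ : State} (h : CovInv I C σ) :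
    C.card ≤ 2 * I.vc := by
  obtain ⟨V, hVc, hV⟩ := I.G.vertexCoverNum_exists
  obtain ⟨D, -, hDc, hDV⟩ := h.small V hV
  have h1 : (D.card : ℕ∞) ≤ V.encard := by
    rw [← Set.encard_coe_eq_coe_finsetCard, ← Fin.val_injective.encard_image V]
    refine Set.encard_le_encard ?_
    intro x hx
    obtain ⟨hlt, hm⟩ := hDV x hx
    exact ⟨_, hm, rfl⟩
  rw [hVc, ← I.coe_vc] at h1
  have : D.card ≤ I.vc := by exact_mod_cast h1
  omega

/-! ### Local search for a matching of vertices and colors -/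

/-- An augmentation by one edge. -/
def augOne : Cmd :=
  .ite (.and (.not (.get 15 (var 43))) (.and (.not (.get 16 (var 42))) (.short (var 42) (var 43))))
    (.set 15 (var 43) (.add (var 42) (.lit 1)) ;; .set 16 (var 42) (.lit 1)) .skip

/-- An augmentation by three edges. -/
def augThree : Cmd :=
  .ite (.and (.get 15 (var 41)) (.and (.not (.get 15 (var 43))) (.and (.not (.get 16 (var 42)))
      (.and (.short (var 42) (var 41)) (.short (.sub (.get 15 (var 41)) (.lit 1)) (var 43))))))
    (.set 15 (var 43) (.get 15 (var 41)) ;; .set 15 (var 41) (.add (var 42) (.lit 1)) ;;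
      .set 16 (var 42) (.lit 1)) .skip

/-- A matching that cannot be improved locally. -/
def matching : Cmd :=
  .rep 40 (.add qE (.lit 1)) (.rep 41 qE (.rep 42 nE (.rep 43 qE (augOne ;; augThree))))

/-- The state of the matching. -/
structure MatchInv (I : CDDP) (σ : State) : Prop where
  tab : Tab I σ
  isMatch : I.IsMatch (σ 15)
  used : ∀ y, σ 16 y ≠ 0 ↔ ∃ c < I.q, σ 15 c = y + 1

theorem MatchInv.put {I : CDDP} {σ : State} (h : MatchInv I σ) {x i v : ℕ} (hx : 40 ≤ x) :
    MatchInv I (put σ x i v) where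
  tab := h.tab.congr (put_ne (by omega)) (put_ne (by omega)) (put_ne (by omega))
  isMatch := by rw [put_ne (by omega)]; exact h.isMatch
  used := by rw [put_ne (by omega), put_ne (by omega)]; exact h.used

/-- The matching admits no augmentation by the edge `yd`, nor one that uses `yc` and frees `d`. -/
def NoAug (I : CDDP) (mc : ℕ → ℕ) (c y d : ℕ) : Prop :=
  ((∀ c < I.q, mc c ≠ y + 1) → mc d = 0 → ¬ I.Short y d) ∧
    ((∀ c < I.q, mc c ≠ y + 1) → mc d = 0 → ∀ x, mc c = x + 1 → I.Short y c → ¬ I.Short x d)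

theorem isStable_of_noAug {I : CDDP} {mc : ℕ → ℕ}
    (h : ∀ c < I.q, ∀ y < I.n, ∀ d < I.q, NoAug I mc c y d) : I.IsStable mc where
  one d hd y h1 h2 h3 := (h d hd y h3.1.2.1 d hd).1 h2 h1 h3
  three c hc d hd x y h1 h2 h3 h4 h5 := (h c hc y h4.1.2.1 d hd).2 h3 h2 x h1 h4 h5

theorem matchSize_succ {q : ℕ} {mc mc' : ℕ → ℕ} {d : ℕ} (hd : d < q) (h0 : mc d = 0)
    (h1 : mc' d ≠ 0) (h : ∀ c, c ≠ d → (mc' c = 0 ↔ mc c = 0)) :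
    CDDP.matchSize q mc + 1 = CDDP.matchSize q mc' := by
  have : ((Finset.range q).filter fun c => mc' c ≠ 0) =
      insert d ((Finset.range q).filter fun c => mc c ≠ 0) := by
    ext c
    by_cases hc : c = d
    · subst hc; simp [hd, h1]
    · simp [hc, h c hc]
  rw [CDDP.matchSize, CDDP.matchSize, this, Finset.card_insert_of_notMem (by simp [h0])]

/-- What happens in a part of the search for augmentations of which `Q` is the outcome if nothing
can be improved. -/
def Progress (I : CDDP) (σ τ : State) (Q : Prop) : Prop :=
  MatchInv I τ ∧ ((CDDP.matchSize I.q (σ 15) < CDDP.matchSize I.q (τ 15) ∧ ¬ I.IsStable (σ 15)) ∨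
    (τ 15 = σ 15 ∧ Q))

theorem Progress.trans {I : CDDP} {σ τ υ : State} {Q Q' : Prop} (h : Progress I σ τ Q)
    (h' : Progress I τ υ Q') : Progress I σ υ (Q ∧ Q') := by
  refine ⟨h'.1, ?_⟩
  rcases h.2 with ⟨h1, h2⟩ | ⟨h1, h2⟩ <;> rcases h'.2 with ⟨h3, h4⟩ | ⟨h3, h4⟩
  · exact .inl ⟨h1.trans h3, h2⟩
  · exact .inl ⟨by rw [h3]; exact h1, h2⟩
  · rw [h1] at h3 h4
    exact .inl ⟨h3, h4⟩
  · exact .inr ⟨h3.trans h1, h2, h4⟩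

theorem Progress.mono {I : CDDP} {σ τ : State} {Q Q' : Prop} (h : Progress I σ τ Q)
    (hQ : τ 15 = σ 15 → Q → Q') : Progress I σ τ Q' :=
  ⟨h.1, h.2.imp id fun h => ⟨h.1, hQ h.1 h.2⟩⟩

theorem Progress.put {I : CDDP} {σ τ : State} {Q : Prop} (h : Progress I σ τ Q) {x i v : ℕ}
    (hx : 40 ≤ x) : Progress I σ (put τ x i v) Q :=
  ⟨h.1.put hx, by rw [put_ne (by omega)]; exact h.2⟩

theorem augOne_spec {I : CDDP} {σ : State} (h : MatchInv I σ) {y d : ℕ} (hy : y < I.n)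
    (hd : d < I.q) (h42 : σ 42 0 = y) (h43 : σ 43 0 = d) : Progress I σ (augOne.den σ)
      ((∀ c < I.q, σ 15 c ≠ y + 1) → σ 15 d = 0 → ¬ I.Short y d) := by
  have hfree : σ 16 y = 0 ↔ ∀ c < I.q, σ 15 c ≠ y + 1 := by
    have := h.used y
    constructor
    · intro h0 c hc h1
      exact this.2 ⟨c, hc, h1⟩ h0
    · intro h0
      by_contra h1
      obtain ⟨c, hc, h2⟩ := this.1 h1
      exact h0 c hc h2
  rw [augOne, Cmd.den]
  have hbs : (Expr.and (.not (.get 15 (var 43))) (.and (.not (.get 16 (var 42)))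
      (.short (var 42) (var 43)))).eval σ ≠ 0 ↔ σ 15 d = 0 ∧ σ 16 y = 0 ∧ I.Short y d := by
    rw [Expr.eval_and, Expr.eval_and, Expr.eval_not, Expr.eval_not, h.tab.short (by simpa [Expr.eval, h42])
      (by simpa [Expr.eval, h43])]
    simp [Expr.eval, h42, h43]
  split_ifs with hb
  · rw [hbs] at hb
    obtain ⟨hd0, hy0, hs⟩ := hb
    have hy0' := hfree.1 hy0
    set τ := Cmd.den (.set 15 (var 43) (.add (var 42) (.lit 1)) ;; .set 16 (var 42) (.lit 1)) σ
      with hτ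
    have h15 : ∀ c, τ 15 c = if c = d then y + 1 else σ 15 c := by
      intro c; simp [hτ, Cmd.den, Expr.eval, put_apply, h42, h43]
    have h16 : ∀ x, τ 16 x = if x = y then 1 else σ 16 x := by
      intro c; simp [hτ, Cmd.den, Expr.eval, put_apply, h42]
    refine ⟨⟨?_, ?_, ?_⟩, .inl ⟨?_, fun hst => hst.one d hd y hd0 hy0' hs⟩⟩
    · exact h.tab.congr (Cmd.den_frame _ (by decide)) (Cmd.den_frame _ (by decide))
        (Cmd.den_frame _ (by decide))
    · constructor
      · intro c hc x hx
        rw [h15] at hx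
        split_ifs at hx with hcd
        · obtain rfl : y = x := by omega
          exact hcd ▸ hs
        · exact h.isMatch.short c hc x hx
      · intro c hc c' hc' h0 h1
        rw [h15] at h0 h1
        rw [h15] at h1
        split_ifs at h0 h1 with h2 h3 h3
        · rw [h2, h3]
        · exact absurd h1.symm (hy0' c' hc')
        · exact absurd h1 (hy0' c hc)
        · exact h.isMatch.inj c hc c' hc' h0 h1
    · intro x
      rw [h16]
      simp only [h15]
      by_cases hxy : x = y
      · subst hxy
        simp only [if_true]
        exact ⟨fun _ => ⟨d, hd, by simp⟩, fun _ => by omega⟩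
      · rw [if_neg hxy, h.used]
        constructor
        · rintro ⟨c, hc, hcx⟩
          refine ⟨c, hc, ?_⟩
          rw [if_neg]
          · exact hcx
          · rintro rfl; omega
        · rintro ⟨c, hc, hcx⟩
          split_ifs at hcx
          · omega
          · exact ⟨c, hc, hcx⟩
    · have := matchSize_succ (mc := σ 15) (mc' := τ 15) hd hd0 (by rw [h15]; simp)
        (fun c hc => by rw [h15, if_neg hc])
      omega
  · rw [hbs] at hb
    refine ⟨h, .inr ⟨rfl, ?_⟩⟩
    intro h1 h2 h3
    exact hb ⟨h2, hfree.2 h1, h3⟩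

/-- The color `c` hands its vertex `x` to the free color `d` and takes the free vertex `y` instead.
Only `d` changes from free to matched, so the size grows by one, and `x` stays in use. -/
theorem augThree_spec {I : CDDP} {σ : State} (h : MatchInv I σ) {c y d : ℕ} (hc : c < I.q)
    (hy : y < I.n) (hd : d < I.q) (h41 : σ 41 0 = c) (h42 : σ 42 0 = y) (h43 : σ 43 0 = d) :
    Progress I σ (augThree.den σ) ((∀ c < I.q, σ 15 c ≠ y + 1) → σ 15 d = 0 →
      ∀ x, σ 15 c = x + 1 → I.Short y c → ¬ I.Short x d) := by
  have hfree : σ 16 y = 0 ↔ ∀ c < I.q, σ 15 c ≠ y + 1 := by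
    have := h.used y
    constructor
    · intro h0 c hc h1
      exact this.2 ⟨c, hc, h1⟩ h0
    · intro h0
      by_contra h1
      obtain ⟨c, hc, h2⟩ := this.1 h1
      exact h0 c hc h2
  have hlt : σ 15 c - 1 < I.n := by
    rcases Nat.eq_zero_or_pos (σ 15 c) with h0 | h0
    · rw [h0]; exact I.s.pos
    · exact (h.isMatch.short c hc (σ 15 c - 1) (by omega)).1.2.1
  rw [augThree, Cmd.den]
  have hbs : (Expr.and (.get 15 (var 41)) (.and (.not (.get 15 (var 43)))
      (.and (.not (.get 16 (var 42))) (.and (.short (var 42) (var 41))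
        (.short (.sub (.get 15 (var 41)) (.lit 1)) (var 43)))))).eval σ ≠ 0 ↔
      σ 15 c ≠ 0 ∧ σ 15 d = 0 ∧ σ 16 y = 0 ∧ I.Short y c ∧ I.Short (σ 15 c - 1) d := by
    rw [Expr.eval_and, Expr.eval_and, Expr.eval_and, Expr.eval_and, Expr.eval_not, Expr.eval_not,
      h.tab.short (by simpa [Expr.eval, h42]) (by simpa [Expr.eval, h41]),
      h.tab.short (by simpa [Expr.eval, h41]) (by simpa [Expr.eval, h43])]
    simp [Expr.eval, h41, h42, h43]
  split_ifs with hb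
  · rw [hbs] at hb
    obtain ⟨hc0, hd0, hy0, hs, hs'⟩ := hb
    have hy0' := hfree.1 hy0
    obtain ⟨x, hx⟩ : ∃ x, σ 15 c = x + 1 := ⟨σ 15 c - 1, by omega⟩
    rw [hx, Nat.add_sub_cancel] at hs'
    have hcd : c ≠ d := by rintro rfl; exact hc0 hd0
    set τ := Cmd.den (.set 15 (var 43) (.get 15 (var 41)) ;;
      .set 15 (var 41) (.add (var 42) (.lit 1)) ;; .set 16 (var 42) (.lit 1)) σ with hτ
    have h15 : ∀ e, τ 15 e = if e = c then y + 1 else if e = d then x + 1 else σ 15 e := by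
      intro e; simp [hτ, Cmd.den, Expr.eval, put_apply, h42, h43, h41, hx]
    have h16 : ∀ x, τ 16 x = if x = y then 1 else σ 16 x := by
      intro c; simp [hτ, Cmd.den, Expr.eval, put_apply, h42]
    refine ⟨⟨?_, ?_, ?_⟩, .inl ⟨?_, fun hst => hst.three c hc d hd x y hx hd0 hy0' hs hs'⟩⟩
    · exact h.tab.congr (Cmd.den_frame _ (by decide)) (Cmd.den_frame _ (by decide))
        (Cmd.den_frame _ (by decide))
    · have hinj : ∀ e < I.q, σ 15 e = x + 1 → e = c := fun e he hex =>
        h.isMatch.inj e he c hc (by omega) (by omega)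
      constructor
      · intro e he z hz
        rw [h15] at hz
        split_ifs at hz with h1 h2
        · obtain rfl : y = z := by omega
          exact h1 ▸ hs
        · obtain rfl : x = z := by omega
          exact h2 ▸ hs'
        · exact h.isMatch.short e he z hz
      · intro e he e' he' h0 h1
        have hxy : x ≠ y := by rintro rfl; exact hy0' c hc hx
        have g1 := hinj e he
        have g2 := hinj e' he'
        have g3 := hy0' e he
        have g4 := hy0' e' he'
        have g5 := h.isMatch.inj e he e' he'
        rw [h15] at h0 h1
        rw [h15] at h1
        split_ifs at h0 h1 <;> omega
    · intro z
      rw [h16]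
      simp only [h15]
      by_cases hxy : z = y
      · subst hxy
        simp only [if_true]
        exact ⟨fun _ => ⟨c, hc, by simp⟩, fun _ => by omega⟩
      · rw [if_neg hxy, h.used]
        constructor
        · rintro ⟨e, he, hez⟩
          by_cases hec : e = c
          · refine ⟨d, hd, ?_⟩
            rw [if_neg (Ne.symm hcd), if_pos rfl]
            rw [hec] at hez
            omega
          · refine ⟨e, he, ?_⟩
            rw [if_neg hec, if_neg]
            · exact hez
            · rintro rfl; omega
        · rintro ⟨e, he, hez⟩
          split_ifs at hez
          · omega
          · exact ⟨c, hc, by omega⟩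
          · exact ⟨e, he, hez⟩
    · have := matchSize_succ (mc := σ 15) (mc' := τ 15) hd hd0 (by rw [h15]; split_ifs <;> omega)
        (fun e he => by
          rw [h15, if_neg he]
          split_ifs with h1
          · rw [h1]; simp [hc0]
          · rfl)
      omega
  · rw [hbs] at hb
    refine ⟨h, .inr ⟨rfl, ?_⟩⟩
    intro h1 h2 x h3 h4 h5
    exact hb ⟨by omega, h2, hfree.2 h1, h4, by rw [h3]; exact h5⟩

theorem aug_spec {I : CDDP} {σ : State} (h : MatchInv I σ) {c y d : ℕ} (hc : c < I.q)
    (hy : y < I.n) (hd : d < I.q) (h41 : σ 41 0 = c) (h42 : σ 42 0 = y) (h43 : σ 43 0 = d) :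
    Progress I σ ((augOne ;; augThree).den σ) (NoAug I (σ 15) c y d) := by
  have h1 := augOne_spec h hy hd h42 h43
  have h2 := augThree_spec h1.1 hc hy hd ((congrFun (Cmd.den_frame _ (by decide)) _).trans h41)
    ((congrFun (Cmd.den_frame _ (by decide)) _).trans h42)
    ((congrFun (Cmd.den_frame _ (by decide)) _).trans h43)
  rcases h1.2 with h3 | ⟨h3, h4⟩
  -- If the first augmentation took place, the matching cannot be unchanged at the end, because the
  -- second test never decreases its size.
  · refine (h1.trans h2).mono fun h5 h6 => ?_
    have h7 : CDDP.matchSize I.q ((augOne.den σ) 15) ≤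
        CDDP.matchSize I.q ((augThree.den (augOne.den σ)) 15) := by
      rcases h2.2 with h8 | h8
      · exact h8.1.le
      · rw [h8.1]
    rw [h5] at h7
    omega
  · refine (h1.trans h2).mono fun _ h6 => ?_
    rw [h3] at h6
    exact ⟨h6.1, h6.2⟩

/-- A loop over parts of the search for augmentations. -/
theorem progress_rep {I : CDDP} {σ : State} {x : ℕ} {lim : Expr} {P : Cmd} (hx : x ∉ P.writes)
    (hx' : 40 ≤ x) (h : MatchInv I σ) (Q : (ℕ → ℕ) → ℕ → Prop)
    (hs : ∀ k < lim.eval σ, ∀ τ : State, (∀ a, a ∉ x :: P.writes → τ a = σ a) → τ x 0 = k →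
      MatchInv I τ → Progress I τ (P.den τ) (Q (τ 15) k)) :
    Progress I σ ((Cmd.rep x lim P).den σ) (∀ k < lim.eval σ, Q (σ 15) k) := by
  refine Cmd.for_rule (fun k τ => Progress I σ τ (∀ l < k, Q (σ 15) l)) hx
    (fun k τ i v h => h.put hx') ⟨h, .inr ⟨rfl, by simp⟩⟩ ?_
  intro k hk τ hτ hkτ hp
  have h1 := hs k hk τ hτ hkτ hp.1
  refine ⟨h1.1, ?_⟩
  rcases hp.2 with ⟨h2, h3⟩ | ⟨h2, h3⟩ <;> rcases h1.2 with ⟨h4, h5⟩ | ⟨h4, h5⟩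
  · exact .inl ⟨h2.trans h4, h3⟩
  · exact .inl ⟨by rw [h4]; exact h2, h3⟩
  · rw [h2] at h4 h5
    exact .inl ⟨h4, h5⟩
  · rw [h2] at h4 h5
    refine .inr ⟨h4, fun l hl => ?_⟩
    rcases Nat.lt_succ_iff_lt_or_eq.1 hl with hl | rfl
    exacts [h3 l hl, h5]

/-- If a sweep leaves the matching unchanged, all triples of a color, a vertex and a color have been
tested against one and the same matching, which is therefore stable. -/
theorem sweep_spec {I : CDDP} {σ : State} (h : MatchInv I σ) :
    Progress I σ ((Cmd.rep 41 qE (.rep 42 nE (.rep 43 qE (augOne ;; augThree)))).den σ)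
      (I.IsStable (σ 15)) := by
  refine (progress_rep (by decide) (by decide) h
    (fun mc c => ∀ y < I.n, ∀ d < I.q, NoAug I mc c y d) ?_).mono ?_
  · intro c hc τ hτ hcτ hτi
    have hq : σ 0 2 = I.q := h.tab.q
    simp only [Expr.eval, hq] at hc
    refine (progress_rep (by decide) (by decide) hτi
      (fun mc y => ∀ d < I.q, NoAug I mc c y d) ?_).mono ?_
    · intro y hy ρ hρ hyρ hρi
      simp only [Expr.eval, hτi.tab.n] at hy
      refine (progress_rep (by decide) (by decide) hρi (fun mc d => NoAug I mc c y d) ?_).mono ?_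
      · intro d hd π hπ hdπ hπi
        simp only [Expr.eval, hρi.tab.q] at hd
        exact aug_spec hπi hc hy hd (by rw [hπ 41 (by decide), hρ 41 (by decide), hcτ])
          (by rw [hπ 42 (by decide), hyρ]) hdπ
      · intro _ h1
        simpa only [Expr.eval, hρi.tab.q] using h1
    · intro _ h1
      simpa only [Expr.eval, hτi.tab.n] using h1
  · intro _ h1
    simp only [Expr.eval, h.tab.q] at h1
    exact isStable_of_noAug h1

theorem matching_spec {I : CDDP} {σ : State} (ht : Tab I σ) (h15 : σ 15 = fun _ => 0)
    (h16 : σ 16 = fun _ => 0) :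
    MatchInv I (matching.den σ) ∧ I.IsStable ((matching.den σ) 15) := by
  have h0 : MatchInv I σ := by
    refine ⟨ht, ⟨?_, ?_⟩, ?_⟩ <;> simp [h15, h16]
  have := Cmd.for_rule (x := 40) (lim := .add qE (.lit 1))
    (P := .rep 41 qE (.rep 42 nE (.rep 43 qE (augOne ;; augThree)))) (σ := σ)
    -- A matching has at most `q` edges, so `q + 1` sweeps cannot all enlarge it. A stable matching
    -- is not changed any more; for this purpose `Progress` records that an enlarged matching was
    -- not stable.
    (fun k τ => MatchInv I τ ∧ (k ≤ CDDP.matchSize I.q (τ 15) ∨ I.IsStable (τ 15))) (by decide)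
    (by
      intro k τ i v h
      rw [put_ne (by decide)]
      exact ⟨h.1.put (by decide), h.2⟩) ⟨h0, .inl (Nat.zero_le _)⟩ ?_
  · refine ⟨this.1, this.2.resolve_left ?_⟩
    simp only [Expr.eval, ht.q]
    have : CDDP.matchSize I.q ((matching.den σ) 15) ≤ I.q := by
      refine (Finset.card_le_card (Finset.filter_subset ..)).trans ?_
      simp
    rw [matching] at this
    omega
  · rintro k - τ - - ⟨h1, h2⟩
    have h3 := sweep_spec h1
    refine ⟨h3.1, ?_⟩
    rcases h3.2 with ⟨h4, h5⟩ | ⟨h4, h5⟩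
    · have := h2.resolve_right h5
      exact .inl (by omega)
    · rw [h4]
      exact .inr h5

/-! ### Output of packings -/

/-- The constants of the search: the instance, the list of targets, the number `m` of cover
vertices, the number `R` of rounds, and a bound for the length of the output. -/
structure Env (I : CDDP) (m R : ℕ) (tg mc : ℕ → ℕ) (σ : State) : Prop where
  tab : Tab I σ
  target : σ 5 = tg
  target_zero : tg 0 = I.t
  target_lt : ∀ j, tg j < I.n
  coverSize : σ 6 0 = m
  paths : σ 7 0 = 4 * m
  roundNum : σ 8 0 = R
  width : σ 9 0 = 2 * (m + 1) + R
  wordBound : σ 14 0 = I.q * (I.n + 2) + 2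
  mate : σ 15 = mc

/-- The search writes only array 1, the output, and arrays from 20 on. All its constants lie in the
other arrays below 20, so they survive every part of it. -/
theorem Env.congr {I : CDDP} {m R : ℕ} {tg mc : ℕ → ℕ} {σ τ : State} (h : Env I m R tg mc σ)
    (hτ : ∀ a < 20, a ≠ 1 → τ a = σ a) : Env I m R tg mc τ where
  tab := h.tab.congr (hτ 0 (by decide) (by decide)) (hτ 2 (by decide) (by decide))
    (hτ 3 (by decide) (by decide))
  target := by rw [hτ 5 (by decide) (by decide), h.target]
  target_zero := h.target_zero
  target_lt := h.target_lt
  coverSize := by rw [hτ 6 (by decide) (by decide), h.coverSize]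
  paths := by rw [hτ 7 (by decide) (by decide), h.paths]
  roundNum := by rw [hτ 8 (by decide) (by decide), h.roundNum]
  width := by rw [hτ 9 (by decide) (by decide), h.width]
  wordBound := by rw [hτ 14 (by decide) (by decide), h.wordBound]
  mate := by rw [hτ 15 (by decide) (by decide), h.mate]

theorem Env.den {I : CDDP} {m R : ℕ} {tg mc : ℕ → ℕ} {σ : State} (h : Env I m R tg mc σ)
    {P : Cmd} (hP : ∀ a ∈ P.writes, a = 1 ∨ 20 ≤ a) : Env I m R tg mc (P.den σ) :=
  h.congr fun a ha h1 => Cmd.den_frame _ fun hw => by have := hP a hw; omega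

theorem Env.of_frame {I : CDDP} {m R : ℕ} {tg mc : ℕ → ℕ} {σ τ : State} (h : Env I m R tg mc σ)
    {L : List ℕ} (hτ : ∀ a, a ∉ L → τ a = σ a) (hL : ∀ a ∈ L, a = 1 ∨ 20 ≤ a) :
    Env I m R tg mc τ :=
  h.congr fun a ha h1 => hτ a fun hw => by have := hL a hw; omega

/-- The array `f` holds the output word of the packing `S`, with its length in front. -/
def WordIs (f : ℕ → ℕ) (S : List (ℕ × List ℕ)) : Prop :=
  Holds f ((CDDP.word S).length :: CDDP.word S)

/-- The array `f` is the indicator of the set `X` of keys. -/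
def SetIs (I : CDDP) (f : ℕ → ℕ) (X : Finset ℕ) : Prop :=
  ∀ x < I.n + I.q, f x ≠ 0 ↔ x ∈ X

theorem word_append_singleton (S : List (ℕ × List ℕ)) (c : ℕ) (l : List ℕ) :
    CDDP.word (S ++ [(c, l)]) = (S.length + 1) :: ((CDDP.word S).tail ++ c :: l.length :: l) := by
  simp [CDDP.word]

theorem word_eq_cons (S : List (ℕ × List ℕ)) :
    CDDP.word S = S.length :: (CDDP.word S).tail := rfl

theorem wordIs_iff {f : ℕ → ℕ} {S : List (ℕ × List ℕ)} : WordIs f S ↔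
    f 0 = (CDDP.word S).length ∧ f 1 = S.length ∧ Holds (fun i => f (i + 2)) (CDDP.word S).tail := by
  rw [WordIs, word_eq_cons S, holds_cons, holds_cons]
  rfl

/-- Append the path in the buffer to the output word. -/
def emit : Cmd :=
  .set 20 (.add (.get 20 (.lit 0)) (.lit 1)) (var 30) ;;
  .set 20 (.add (.get 20 (.lit 0)) (.lit 2)) (var 24) ;;
  .rep 45 nE (.ite (.sub (var 24) (var 45))
    (.set 20 (.add (.add (.get 20 (.lit 0)) (.lit 3)) (var 45)) (.get 23 (var 45)) ;;
      .ite (.add (.eq (var 45) (.lit 1))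
          (.and (var 45) (.sub (var 24) (.add (var 45) (.lit 1)))))
        (.set 21 (.get 23 (var 45)) (.lit 1)) .skip) .skip) ;;
  .set 21 (.add nE (var 30)) (.lit 1) ;;
  .set 20 (.lit 0) (.add (.add (.get 20 (.lit 0)) (.lit 2)) (var 24)) ;;
  .set 20 (.lit 1) (.add (.get 20 (.lit 1)) (.lit 1))

/-- The position `i` of a path of length `len` belongs to the keys of the path. -/
def IsKeyPos (len i : ℕ) : Prop := i = 1 ∨ 1 ≤ i ∧ i + 1 < len

theorem eval_isKeyPos {σ : State} {x y : Expr} :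
    (Expr.add (.eq x (.lit 1)) (.and x (.sub y (.add x (.lit 1))))).eval σ ≠ 0 ↔
      IsKeyPos (y.eval σ) (x.eval σ) := by
  rw [Expr.eval_or, Expr.eval_eq, Expr.eval_and, Expr.eval_lt, IsKeyPos]
  simp only [Expr.eval]
  omega

/-- The old word occupies the cells 1 to `N`, where `N` is stored in cell 0, so the color goes to
cell `N + 1`, the number of vertices to `N + 2`, and the vertices follow. The loop runs up to `n`,
with a test, instead of up to the length of the path: limits of loops must not be changed by the
program, and `n` is large enough for every path. -/
theorem emit_spec {I : CDDP} {m R : ℕ} {tg mc : ℕ → ℕ} {σ : State} (hE : Env I m R tg mc σ)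
    {S : List (ℕ × List ℕ)} {c : ℕ} {l : List ℕ} (hr : I.IsRoute c l) (hw : WordIs (σ 20) S)
    (hu : SetIs I (σ 21) (I.used S)) (hc : σ 30 0 = c) (hl : σ 24 0 = l.length)
    (hb : Holds (σ 23) l) :
    WordIs ((emit.den σ) 20) (S ++ [(c, l)]) ∧
      SetIs I ((emit.den σ) 21) (I.used (S ++ [(c, l)])) := by
  rw [wordIs_iff] at hw
  obtain ⟨hw0, hw1, hw2⟩ := hw
  set N := (CDDP.word S).length with hN
  have hN1 : 1 ≤ N := by rw [hN, word_eq_cons]; simp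
  rw [emit, Cmd.den_seq, Cmd.den_seq, Cmd.den_seq]
  set σ1 := Cmd.den (.set 20 (.add (.get 20 (.lit 0)) (.lit 2)) (var 24))
    (Cmd.den (.set 20 (.add (.get 20 (.lit 0)) (.lit 1)) (var 30)) σ) with hσ1
  have e20 : ∀ i, σ1 20 i = if i = N + 2 then l.length else if i = N + 1 then c else σ 20 i := by
    intro i
    simp [hσ1, Cmd.den, Expr.eval, put_apply, hw0, hc, hl]
  have e21 : σ1 21 = σ 21 := by simp [hσ1, Cmd.den, put_ne]
  have e23 : σ1 23 = σ 23 := by simp [hσ1, Cmd.den, put_ne]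
  have e24 : σ1 24 = σ 24 := by simp [hσ1, Cmd.den, put_ne]
  have e30 : σ1 30 = σ 30 := by simp [hσ1, Cmd.den, put_ne]
  have e0 : σ1 0 = σ 0 := by simp [hσ1, Cmd.den, put_ne]
  set P : Cmd := (.ite (.sub (var 24) (var 45))
    (.set 20 (.add (.add (.get 20 (.lit 0)) (.lit 3)) (var 45)) (.get 23 (var 45)) ;;
      .ite (.add (.eq (var 45) (.lit 1))
          (.and (var 45) (.sub (var 24) (.add (var 45) (.lit 1)))))
        (.set 21 (.get 23 (var 45)) (.lit 1)) .skip) .skip) with hP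
  have hloop := Cmd.for_rule (x := 45) (lim := nE) (P := P) (σ := σ1)
    (fun k τ => (∀ i < N + 3, τ 20 i = σ1 20 i) ∧ (∀ i < k, i < l.length → τ 20 (N + 3 + i) = σ 23 i) ∧
      ∀ x, τ 21 x ≠ 0 ↔ σ 21 x ≠ 0 ∨ ∃ i < k, IsKeyPos l.length i ∧ l[i]? = some x)
    (by decide) (by intro k τ i v h; rw [put_ne (by decide), put_ne (by decide)]; exact h)
    (by simp [e21]) (by
      rintro k hk τ hτ hkτ ⟨h1, h2, h3⟩
      have t23 : τ 23 = σ 23 := (hτ 23 (by decide)).trans e23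
      have t24 : τ 24 0 = l.length := by rw [hτ 24 (by decide), e24, hl]
      have t20 : τ 20 0 = N := by rw [h1 0 (by omega), e20]; simp [hw0]
      rw [hP, Cmd.den_ite]
      split_ifs with hlt
      · rw [Expr.eval_lt] at hlt
        simp only [Expr.eval, hkτ, t24] at hlt
        rw [Cmd.den_seq]
        set τ1 := Cmd.den (.set 20 (.add (.add (.get 20 (.lit 0)) (.lit 3)) (var 45))
          (.get 23 (var 45))) τ with hτ1
        have f20 : ∀ i, τ1 20 i = if i = N + 3 + k then σ 23 k else τ 20 i := by
          intro i; simp [hτ1, Cmd.den, Expr.eval, put_apply, t20, hkτ, t23]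
        have f21 : τ1 21 = τ 21 := by simp [hτ1, Cmd.den, put_ne]
        have f23 : τ1 23 = σ 23 := by simp [hτ1, Cmd.den, put_ne, t23]
        have f24 : τ1 24 = τ 24 := by simp [hτ1, Cmd.den, put_ne]
        have f45 : τ1 45 = τ 45 := by simp [hτ1, Cmd.den, put_ne]
        set τ2 := Cmd.den (.ite (.add (.eq (var 45) (.lit 1))
          (.and (var 45) (.sub (var 24) (.add (var 45) (.lit 1)))))
          (.set 21 (.get 23 (var 45)) (.lit 1)) .skip) τ1 with hτ2
        have g20 : τ2 20 = τ1 20 := Cmd.den_frame _ (by decide)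
        have g21 : ∀ x, τ2 21 x ≠ 0 ↔ τ 21 x ≠ 0 ∨ IsKeyPos l.length k ∧ σ 23 k = x := by
          intro x
          rw [hτ2, Cmd.den_ite]
          have hkey := eval_isKeyPos (σ := τ1) (x := var 45) (y := var 24)
          simp only [Expr.eval, f24, f45, hkτ, t24] at hkey
          split_ifs with hkp
          · simp only [Expr.eval, f24, f45, hkτ, t24] at hkp
            rw [hkey] at hkp
            simp only [Cmd.den, Expr.eval, put_apply, f45, hkτ, f23, f21]
            simp only [if_true]
            split_ifs with hx
            · simp [hkp, hx]
            · simp [hkp, Ne.symm hx]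
          · simp only [Expr.eval, f24, f45, hkτ, t24] at hkp
            rw [hkey] at hkp
            simp [Cmd.den, f21, hkp]
        refine ⟨?_, ?_, ?_⟩
        · intro i hi
          rw [g20, f20, if_neg (by omega), h1 i hi]
        · intro i hi hil
          rw [g20, f20]
          split_ifs with h
          · rw [show i = k by omega]
          · exact h2 i (by omega) hil
        · intro x
          rw [g21, h3]
          constructor
          · rintro ((h | ⟨i, hi, h⟩) | ⟨h, h'⟩)
            · exact .inl h
            · exact .inr ⟨i, by omega, h⟩
            · refine .inr ⟨k, by omega, h, ?_⟩
              rw [List.getElem?_eq_getElem hlt, ← hb.get hlt, h']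
          · rintro (h | ⟨i, hi, h, h'⟩)
            · exact .inl (.inl h)
            · rcases Nat.lt_succ_iff_lt_or_eq.1 hi with hi | rfl
              · exact .inl (.inr ⟨i, hi, h, h'⟩)
              · exact .inr ⟨h, hb _ _ h'⟩
      · rw [Expr.eval_lt] at hlt
        simp only [Expr.eval, hkτ, t24] at hlt
        refine ⟨h1, fun i hi hil => h2 i (by omega) hil, ?_⟩
        intro x
        rw [Cmd.den, h3]
        refine or_congr_right ⟨fun ⟨i, hi, h⟩ => ⟨i, by omega, h⟩, fun ⟨i, hi, h, h'⟩ => ⟨i, ?_, h, h'⟩⟩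
        have := (List.getElem?_eq_some_iff.1 h').1
        omega)
  simp only [Expr.eval, e0, hE.tab.n] at hloop
  set σ2 := Cmd.den (.rep 45 nE P) σ1 with hσ2
  obtain ⟨h1, h2, h3⟩ := hloop
  have s24 : σ2 24 0 = l.length := by rw [hσ2, Cmd.den_frame _ (by decide), e24, hl]
  have s30 : σ2 30 0 = c := by rw [hσ2, Cmd.den_frame _ (by decide), e30, hc]
  have s0 : σ2 0 = σ 0 := by rw [hσ2, Cmd.den_frame _ (by decide), e0]
  have s20 : σ2 20 0 = N := by rw [h1 0 (by omega), e20]; simp [hw0]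
  have s20' : σ2 20 1 = S.length := by
    rw [h1 1 (by omega), e20, if_neg (by omega), if_neg (by omega), hw1]
  have hlen := hr.length_le
  constructor
  · have hwl : (CDDP.word (S ++ [(c, l)])).length = N + 2 + l.length := by
      rw [word_append_singleton]
      simp only [List.length_cons, List.length_append, List.length_tail]
      omega
    have hfin : ∀ i, Cmd.den (.set 21 (.add nE (var 30)) (.lit 1) ;;
        .set 20 (.lit 0) (.add (.add (.get 20 (.lit 0)) (.lit 2)) (var 24)) ;;
        .set 20 (.lit 1) (.add (.get 20 (.lit 1)) (.lit 1))) σ2 20 i =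
        if i = 1 then S.length + 1 else if i = 0 then N + 2 + l.length else σ2 20 i := by
      intro i
      simp [Cmd.den, Expr.eval, put_apply, s20, s20', s24]
    rw [wordIs_iff, hwl, hfin, hfin]
    refine ⟨by simp, by simp, ?_⟩
    simp only [hfin]
    rw [word_append_singleton, List.tail_cons, holds_append]
    constructor
    · refine hw2.congr ?_
      intro i hi
      rw [List.length_tail] at hi
      rw [if_neg (by omega), if_neg (by omega), h1 _ (by omega), e20, if_neg (by omega),
        if_neg (by omega)]
    · rw [List.length_tail, holds_cons, holds_cons]
      refine ⟨?_, ?_, ?_⟩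
      · rw [if_neg (by omega), if_neg (by omega), h1 _ (by omega), e20, if_neg (by omega),
          if_pos (by omega)]
      · rw [if_neg (by omega), if_neg (by omega), h1 _ (by omega), e20, if_pos (by omega)]
      · refine hb.congr ?_
        intro i hi
        rw [if_neg (by omega), if_neg (by omega), show N - 1 + (i + 1 + 1) + 2 = N + 3 + i by omega,
          h2 i (by omega) hi]
  · have hfin : ∀ x, Cmd.den (.set 21 (.add nE (var 30)) (.lit 1) ;;
        .set 20 (.lit 0) (.add (.add (.get 20 (.lit 0)) (.lit 2)) (var 24)) ;;
        .set 20 (.lit 1) (.add (.get 20 (.lit 1)) (.lit 1))) σ2 21 x =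
        if x = I.n + c then 1 else σ2 21 x := by
      intro i
      simp [Cmd.den, Expr.eval, put_apply, s30, s0, hE.tab.n]
    intro x hx
    rw [hfin, CDDP.used_append, CDDP.used_singleton, Finset.mem_union, List.mem_toFinset,
      CDDP.mem_keys, ← hu x hx]
    have h3x := h3 x
    have hpos : (∃ i < I.n, IsKeyPos l.length i ∧ l[i]? = some x) ↔
        ∃ i, (i = 1 ∨ 1 ≤ i ∧ i + 1 < l.length) ∧ l[i]? = some x := by
      refine ⟨fun ⟨i, _, h⟩ => ⟨i, h⟩, fun ⟨i, h, h'⟩ => ⟨i, ?_, h, h'⟩⟩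
      have := (List.getElem?_eq_some_iff.1 h').1
      omega
    rw [hpos] at h3x
    split_ifs with hxc
    · simp [hxc]
    · rw [h3x]
      simp [hxc]

/-- Start with the empty packing. -/
def reset : Cmd :=
  .set 20 (.lit 0) (.lit 1) ;; .set 20 (.lit 1) (.lit 0) ;;
  .rep 45 (.add nE qE) (.set 21 (var 45) (.lit 0))

theorem reset_spec {I : CDDP} {σ : State} (hT : Tab I σ) :
    WordIs ((reset.den σ) 20) [] ∧ SetIs I ((reset.den σ) 21) (I.used []) := by
  rw [reset, Cmd.den_seq, Cmd.den_seq]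
  set σ1 := Cmd.den (.set 20 (.lit 1) (.lit 0)) (Cmd.den (.set 20 (.lit 0) (.lit 1)) σ) with hσ1
  have h20 : σ1 20 0 = 1 ∧ σ1 20 1 = 0 := by simp [hσ1, Cmd.den, Expr.eval, put_apply]
  have h0 : σ1 0 = σ 0 := by simp [hσ1, Cmd.den, put_ne]
  constructor
  · rw [Cmd.den_frame _ (by decide), wordIs_iff]
    simpa [CDDP.word, holds_nil] using h20
  · have := Cmd.for_rule (x := 45) (lim := .add nE qE) (P := .set 21 (var 45) (.lit 0)) (σ := σ1)
      (fun k τ => ∀ x < k, τ 21 x = 0) (by decide)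
      (by intro k τ i v h; rw [put_ne (by decide)]; exact h) (by simp) (by
        intro k _ τ _ hk h x hx
        simp only [Cmd.den, Expr.eval, put_self, hk]
        split_ifs with hxk
        · rfl
        · exact h x (by omega))
    simp only [Expr.eval, h0, hT.n, hT.q] at this
    intro x hx
    rw [this x hx]
    simp [CDDP.used]

/-- Keep the packing if it is larger than the best one so far. -/
def keepBest : Cmd :=
  .ite (.sub (.get 20 (.lit 1)) (.get 1 (.lit 1)))
    (.rep 45 (var 14) (.set 1 (var 45) (.get 20 (var 45)))) .skip

/-- Different colors bound the number of paths by `q`, and a path contributes at most `n` vertices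
and two further numbers. -/
theorem length_word_le {I : CDDP} {S : List (ℕ × List ℕ)} (hS : I.IsPacking S) :
    (CDDP.word S).length ≤ I.q * (I.n + 2) + 1 := by
  have h1 : ∀ S : List (ℕ × List ℕ), (∀ p ∈ S, I.IsRoute p.1 p.2) →
      (CDDP.word S).length ≤ S.length * (I.n + 2) + 1 := by
    intro S
    induction S with
    | nil => simp [CDDP.word]
    | cons p S ih =>
      intro h
      have h1 := ih fun x hx => h x (by simp [hx])
      have h2 := (h p (by simp)).length_le
      simp only [CDDP.word, List.length_cons, List.flatMap_cons, List.length_append, add_mul] at h1 ⊢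
      omega
  obtain ⟨S', hS', rfl⟩ := hS.exists_solution
  have h2 : S'.length ≤ I.q := by
    have hn : (S'.map Prod.snd).Nodup := by
      rw [List.Nodup, List.pairwise_map]
      exact hS'.2.imp fun h => h.2.2
    simpa using hn.length_le_card
  refine (h1 _ hS.1).trans ?_
  rw [List.length_map]
  gcongr

theorem keepBest_spec {I : CDDP} {m R : ℕ} {tg mc : ℕ → ℕ} {σ : State} (hE : Env I m R tg mc σ)
    {S O : List (ℕ × List ℕ)} (hS : I.IsPacking S) (hO : I.IsPacking O) (hw : WordIs (σ 20) S)
    (ho : WordIs (σ 1) O) : ∃ O', I.IsPacking O' ∧ WordIs ((keepBest.den σ) 1) O' ∧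
      O.length ≤ O'.length ∧ S.length ≤ O'.length := by
  have hw1 := (wordIs_iff.1 hw).2.1
  have ho1 := (wordIs_iff.1 ho).2.1
  rw [keepBest, Cmd.den]
  split_ifs with hb
  · rw [Expr.eval_lt] at hb
    simp only [Expr.eval, hw1, ho1] at hb
    refine ⟨S, hS, ?_, hb.le, le_rfl⟩
    have := Cmd.for_rule (x := 45) (lim := var 14) (P := .set 1 (var 45) (.get 20 (var 45))) (σ := σ)
      (fun k τ => ∀ i < k, τ 1 i = σ 20 i) (by decide)
      (by intro k τ i v h; rw [put_ne (by decide)]; exact h) (by simp) (by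
        intro k _ τ hτ hk h x hx
        simp only [Cmd.den, Expr.eval, put_self, hk, hτ 20 (by decide)]
        split_ifs with hxk
        · rw [hxk]
        · exact h x (by omega))
    refine Holds.congr hw fun i hi => this i ?_
    have h1 := length_word_le hS
    simp only [Expr.eval, hE.wordBound]
    rw [List.length_cons] at hi
    omega
  · rw [Expr.eval_lt] at hb
    simp only [Expr.eval, hw1, ho1] at hb
    exact ⟨O, hO, ho, le_rfl, by omega⟩

/-- Write the path of the color `v44` that is matched with `mc - 1` into the buffer. -/
def loadShort : Cmd :=
  .set 30 (.lit 0) (var 44) ;; .set 23 (.lit 0) sE ;;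
  .ite (.eq (.get 15 (var 44)) (.add tE (.lit 1)))
    (.set 23 (.lit 1) tE ;; .set 24 (.lit 0) (.lit 2))
    (.set 23 (.lit 1) (.sub (.get 15 (var 44)) (.lit 1)) ;; .set 23 (.lit 2) tE ;;
      .set 24 (.lit 0) (.lit 3))

/-- The packing given by the matching. -/
def short : Cmd :=
  reset ;; .rep 44 qE (.ite (.get 15 (var 44)) (loadShort ;; emit) .skip) ;; keepBest

theorem loadShort_spec {I : CDDP} {m R : ℕ} {tg mc : ℕ → ℕ} {σ : State}
    (hE : Env I m R tg mc σ) {c x : ℕ} (hc : σ 44 0 = c) (hx : mc c = x + 1) :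
    (loadShort.den σ) 30 0 = c ∧ (loadShort.den σ) 24 0 = (I.shortPath x).length ∧
      Holds ((loadShort.den σ) 23) (I.shortPath x) := by
  have hs := hE.tab.s
  have ht := hE.tab.t
  rw [loadShort, Cmd.den_seq, Cmd.den_seq, Cmd.den_ite]
  set σ1 := Cmd.den (.set 23 (.lit 0) sE) (Cmd.den (.set 30 (.lit 0) (var 44)) σ) with hσ1
  have e23 : σ1 23 0 = I.s := by simp [hσ1, Cmd.den, Expr.eval, put_apply, hs]
  have e30 : σ1 30 0 = c := by simp [hσ1, Cmd.den, Expr.eval, put_apply, hc]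
  have e0 : σ1 0 = σ 0 := by simp [hσ1, Cmd.den, put_ne]
  have e15 : σ1 15 = mc := by simp [hσ1, Cmd.den, put_ne, hE.mate]
  have e44 : σ1 44 0 = c := by simp [hσ1, Cmd.den, put_ne, hc]
  have hb : (Expr.eq (.get 15 (var 44)) (.add tE (.lit 1))).eval σ1 ≠ 0 ↔ x = I.t := by
    rw [Expr.eval_eq]
    simp only [Expr.eval, e44, e15, hx, e0, ht]
    omega
  split_ifs with h
  · rw [hb] at h
    rw [CDDP.shortPath, if_pos h]
    simp [Cmd.den, Expr.eval, put_apply, holds_cons, holds_nil, e23, e30, e0, ht]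
  · rw [hb] at h
    rw [CDDP.shortPath, if_neg h]
    simp [Cmd.den, Expr.eval, put_apply, holds_cons, holds_nil, e23, e30, e0, ht, e44, e15, hx]

theorem matchSize_succ_range (mc : ℕ → ℕ) (k : ℕ) : CDDP.matchSize (k + 1) mc =
    CDDP.matchSize k mc + if mc k ≠ 0 then 1 else 0 := by
  rw [CDDP.matchSize, CDDP.matchSize, Finset.range_add_one, Finset.filter_insert]
  split_ifs with h
  · rw [Finset.card_insert_of_notMem (by simp)]
  · rfl

theorem short_spec {I : CDDP} {m R : ℕ} {tg mc : ℕ → ℕ} {σ : State}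
    (hE : Env I m R tg mc σ) (hm : I.IsMatch mc) {O : List (ℕ × List ℕ)} (hO : I.IsPacking O)
    (ho : WordIs (σ 1) O) : ∃ O', I.IsPacking O' ∧ WordIs ((short.den σ) 1) O' ∧
      CDDP.matchSize I.q mc ≤ O'.length := by
  rw [short, Cmd.den_seq, Cmd.den_seq]
  obtain ⟨h1, h2⟩ := reset_spec hE.tab
  have hE1 : Env I m R tg mc (reset.den σ) := hE.den (by decide)
  have hloop := Cmd.for_rule (x := 44) (lim := qE)
    (P := .ite (.get 15 (var 44)) (loadShort ;; emit) .skip) (σ := reset.den σ)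
    (fun k τ => ∃ S, I.IsPacking S ∧ WordIs (τ 20) S ∧ SetIs I (τ 21) (I.used S) ∧
      S.length = CDDP.matchSize k mc ∧
        -- Keys in use are colors below `k` and their mates. Injectivity of the matching then makes
        -- the next color and its mate new.
        ∀ y ∈ I.used S, ∃ c < k, ∃ x, mc c = x + 1 ∧ (y = I.n + c ∨ y = x)) (by decide)
    (by intro k τ i v h; rw [put_ne (by decide), put_ne (by decide)]; exact h)
    ⟨[], by simp [CDDP.IsPacking], h1, h2, by simp [CDDP.matchSize], by simp [CDDP.used]⟩ (by
      rintro k hk τ hτ hkτ ⟨S, hS, hw, hu, hlen, hkeys⟩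
      have hE2 : Env I m R tg mc τ := hE1.of_frame hτ (by decide)
      simp only [Expr.eval, hE1.tab.q] at hk
      rw [Cmd.den, matchSize_succ_range]
      simp only [Expr.eval, hkτ, hE2.mate]
      split_ifs with hb
      · obtain ⟨x, hx⟩ : ∃ x, mc k = x + 1 := ⟨mc k - 1, by omega⟩
        have hsh := hm.short k hk x hx
        obtain ⟨g1, g2, g3⟩ := loadShort_spec hE2 hkτ hx
        obtain ⟨g4, g5⟩ := emit_spec (hE2.den (P := loadShort) (by decide)) (S := S) hsh.isRoute
          (by rw [Cmd.den_frame _ (by decide)]; exact hw)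
          (by rw [Cmd.den_frame _ (by decide)]; exact hu) g1 g2 g3
        refine ⟨S ++ [(k, I.shortPath x)], ?_, g4, g5, by simp [hlen], ?_⟩
        · refine CDDP.isPacking_append_singleton hS ⟨hsh.isRoute, ?_⟩
          rw [CDDP.keys_shortPath]
          intro y hy hyS
          obtain ⟨c, hc, z, hz, hyc⟩ := hkeys y hyS
          have hzn := (hm.short c (by omega) z hz).1.2.1
          have hxn := hsh.1.2.1
          simp only [List.mem_cons, List.not_mem_nil, or_false] at hy
          have hinj := hm.inj c (by omega) k hk (by omega)
          omega
        · intro y hy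
          rw [CDDP.used_append, CDDP.used_singleton, CDDP.keys_shortPath] at hy
          simp only [List.toFinset_cons, List.toFinset_nil, Finset.mem_union, Finset.mem_insert,
            insert_empty_eq, Finset.mem_singleton] at hy
          rcases hy with hy | hy
          · obtain ⟨c, hc, h⟩ := hkeys y hy
            exact ⟨c, by omega, h⟩
          · exact ⟨k, by omega, x, hx, hy⟩
      · refine ⟨S, hS, hw, hu, hlen, ?_⟩
        intro y hy
        obtain ⟨c, hc, h⟩ := hkeys y hy
        exact ⟨c, by omega, h⟩)
  simp only [Expr.eval, hE1.tab.q] at hloop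
  obtain ⟨S, hS, hw, -, hlen, -⟩ := hloop
  obtain ⟨O', h3, h4, -, h5⟩ := keepBest_spec (hE1.den (by decide)) hS hO hw (by
    rw [Cmd.den_frame _ (by decide), Cmd.den_frame _ (by decide)]; exact ho)
  exact ⟨O', h3, h4, hlen ▸ h5⟩

/-! ### The search along one guess -/

/-- The buffer holds the path `l`. -/
def Buf (σ : State) (l : List ℕ) : Prop := Holds (σ 23) l ∧ σ 24 0 = l.length

theorem Buf.congr {σ τ : State} {l : List ℕ} (h : Buf σ l) (h3 : τ 23 = σ 23) (h4 : τ 24 = σ 24) :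
    Buf τ l := by
  rw [Buf, h3, h4]; exact h

/-- Append a vertex to the buffer. -/
def push (e : Expr) : Cmd := .set 23 (var 24) e ;; .set 24 (.lit 0) (.add (var 24) (.lit 1))

theorem push_spec {σ : State} {l : List ℕ} (h : Buf σ l) (e : Expr) :
    Buf ((push e).den σ) (l ++ [e.eval σ]) := by
  obtain ⟨h1, h2⟩ := h
  have e23 : ∀ i, (push e).den σ 23 i = if i = l.length then e.eval σ else σ 23 i := by
    intro i; simp [push, Cmd.den, Expr.eval, put_apply, h2]
  have e24 : (push e).den σ 24 0 = l.length + 1 := by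
    simp [push, Cmd.den, Expr.eval, put_apply, h2]
  refine ⟨?_, by simp [e24]⟩
  rw [holds_append]
  refine ⟨h1.congr fun i hi => ?_, ?_⟩
  · rw [e23, if_neg (by omega)]
  · rw [holds_cons]
    exact ⟨by simp [e23], holds_nil⟩

/-- Append the connection of rank `v34` from `v25` to `v33` in color `v46` to the buffer. -/
def connect : Cmd :=
  .rep 48 nE (.ite (.and (.hasCol (var 46) (var 25) (var 48)) (.hasCol (var 46) (var 48) (var 33)))
    (.set 27 (.lit 0) (.add (var 27) (.lit 1)) ;;
      .ite (.eq (var 27) (var 34)) (push (var 48)) .skip) .skip)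

/-- Cell 0 of array 27 counts the common neighbors met so far, and the vertex at which the count
reaches `r` is appended. If the count never reaches `r`, nothing is appended, in agreement with
`via`. -/
theorem connect_spec {I : CDDP} {σ : State} (hT : Tab I σ) {l : List ℕ} (hl : Buf σ l)
    {c u v r : ℕ} (hc : σ 46 0 = c) (hu : σ 25 0 = u) (hv : σ 33 0 = v) (hr : σ 34 0 = r)
    (hcq : c < I.q) (hun : u < I.n) (hvn : v < I.n) (hr0 : r ≠ 0) (h27 : σ 27 0 = 0) :
    Buf (connect.den σ) (l ++ I.via c u v r) := by
  classical
  set p : ℕ → Bool := fun x => decide (I.Col c u x ∧ I.Col c x v) with hp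
  have hvia : I.via c u v r = (((List.range I.n).filter p)[r - 1]?).toList := by
    rw [CDDP.via, if_neg hr0, CDDP.between]
  rw [hvia, connect]
  have hloop := Cmd.for_rule (x := 48) (lim := nE) (P := .ite
      (.and (.hasCol (var 46) (var 25) (var 48)) (.hasCol (var 46) (var 48) (var 33)))
      (.set 27 (.lit 0) (.add (var 27) (.lit 1)) ;;
        .ite (.eq (var 27) (var 34)) (push (var 48)) .skip) .skip) (σ := σ)
    (fun k τ => τ 27 0 = ((List.range k).filter p).length ∧
      Buf τ (l ++ (((List.range k).filter p)[r - 1]?).toList)) (by decide)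
    (by
      intro k τ i v h
      rw [put_ne (by decide)]
      exact ⟨h.1, h.2.congr (put_ne (by decide)) (put_ne (by decide))⟩)
    (by simpa [h27] using hl) (by
      rintro k hk τ hτ hkτ ⟨h1, h2⟩
      have hT' : Tab I τ := hT.congr (hτ 0 (by decide)) (hτ 2 (by decide)) (hτ 3 (by decide))
      simp only [Expr.eval, hT.n] at hk
      have t46 : τ 46 0 = c := by rw [hτ 46 (by decide), hc]
      have t25 : τ 25 0 = u := by rw [hτ 25 (by decide), hu]
      have t33 : τ 33 0 = v := by rw [hτ 33 (by decide), hv]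
      have t34 : τ 34 0 = r := by rw [hτ 34 (by decide), hr]
      have hb : (Expr.and (.hasCol (var 46) (var 25) (var 48))
          (.hasCol (var 46) (var 48) (var 33))).eval τ ≠ 0 ↔ p k = true := by
        rw [Expr.eval_and]
        simp only [Expr.eval, t46, t25, t33, hkτ]
        rw [hT'.col u hun k hk c hcq, hT'.col k hk v hvn c hcq]
        simp [hp]
      rw [Cmd.den_ite, List.range_succ, List.filter_append]
      split_ifs with hbe
      · rw [hb] at hbe
        have hf : [k].filter p = [k] := by simp [hbe]
        rw [hf, Cmd.den_seq]
        set τ1 := Cmd.den (.set 27 (.lit 0) (.add (var 27) (.lit 1))) τ with hτ1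
        have e27 : τ1 27 0 = ((List.range k).filter p).length + 1 := by
          simp [hτ1, Cmd.den, Expr.eval, put_apply, h1]
        have hbuf : Buf τ1 (l ++ (((List.range k).filter p)[r - 1]?).toList) :=
          h2.congr (Cmd.den_frame _ (by decide)) (Cmd.den_frame _ (by decide))
        have e34 : τ1 34 0 = r := by rw [hτ1, Cmd.den_frame _ (by decide), t34]
        have e48 : τ1 48 0 = k := by rw [hτ1, Cmd.den_frame _ (by decide), hkτ]
        refine ⟨by rw [Cmd.den_frame _ (by decide), e27]; simp, ?_⟩
        rw [Cmd.den_ite]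
        have hb2 : (Expr.eq (var 27) (var 34)).eval τ1 ≠ 0 ↔
            ((List.range k).filter p).length + 1 = r := by
          rw [Expr.eval_eq]
          simp only [Expr.eval, e27, e34]
        split_ifs with hbe2
        · rw [hb2] at hbe2
          have := push_spec hbuf (var 48)
          simp only [Expr.eval, e48] at this
          rw [List.getElem?_append_right (by omega), show r - 1 - _ = 0 by omega]
          rw [List.getElem?_eq_none (by omega)] at this
          simpa using this
        · rw [hb2] at hbe2
          -- The new neighbor is at a position different from `r - 1`: either the wanted one was
          -- found earlier, or it lies still further ahead.
          have : ((List.range k).filter p ++ [k])[r - 1]? = ((List.range k).filter p)[r - 1]? := by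
            rcases Nat.lt_or_ge (r - 1) ((List.range k).filter p).length with h | h
            · rw [List.getElem?_append_left h]
            · rw [List.getElem?_eq_none h, List.getElem?_eq_none]
              rw [List.length_append, List.length_singleton]
              omega
          rw [this]
          exact hbuf
      · rw [hb] at hbe
        have hf : [k].filter p = [] := by simp [hbe]
        rw [hf, List.append_nil]
        exact ⟨h1, h2⟩)
  simp only [Expr.eval, hT.n] at hloop
  exact hloop.2

/-- The steps that are described by the digits from position `b`. -/
def stepsOf (gs : ℕ → ℕ) (b m : ℕ) : List (ℕ × ℕ) :=
  (List.range (m + 1)).map fun j => (gs (b + (j + j)), gs (b + (j + j) + 1))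

/-- One step of the construction of a path. -/
def buildStep : Cmd :=
  .set 33 (.lit 0) (.get 5 (.get 31 (.add (var 32) (.add (var 47) (var 47))))) ;;
  .set 34 (.lit 0) (.get 31 (.add (.add (var 32) (.add (var 47) (var 47))) (.lit 1))) ;;
  .set 27 (.lit 0) (.lit 0) ;;
  .ite (var 34) connect .skip ;;
  push (var 33) ;;
  .set 25 (.lit 0) (var 33) ;;
  .ite (.get 31 (.add (var 32) (.add (var 47) (var 47)))) .skip (.set 26 (.lit 0) (.lit 1))

theorem buildStep_spec {I : CDDP} {m R : ℕ} {tg mc : ℕ → ℕ} {σ : State} (hE : Env I m R tg mc σ)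
    {gs : ℕ → ℕ} (hgs : σ 31 = gs) {b k c u : ℕ} (hb : σ 32 0 = b) (hk : σ 47 0 = k)
    (hc : σ 46 0 = c) (hcq : c < I.q) (hu : σ 25 0 = u) (hun : u < I.n) {l : List ℕ}
    (hl : Buf σ l) (h26 : σ 26 0 = 0) :
    Buf (buildStep.den σ) (l ++ I.via c u (tg (gs (b + (k + k)))) (gs (b + (k + k) + 1)) ++
      [tg (gs (b + (k + k)))]) ∧ (buildStep.den σ) 25 0 = tg (gs (b + (k + k))) ∧
      ((buildStep.den σ) 26 0 = 0 ↔ gs (b + (k + k)) ≠ 0) := by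
  set j := gs (b + (k + k)) with hj
  set r := gs (b + (k + k) + 1) with hr
  rw [buildStep, Cmd.den_seq, Cmd.den_seq, Cmd.den_seq, Cmd.den_seq]
  set σ1 := Cmd.den (.set 27 (.lit 0) (.lit 0)) (Cmd.den (.set 34 (.lit 0)
    (.get 31 (.add (.add (var 32) (.add (var 47) (var 47))) (.lit 1)))) (Cmd.den (.set 33 (.lit 0)
    (.get 5 (.get 31 (.add (var 32) (.add (var 47) (var 47)))))) σ)) with hσ1
  have e33 : σ1 33 0 = tg j := by
    simp [hσ1, Cmd.den, Expr.eval, put_apply, hE.target, hgs, hb, hk, hj]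
  have e34 : σ1 34 0 = r := by
    simp [hσ1, Cmd.den, Expr.eval, put_apply, hgs, hb, hk, hr]
  have e27 : σ1 27 0 = 0 := by simp [hσ1, Cmd.den, Expr.eval, put_apply]
  have efr : ∀ a, a ≠ 33 → a ≠ 34 → a ≠ 27 → σ1 a = σ a := by
    intro a h1 h2 h3
    simp [hσ1, Cmd.den, put_ne h1, put_ne h2, put_ne h3]
  have hE1 : Env I m R tg mc σ1 :=
    hE.congr fun a ha _ => efr a (by omega) (by omega) (by omega)
  have hl1 : Buf σ1 l := hl.congr (efr _ (by decide) (by decide) (by decide))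
    (efr _ (by decide) (by decide) (by decide))
  have e46 : σ1 46 0 = c := by rw [efr 46 (by decide) (by decide) (by decide), hc]
  have e25 : σ1 25 0 = u := by rw [efr 25 (by decide) (by decide) (by decide), hu]
  set σ2 := Cmd.den (.ite (var 34) connect .skip) σ1 with hσ2
  have hl2 : Buf σ2 (l ++ I.via c u (tg j) r) := by
    rw [hσ2, Cmd.den_ite]
    simp only [Expr.eval, e34]
    split_ifs with h0
    · exact connect_spec hE1.tab hl1 e46 e25 e33 e34 hcq hun (hE.target_lt j) h0 e27
    · simpa [Cmd.den, CDDP.via, not_not.1 h0] using hl1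
  have gfr : ∀ a, a ∉ [48, 27, 23, 24] → σ2 a = σ1 a := by
    intro a ha
    refine Cmd.den_frame _ fun h => ha ?_
    have hsub : (Cmd.ite (var 34) connect .skip).writes ⊆ [48, 27, 23, 24] := by decide
    exact hsub h
  have g33 : σ2 33 0 = tg j := by rw [gfr 33 (by decide), e33]
  have g26 : σ2 26 0 = 0 := by
    rw [gfr 26 (by decide), efr 26 (by decide) (by decide) (by decide), h26]
  have g31 : σ2 31 = gs := by
    rw [gfr 31 (by decide), efr 31 (by decide) (by decide) (by decide), hgs]
  have g32 : σ2 32 0 = b := by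
    rw [gfr 32 (by decide), efr 32 (by decide) (by decide) (by decide), hb]
  have g47 : σ2 47 0 = k := by
    rw [gfr 47 (by decide), efr 47 (by decide) (by decide) (by decide), hk]
  rw [Cmd.den_seq, Cmd.den_seq]
  have hl3 := push_spec hl2 (var 33)
  simp only [Expr.eval, g33] at hl3
  set σ3 := (push (var 33)).den σ2 with hσ3
  have kfr : ∀ a, a ≠ 23 → a ≠ 24 → σ3 a = σ2 a := by
    intro a h1 h2
    exact Cmd.den_frame _ (by simp [push, Cmd.writes, h1, h2])
  set σ4 := Cmd.den (.set 25 (.lit 0) (var 33)) σ3 with hσ4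
  have k25 : σ4 25 0 = tg j := by
    simp [hσ4, Cmd.den, Expr.eval, put_apply, kfr, g33]
  have mfr : ∀ a, a ≠ 23 → a ≠ 24 → a ≠ 25 → σ4 a = σ2 a := by
    intro a h1 h2 h3
    rw [hσ4, Cmd.den, put_ne h3, kfr a h1 h2]
  refine ⟨?_, ?_, ?_⟩
  · refine hl3.congr ?_ ?_
    · rw [Cmd.den_frame _ (by decide), hσ4, Cmd.den_frame _ (by decide)]
    · rw [Cmd.den_frame _ (by decide), hσ4, Cmd.den_frame _ (by decide)]
  · rw [Cmd.den_frame _ (by decide), k25]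
  · rw [Cmd.den_ite]
    simp only [Expr.eval, mfr 31 (by decide) (by decide) (by decide),
      mfr 32 (by decide) (by decide) (by decide), mfr 47 (by decide) (by decide) (by decide), g31,
      g32, g47, ← hj]
    split_ifs with h0
    · simp [Cmd.den, mfr 26 (by decide) (by decide) (by decide), g26, h0]
    · simp [Cmd.den, Expr.eval, put_apply, h0]

/-- Write the path in color `v46` that is described by the digits from position `v32` into the
buffer. -/
def build : Cmd :=
  .set 24 (.lit 0) (.lit 0) ;; push sE ;; .set 25 (.lit 0) sE ;; .set 26 (.lit 0) (.lit 0) ;;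
  .rep 47 (.add (var 6) (.lit 1)) (.ite (.not (var 26)) buildStep .skip)

theorem build_spec {I : CDDP} {m R : ℕ} {tg mc : ℕ → ℕ} {σ : State} (hE : Env I m R tg mc σ)
    {gs : ℕ → ℕ} (hgs : σ 31 = gs) {b c : ℕ} (hb : σ 32 0 = b) (hc : σ 46 0 = c) (hcq : c < I.q) :
    Buf (build.den σ) (I.walk tg (stepsOf gs b m) c) := by
  rw [build, Cmd.den_seq, Cmd.den_seq, Cmd.den_seq, Cmd.den_seq]
  set σ0 := Cmd.den (.set 24 (.lit 0) (.lit 0)) σ with hσ0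
  have hE0 : Env I m R tg mc σ0 := hE.den (by decide)
  have hl0 : Buf σ0 [] := ⟨holds_nil, by simp [hσ0, Cmd.den, Expr.eval, put_apply]⟩
  have hl1 := push_spec hl0 sE
  simp only [Expr.eval, hE0.tab.s, List.nil_append] at hl1
  have hE1 : Env I m R tg mc ((push sE).den σ0) := hE0.den (by decide)
  set σ1 := (push sE).den σ0 with hσ1
  set σ2 := Cmd.den (.set 26 (.lit 0) (.lit 0)) (Cmd.den (.set 25 (.lit 0) sE) σ1) with hσ2
  have e25 : σ2 25 0 = I.s := by simp [hσ2, Cmd.den, Expr.eval, put_apply, hE1.tab.s]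
  have e26 : σ2 26 0 = 0 := by simp [hσ2, Cmd.den, Expr.eval, put_apply]
  have efr : ∀ a, a ∉ [23, 24, 25, 26] → σ2 a = σ a := by
    intro a ha
    simp only [List.mem_cons, List.not_mem_nil, or_false, not_or] at ha
    rw [hσ2, Cmd.den, put_ne ha.2.2.2, Cmd.den, put_ne ha.2.2.1, hσ1,
      Cmd.den_frame _ (by simp [push, Cmd.writes, ha]), hσ0, Cmd.den, put_ne ha.2.1]
  have hE2 : Env I m R tg mc σ2 := hE.of_frame efr (by decide)
  have hl2 : Buf σ2 [(I.s : ℕ)] := hl1.congr (by simp [hσ2, Cmd.den, put_ne])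
    (by simp [hσ2, Cmd.den, put_ne])
  set L := stepsOf gs b m with hL
  have hlen : L.length = m + 1 := by simp [hL, stepsOf]
  have hloop := Cmd.for_rule (x := 47) (lim := .add (var 6) (.lit 1))
    (P := .ite (.not (var 26)) buildStep .skip) (σ := σ2)
    -- Either the stop flag is set and the buffer is the complete walk, or what is missing is the
    -- expansion of the remaining steps from the current vertex.
    (fun k τ => ∃ pre u, Buf τ pre ∧ τ 25 0 = u ∧ u < I.n ∧
      (τ 26 0 ≠ 0 ∧ I.walk tg L c = pre ∨
        τ 26 0 = 0 ∧ I.walk tg L c = pre ++ I.expand tg c u (L.drop k))) (by decide)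
    (by
      rintro k τ i v ⟨pre, u, h1, h2⟩
      refine ⟨pre, u, h1.congr (put_ne (by decide)) (put_ne (by decide)), ?_⟩
      rw [put_ne (by decide), put_ne (by decide)]
      exact h2)
    ⟨[(I.s : ℕ)], I.s, hl2, e25, I.s.2, .inr ⟨e26, by simp [CDDP.walk]⟩⟩ (by
      rintro k hk τ hτ hkτ ⟨pre, u, h1, h2, h3, h4⟩
      have hEτ : Env I m R tg mc τ := hE2.of_frame hτ (by decide)
      simp only [Expr.eval, hE2.coverSize] at hk
      rw [Cmd.den_ite]
      split_ifs with h26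
      · rw [Expr.eval_not] at h26
        simp only [Expr.eval] at h26
        have h5 := (h4.resolve_left fun h => h.1 h26).2
        obtain ⟨g1, g2, g3⟩ := buildStep_spec hEτ (b := b) (c := c)
          (by rw [hτ 31 (by decide), efr 31 (by decide), hgs])
          (by rw [hτ 32 (by decide), efr 32 (by decide), hb]) hkτ
          (by rw [hτ 46 (by decide), efr 46 (by decide), hc]) hcq h2 h3 h1 h26
        refine ⟨_, _, g1, g2, hEτ.target_lt _, ?_⟩
        have hdrop : L.drop k = (gs (b + (k + k)), gs (b + (k + k) + 1)) :: L.drop (k + 1) := by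
          rw [List.drop_eq_getElem_cons (by omega)]
          simp [hL, stepsOf]
        rw [hdrop, CDDP.expand] at h5
        by_cases h0 : gs (b + (k + k)) = 0
        · rw [if_pos h0] at h5
          refine .inl ⟨fun h => g3.1 h h0, ?_⟩
          rw [h5]
          simp
        · rw [if_neg h0] at h5
          refine .inr ⟨g3.2 h0, ?_⟩
          rw [h5]
          simp
      · rw [Expr.eval_not] at h26
        simp only [Expr.eval] at h26
        exact ⟨pre, u, h1, h2, h3, .inl (h4.resolve_right fun h => h26 h.1)⟩)
  simp only [Expr.eval, hE2.coverSize] at hloop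
  obtain ⟨pre, u, h1, -, -, h4⟩ := hloop
  rcases h4 with ⟨-, h⟩ | ⟨-, h⟩
  · rw [h]; exact h1
  · rw [List.drop_eq_nil_of_le (by omega), CDDP.expand, List.append_nil] at h
    rw [h]; exact h1

/-! ### Testing a path in the buffer -/

/-- Count the violated conditions. -/
abbrev blame (e : Expr) : Cmd := .set 28 (.lit 0) (.add (var 28) e)

theorem Expr.eval_eq' {σ : State} {x y : Expr} :
    (Expr.eq x y).eval σ = 0 ↔ x.eval σ ≠ y.eval σ := by
  simp only [eval]; omega

theorem blame_spec (e : Expr) (σ : State) :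
    ((blame e).den σ) 28 0 = 0 ↔ σ 28 0 = 0 ∧ e.eval σ = 0 := by
  simp [Cmd.den, Expr.eval, put_self]

/-- Check the position `v47` of the path in the buffer. -/
def checkPos : Cmd :=
  blame (.not (.sub nE (.get 23 (var 47)))) ;;
  .ite (.sub (var 24) (.add (var 47) (.lit 1)))
    (blame (.not (.hasCol (var 46) (.get 23 (var 47)) (.get 23 (.add (var 47) (.lit 1)))))) .skip ;;
  .ite (.add (.eq (var 47) (.lit 1)) (.and (var 47) (.sub (var 24) (.add (var 47) (.lit 1)))))
    (blame (.get 22 (.get 23 (var 47)))) .skip ;;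
  .rep 48 nE (.ite (.sub (var 47) (var 48))
    (blame (.eq (.get 23 (var 47)) (.get 23 (var 48)))) .skip)

set_option maxHeartbeats 1000000 in
theorem checkPos_spec {σ : State} {n c i len : ℕ} (hn : σ 0 1 = n) (hc : σ 46 0 = c)
    (hi : σ 47 0 = i) (hlen : σ 24 0 = len) : (checkPos.den σ) 28 0 = 0 ↔ σ 28 0 = 0 ∧
      (σ 23 i < n ∧ (i + 1 < len → σ 0 (σ 2 (σ 23 i) + σ 3 (σ 23 (i + 1)) + (c + 1)) ≠ 0) ∧
      (IsKeyPos len i → σ 22 (σ 23 i) = 0) ∧ ∀ j < n, j < i → σ 23 i ≠ σ 23 j) := by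
  rw [checkPos, Cmd.den_seq, Cmd.den_seq, Cmd.den_seq]
  set σ1 := (blame (.not (.sub nE (.get 23 (var 47))))).den σ with hσ1
  set σ2 := Cmd.den (.ite (.sub (var 24) (.add (var 47) (.lit 1)))
    (blame (.not (.hasCol (var 46) (.get 23 (var 47)) (.get 23 (.add (var 47) (.lit 1)))))) .skip) σ1
    with hσ2
  set σ3 := Cmd.den (.ite (.add (.eq (var 47) (.lit 1))
    (.and (var 47) (.sub (var 24) (.add (var 47) (.lit 1)))))
    (blame (.get 22 (.get 23 (var 47)))) .skip) σ2 with hσ3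
  have e1 : ∀ a, a ≠ 28 → σ1 a = σ a := fun a ha =>
    Cmd.den_frame _ (by simpa [Cmd.writes] using ha)
  have e2 : ∀ a, a ≠ 28 → σ2 a = σ a := fun a ha =>
    (Cmd.den_frame _ (by simpa [Cmd.writes] using ha)).trans (e1 a ha)
  have e3 : ∀ a, a ≠ 28 → σ3 a = σ a := fun a ha =>
    (Cmd.den_frame _ (by simpa [Cmd.writes] using ha)).trans (e2 a ha)
  have h1 : σ1 28 0 = 0 ↔ σ 28 0 = 0 ∧ σ 23 i < n := by
    rw [hσ1, blame_spec, Expr.eval_not', Expr.eval_lt]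
    simp only [Expr.eval, hi, hn]
  have h2 : σ2 28 0 = 0 ↔ σ1 28 0 = 0 ∧
      (i + 1 < len → σ 0 (σ 2 (σ 23 i) + σ 3 (σ 23 (i + 1)) + (c + 1)) ≠ 0) := by
    rw [hσ2, Cmd.den_ite]
    have hb : (Expr.sub (var 24) (.add (var 47) (.lit 1))).eval σ1 ≠ 0 ↔ i + 1 < len := by
      rw [Expr.eval_lt]
      simp only [Expr.eval, e1 24 (by decide), e1 47 (by decide), hi, hlen]
    split_ifs with h
    · rw [hb] at h
      rw [blame_spec, Expr.eval_not']
      simp only [Expr.eval, e1 46 (by decide), e1 23 (by decide), e1 47 (by decide),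
        e1 0 (by decide), e1 2 (by decide), e1 3 (by decide), hi, hc]
      simp [h]
    · rw [hb] at h
      simp [Cmd.den, h]
  have h3 : σ3 28 0 = 0 ↔ σ2 28 0 = 0 ∧ (IsKeyPos len i → σ 22 (σ 23 i) = 0) := by
    rw [hσ3, Cmd.den_ite]
    have hb := eval_isKeyPos (σ := σ2) (x := var 47) (y := var 24)
    have h24 : (var 24).eval σ2 = len := by simp only [Expr.eval, e2 24 (by decide), hlen]
    have h47 : (var 47).eval σ2 = i := by simp only [Expr.eval, e2 47 (by decide), hi]
    rw [h24, h47] at hb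
    split_ifs with h
    · rw [hb] at h
      rw [blame_spec]
      simp only [Expr.eval, e2 22 (by decide), e2 23 (by decide), e2 47 (by decide), hi]
      simp [h]
    · rw [hb] at h
      simp [Cmd.den, h]
  have h4 := Cmd.for_rule (x := 48) (lim := nE) (P := .ite (.sub (var 47) (var 48))
    (blame (.eq (.get 23 (var 47)) (.get 23 (var 48)))) .skip) (σ := σ3)
    (fun k τ => τ 28 0 = 0 ↔ σ3 28 0 = 0 ∧ ∀ j < k, j < i → σ 23 i ≠ σ 23 j) (by decide)
    (by intro k τ i v h; rw [put_ne (by decide)]; exact h) (by simp) (by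
      intro k _ τ hτ hk h
      have e23 : τ 23 = σ 23 := (hτ 23 (by decide)).trans (e3 23 (by decide))
      have e47 : τ 47 0 = i := by rw [hτ 47 (by decide), e3 47 (by decide), hi]
      have hstep : (Cmd.den (.ite (.sub (var 47) (var 48))
          (blame (.eq (.get 23 (var 47)) (.get 23 (var 48)))) .skip) τ) 28 0 = 0 ↔
          τ 28 0 = 0 ∧ (k < i → σ 23 i ≠ σ 23 k) := by
        rw [Cmd.den_ite]
        have hb : (Expr.sub (var 47) (var 48)).eval τ ≠ 0 ↔ k < i := by
          rw [Expr.eval_lt]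
          simp only [Expr.eval, e47, hk]
        split_ifs with h
        · rw [hb] at h
          have hq : (Expr.eq (.get 23 (var 47)) (.get 23 (var 48))).eval τ = 0 ↔
              σ 23 i ≠ σ 23 k := by
            rw [Expr.eval_eq']
            simp only [Expr.eval, e47, hk, e23]
          rw [blame_spec, hq]
          simp [h]
        · rw [hb] at h
          simp [Cmd.den, h]
      rw [hstep, h]
      constructor
      · rintro ⟨⟨g1, g2⟩, g3⟩
        refine ⟨g1, fun j hj hji => ?_⟩
        rcases Nat.lt_succ_iff_lt_or_eq.1 hj with hj | rfl
        exacts [g2 j hj hji, g3 hji]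
      · rintro ⟨g1, g2⟩
        exact ⟨⟨g1, fun j hj => g2 j (by omega)⟩, g2 k (by omega)⟩)
  simp only [Expr.eval, e3 0 (by decide), hn] at h4
  rw [h4, h3, h2, h1]
  simp only [and_assoc]

/-- Check whether the path in the buffer is valid and avoids the forbidden keys. -/
def check : Cmd :=
  .set 28 (.lit 0) (.add (.sub (.lit 2) (var 24)) (.sub (var 24) nE)) ;;
  blame (.get 22 (.add nE (var 46))) ;;
  blame (.not (.eq (.get 23 (.sub (var 24) (.lit 1))) tE)) ;;
  .rep 47 nE (.ite (.sub (var 24) (var 47)) checkPos .skip)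

set_option maxHeartbeats 1000000 in
-- A sum of natural numbers vanishes only if every summand does, so one cell collects all
-- violations. Lists longer than `n` are rejected at once, because the loop inspects only the
-- positions below `n`. The first vertex needs no test: a built walk starts at `s`.
theorem check_spec {I : CDDP} {σ : State} (hT : Tab I σ) {X : Finset ℕ} (hX : SetIs I (σ 22) X)
    {c : ℕ} (hc : σ 46 0 = c) (hcq : c < I.q) {l : List ℕ} (hl : Buf σ l)
    (hhead : l.head? = some (I.s : ℕ)) : (check.den σ) 28 0 = 0 ↔ I.Free X (c, l) := by
  obtain ⟨hb, hlen⟩ := hl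
  rw [check, Cmd.den_seq, Cmd.den_seq, Cmd.den_seq]
  set σ1 := Cmd.den (.set 28 (.lit 0) (.add (.sub (.lit 2) (var 24)) (.sub (var 24) nE))) σ with hσ1
  set σ2 := (blame (.get 22 (.add nE (var 46)))).den σ1 with hσ2
  set σ3 := (blame (.not (.eq (.get 23 (.sub (var 24) (.lit 1))) tE))).den σ2 with hσ3
  have e1 : ∀ a, a ≠ 28 → σ1 a = σ a := fun a ha =>
    Cmd.den_frame _ (by simpa [Cmd.writes] using ha)
  have e2 : ∀ a, a ≠ 28 → σ2 a = σ a := fun a ha =>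
    (Cmd.den_frame _ (by simpa [Cmd.writes] using ha)).trans (e1 a ha)
  have e3 : ∀ a, a ≠ 28 → σ3 a = σ a := fun a ha =>
    (Cmd.den_frame _ (by simpa [Cmd.writes] using ha)).trans (e2 a ha)
  have h1 : σ1 28 0 = 0 ↔ 2 ≤ l.length ∧ l.length ≤ I.n := by
    simp only [hσ1, Cmd.den, Expr.eval, put_self, hlen, hT.n, if_true]
    omega
  have h2 : σ2 28 0 = 0 ↔ σ1 28 0 = 0 ∧ σ 22 (I.n + c) = 0 := by
    rw [hσ2, blame_spec]
    simp only [Expr.eval, e1 22 (by decide), e1 0 (by decide), e1 46 (by decide), hT.n, hc]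
  have h3 : σ3 28 0 = 0 ↔ σ2 28 0 = 0 ∧ σ 23 (l.length - 1) = I.t := by
    rw [hσ3, blame_spec, Expr.eval_not', Expr.eval_eq]
    simp only [Expr.eval, e2 23 (by decide), e2 24 (by decide), e2 0 (by decide), hT.t, hlen]
  have h4 := Cmd.for_rule (x := 47) (lim := nE) (P := .ite (.sub (var 24) (var 47)) checkPos .skip)
    (σ := σ3)
    (fun k τ => τ 28 0 = 0 ↔ σ3 28 0 = 0 ∧ ∀ i < k, i < l.length → σ 23 i < I.n ∧
      (i + 1 < l.length → σ 0 (σ 2 (σ 23 i) + σ 3 (σ 23 (i + 1)) + (c + 1)) ≠ 0) ∧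
      (IsKeyPos l.length i → σ 22 (σ 23 i) = 0) ∧ ∀ j < I.n, j < i → σ 23 i ≠ σ 23 j) (by decide)
    (by intro k τ i v h; rw [put_ne (by decide)]; exact h) (by simp) (by
      intro k _ τ hτ hk h
      have eτ : ∀ a, a ∉ [47, 28, 48] → τ a = σ a := by
        intro a ha
        rw [hτ a fun h => ha ?_]
        · exact e3 a fun h => ha (by simp [h])
        · have hsub : 47 :: (Cmd.ite (.sub (var 24) (var 47)) checkPos .skip).writes ⊆
            [47, 28, 48] := by decide
          exact hsub h
      have hstep : (Cmd.den (.ite (.sub (var 24) (var 47)) checkPos .skip) τ) 28 0 = 0 ↔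
          τ 28 0 = 0 ∧ (k < l.length → σ 23 k < I.n ∧
      (k + 1 < l.length → σ 0 (σ 2 (σ 23 k) + σ 3 (σ 23 (k + 1)) + (c + 1)) ≠ 0) ∧
      (IsKeyPos l.length k → σ 22 (σ 23 k) = 0) ∧ ∀ j < I.n, j < k → σ 23 k ≠ σ 23 j) := by
        rw [Cmd.den_ite]
        have hb : (Expr.sub (var 24) (var 47)).eval τ ≠ 0 ↔ k < l.length := by
          rw [Expr.eval_lt]
          simp only [Expr.eval, eτ 24 (by decide), hk, hlen]
        split_ifs with h
        · rw [hb] at h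
          rw [checkPos_spec (n := I.n) (c := c) (i := k) (len := l.length)
            (by rw [eτ 0 (by decide), hT.n]) (by rw [eτ 46 (by decide), hc]) hk
            (by rw [eτ 24 (by decide), hlen]), eτ 0 (by decide), eτ 2 (by decide),
            eτ 3 (by decide), eτ 22 (by decide), eτ 23 (by decide)]
          simp [h]
        · rw [hb] at h
          simp [Cmd.den, h]
      rw [hstep, h]
      constructor
      · rintro ⟨⟨g1, g2⟩, g3⟩
        refine ⟨g1, fun j hj hji => ?_⟩
        rcases Nat.lt_succ_iff_lt_or_eq.1 hj with hj | rfl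
        exacts [g2 j hj hji, g3 hji]
      · rintro ⟨g1, g2⟩
        exact ⟨⟨g1, fun j hj => g2 j (by omega)⟩, g2 k (by omega)⟩)
  simp only [Expr.eval, e3 0 (by decide), hT.n] at h4
  rw [h4, h3, h2, h1]
  constructor
  · rintro ⟨⟨⟨⟨g1, g2⟩, g3⟩, g4⟩, g5⟩
    -- The bits found in the input mean something only for numbers that are vertices, so this comes
    -- before the edges and the keys.
    have hlt : ∀ i (hi : i < l.length), l[i] < I.n := fun i hi => by
      rw [← hb.get hi]
      exact (g5 i (by omega) hi).1
    refine ⟨⟨?_, hhead, ?_, ?_⟩, ?_⟩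
    · rw [List.Nodup, List.pairwise_iff_getElem]
      intro i j (hi : i < l.length) (hj : j < l.length) hij
      have := (g5 j (by omega) hj).2.2.2 i (by omega) hij
      rw [hb.get hi, hb.get hj] at this
      exact this.symm
    · have hl : l.length - 1 < l.length := by omega
      change l.getLast? = _
      rw [List.getLast?_eq_getElem?, List.getElem?_eq_getElem hl, ← hb.get hl, g4]
    · rw [List.isChain_iff_getElem]
      intro i (hi : i + 1 < l.length)
      have := (g5 i (by omega) (by omega)).2.1 hi
      have hi' : i < l.length := by omega
      rw [hb.get hi, hb.get hi'] at this
      exact (hT.col _ (hlt _ _) _ (hlt _ _) c hcq).1 this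
    · intro x hx
      rcases CDDP.mem_keys.1 hx with rfl | ⟨i, (hi : IsKeyPos l.length i), hix⟩
      · rw [← hX _ (by simpa using hcq)]
        exact not_not.2 g3
      · change l[i]? = some x at hix
        obtain ⟨hil, rfl⟩ := List.getElem?_eq_some_iff.1 hix
        have := (g5 i (by omega) hil).2.2.1 hi
        rw [hb.get hil] at this
        have hxl := hlt i hil
        rw [← hX _ (by omega)]
        exact not_not.2 this
  · rintro ⟨hr, hk⟩
    have hkey : ∀ x ∈ I.keys (c, l), x < I.n + I.q → σ 22 x = 0 := by
      intro x hx hxn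
      have := hk x hx
      rw [← hX x hxn] at this
      exact not_not.1 this
    refine ⟨⟨⟨⟨hr.two_le, hr.length_le⟩, ?_⟩, ?_⟩, ?_⟩
    · exact hkey _ (CDDP.color_mem_keys _) (show I.n + c < _ by omega)
    · exact hb _ _ hr.last_get
    · intro i _ hi
      have hin := hr.lt (List.getElem_mem hi)
      rw [hb.get hi]
      refine ⟨hin, ?_, ?_, ?_⟩
      · intro hi'
        rw [hb.get hi']
        have := hr.col hi'
        exact (hT.col _ this.1 _ this.2.1 c hcq).2 this
      · intro hkp
        exact hkey _ (CDDP.mem_keys.2 (.inr ⟨i, hkp, List.getElem?_eq_getElem hi⟩)) (by omega)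
      · intro j _ hji h
        rw [hb.get (by omega : j < l.length)] at h
        have := (hr.nodup.getElem_inj_iff).1 h
        omega

/-! ### One more path: searching, forbidding, repeating -/

/-- The outcome of a search for a path. -/
def FoundIs (σ : State) : Option (ℕ × List ℕ) → Prop
  | none => σ 29 0 = 0
  | some p => σ 29 0 ≠ 0 ∧ σ 30 0 = p.1 ∧ Buf σ p.2

theorem FoundIs.congr {σ τ : State} {o : Option (ℕ × List ℕ)} (h : FoundIs σ o)
    (h23 : τ 23 = σ 23) (h24 : τ 24 = σ 24) (h29 : τ 29 = σ 29) (h30 : τ 30 = σ 30) :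
    FoundIs τ o := by
  cases o with
  | none => rw [FoundIs, h29]; exact h
  | some p => rw [FoundIs, h29, h30]; exact ⟨h.1, h.2.1, h.2.2.congr h23 h24⟩

/-- Find the first color with a valid path. -/
def findPath : Cmd :=
  .set 29 (.lit 0) (.lit 0) ;;
  .rep 46 qE (.ite (.not (var 29)) (build ;; check ;;
    .ite (.not (var 28)) (.set 29 (.lit 0) (.lit 1) ;; .set 30 (.lit 0) (var 46)) .skip) .skip)

/-- After a success, later colors are skipped, so the first valid color is kept and its path remains
in the buffer for marking and output. -/
theorem findPath_spec {I : CDDP} {m R : ℕ} {tg mc : ℕ → ℕ} {σ : State} (hE : Env I m R tg mc σ)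
    {gs : ℕ → ℕ} (hgs : σ 31 = gs) {b : ℕ} (hb : σ 32 0 = b) {X : Finset ℕ}
    (hX : SetIs I (σ 22) X) :
    FoundIs (findPath.den σ) (I.pickBelow tg (stepsOf gs b m) X I.q) := by
  rw [findPath, Cmd.den_seq]
  set σ1 := Cmd.den (.set 29 (.lit 0) (.lit 0)) σ with hσ1
  have e1 : ∀ a, a ≠ 29 → σ1 a = σ a := fun a ha => put_ne ha
  have hE1 : Env I m R tg mc σ1 := hE.den (by decide)
  have hloop := Cmd.for_rule (x := 46) (lim := qE)
    (P := .ite (.not (var 29)) (build ;; check ;; .ite (.not (var 28))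
      (.set 29 (.lit 0) (.lit 1) ;; .set 30 (.lit 0) (var 46)) .skip) .skip) (σ := σ1)
    (fun k τ => FoundIs τ (I.pickBelow tg (stepsOf gs b m) X k)) (by decide)
    (by
      intro k τ i v h
      exact h.congr (put_ne (by decide)) (put_ne (by decide)) (put_ne (by decide))
        (put_ne (by decide)))
    (by simp [FoundIs, CDDP.pickBelow, hσ1, Cmd.den, Expr.eval, put_self]) (by
      intro k hk τ hτ hkτ h
      simp only [Expr.eval, hE1.tab.q] at hk
      have hEτ : Env I m R tg mc τ := hE1.of_frame hτ (by decide)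
      rw [Cmd.den_ite, CDDP.pickBelow]
      cases ho : I.pickBelow tg (stepsOf gs b m) X k with
      | some p =>
        rw [ho] at h
        rw [if_neg]
        · exact h
        · rw [Expr.eval_not]
          exact h.1
      | none =>
        rw [ho] at h
        have h29 : (var 29).eval τ = 0 := h
        rw [if_pos (Expr.eval_not.2 h29), Cmd.den_seq, Cmd.den_seq]
        have h1 := build_spec hEτ (gs := gs) (b := b) (c := k)
          (by rw [hτ 31 (by decide), e1 31 (by decide), hgs])
          (by rw [hτ 32 (by decide), e1 32 (by decide), hb]) hkτ hk
        set τ1 := build.den τ with hτ1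
        have hE2 : Env I m R tg mc τ1 := hEτ.den (by decide)
        have hX1 : SetIs I (τ1 22) X := by
          rw [hτ1, Cmd.den_frame _ (by decide), hτ 22 (by decide), e1 22 (by decide)]
          exact hX
        have h46 : τ1 46 0 = k := by rw [hτ1, Cmd.den_frame _ (by decide), hkτ]
        have h2 : (var 28).eval (check.den τ1) = 0 ↔ _ :=
          check_spec hE2.tab hX1 h46 hk h1 rfl
        have h1' : Buf (check.den τ1) (I.walk tg (stepsOf gs b m) k) :=
          h1.congr (Cmd.den_frame _ (by decide)) (Cmd.den_frame _ (by decide))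
        have h46' : (check.den τ1) 46 0 = k := by rw [Cmd.den_frame _ (by decide), h46]
        have h29' : (check.den τ1) 29 0 = 0 := by
          rw [Cmd.den_frame _ (by decide), hτ1, Cmd.den_frame _ (by decide)]
          exact h
        rw [Cmd.den_ite]
        by_cases hf : I.Free X (k, I.walk tg (stepsOf gs b m) k)
        · rw [if_pos (Expr.eval_not.2 (h2.2 hf)), if_pos hf]
          refine ⟨?_, ?_, ?_⟩
          · simp [Cmd.den, Expr.eval, put_apply]
          · simp [Cmd.den, Expr.eval, put_apply, h46']
          · exact h1'.congr (Cmd.den_frame _ (by decide)) (Cmd.den_frame _ (by decide))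
        · rw [if_neg fun h => hf (h2.1 (Expr.eval_not.1 h)), if_neg hf]
          exact h29')
  simp only [Expr.eval, hE1.tab.q] at hloop
  exact hloop

/-- Add the selected key of the path in the buffer to the forbidden keys. -/
def markKey : Cmd :=
  .set 36 (.lit 0) (.get 31 (.add (.add (var 32) (.add (.add (var 6) (.lit 1))
    (.add (var 6) (.lit 1)))) (var 49))) ;;
  .ite (.and (var 29) (var 36))
    (.ite (.eq (var 36) (.lit 1)) (.set 22 (.add nE (var 30)) (.lit 1))
      (.ite (.sub (var 24) (.sub (var 36) (.lit 1)))
        (.set 22 (.get 23 (.sub (var 36) (.lit 1))) (.lit 1)) .skip)) .skip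

theorem setIs_insert {I : CDDP} {f g : ℕ → ℕ} {X : Finset ℕ} (h : SetIs I f X) {v : ℕ}
    (hg : ∀ x, g x = if x = v then 1 else f x) : SetIs I g (insert v X) := by
  intro x hx
  rw [hg, Finset.mem_insert, ← h x hx]
  split_ifs with hxv <;> simp [hxv]

theorem markKey_spec {I : CDDP} {m R : ℕ} {tg mc : ℕ → ℕ} {σ : State} (hE : Env I m R tg mc σ)
    {gs : ℕ → ℕ} (hgs : σ 31 = gs) {b r : ℕ} (hb : σ 32 0 = b) (hr : σ 49 0 = r) {X : Finset ℕ}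
    (hX : SetIs I (σ 22) X) {o : Option (ℕ × List ℕ)} (ho : FoundIs σ o) :
    SetIs I ((markKey.den σ) 22) (I.mark (gs (b + (m + 1 + (m + 1)) + r)) o X) := by
  rw [markKey, Cmd.den_seq]
  set e := gs (b + (m + 1 + (m + 1)) + r) with he
  set σ1 := Cmd.den (.set 36 (.lit 0) (.get 31 (.add (.add (var 32) (.add (.add (var 6) (.lit 1))
    (.add (var 6) (.lit 1)))) (var 49)))) σ with hσ1
  have e36 : σ1 36 0 = e := by
    simp only [hσ1, Cmd.den, Expr.eval, put_self, hgs, hb, hr, hE.coverSize, he, if_true]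
  have e1 : ∀ a, a ≠ 36 → σ1 a = σ a := fun a ha => put_ne ha
  have hX1 : SetIs I (σ1 22) X := by rw [e1 22 (by decide)]; exact hX
  rw [Cmd.den_ite]
  cases o with
  | none =>
    rw [if_neg]
    · exact hX1
    · rw [Expr.eval_and]
      simp only [Expr.eval, e1 29 (by decide)]
      exact fun h => h.1 ho
  | some p =>
    obtain ⟨h1, h2, h3, h4⟩ := ho
    simp only [CDDP.mark]
    by_cases he0 : e = 0
    · rw [if_neg, if_pos he0]
      · exact hX1
      · rw [Expr.eval_and]
        simp only [Expr.eval, e36]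
        exact fun h => h.2 he0
    · rw [if_pos, if_neg he0]
      · rw [Cmd.den_ite]
        by_cases he1 : e = 1
        · rw [if_pos, if_pos he1]
          · refine setIs_insert hX1 fun x => ?_
            simp only [Cmd.den, Expr.eval, put_self, e1 0 (by decide), hE.tab.n, e1 30 (by decide), h2]
          · rw [Expr.eval_eq]
            simpa only [Expr.eval, e36] using he1
        · rw [if_neg, if_neg he1]
          · rw [Cmd.den_ite]
            have hb : (Expr.sub (var 24) (.sub (var 36) (.lit 1))).eval σ1 ≠ 0 ↔
                e - 1 < p.2.length := by
              rw [Expr.eval_lt]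
              simp only [Expr.eval, e36, e1 24 (by decide), h4]
            by_cases hlt : e - 1 < p.2.length
            · rw [if_pos (hb.2 hlt), List.getElem?_eq_getElem hlt]
              refine setIs_insert hX1 fun x => ?_
              simp only [Cmd.den, Expr.eval, put_self, e1 23 (by decide), e36, h3.get hlt]
            · rw [if_neg fun h => hlt (hb.1 h), List.getElem?_eq_none (by omega)]
              exact hX1
          · rw [Expr.eval_eq]
            simpa only [Expr.eval, e36] using he1
      · rw [Expr.eval_and]
        simp only [Expr.eval, e36, e1 29 (by decide)]
        exact ⟨h1, he0⟩

/-- The digits for the rounds, from position `b`. -/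
def roundsOf (gs : ℕ → ℕ) (b m R : ℕ) : List ℕ :=
  (List.range R).map fun r => gs (b + (m + 1 + (m + 1)) + r)

/-- Search for one more path. -/
def onePath : Cmd :=
  .rep 45 (.add nE qE) (.set 22 (var 45) (.get 21 (var 45))) ;;
  .set 29 (.lit 0) (.lit 0) ;;
  .rep 49 (var 8) (findPath ;; markKey) ;;
  .ite (var 29) emit .skip ;;
  .set 32 (.lit 0) (.add (var 32) (var 9))

theorem onePath_spec {I : CDDP} {m R : ℕ} {tg mc : ℕ → ℕ} {σ : State} (hE : Env I m R tg mc σ)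
    {gs : ℕ → ℕ} (hgs : σ 31 = gs) {b : ℕ} (hb : σ 32 0 = b) {S : List (ℕ × List ℕ)}
    (hw : WordIs (σ 20) S) (hu : SetIs I (σ 21) (I.used S)) :
    WordIs ((onePath.den σ) 20) (I.extend tg S (stepsOf gs b m, roundsOf gs b m R)) ∧
    SetIs I ((onePath.den σ) 21) (I.used (I.extend tg S (stepsOf gs b m, roundsOf gs b m R))) ∧
    (onePath.den σ) 32 0 = b + (2 * (m + 1) + R) := by
  rw [onePath, Cmd.den_seq, Cmd.den_seq]
  have hcopy := Cmd.for_rule (x := 45) (lim := .add nE qE)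
    (P := .set 22 (var 45) (.get 21 (var 45))) (σ := σ)
    (fun k τ => ∀ x < k, τ 22 x = σ 21 x) (by decide)
    (by intro k τ i v h; rw [put_ne (by decide)]; exact h) (by simp) (by
      intro k _ τ hτ hk h x hx
      simp only [Cmd.den, Expr.eval, put_self, hk, hτ 21 (by decide)]
      split_ifs with hxk
      · rw [hxk]
      · exact h x (by omega))
  simp only [Expr.eval, hE.tab.n, hE.tab.q] at hcopy
  set σ1 := Cmd.den (.rep 45 (.add nE qE) (.set 22 (var 45) (.get 21 (var 45)))) σ with hσ1
  set σ2 := Cmd.den (.set 29 (.lit 0) (.lit 0)) σ1 with hσ2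
  have e2 : ∀ a, a ∉ [45, 22, 29] → σ2 a = σ a := by
    intro a ha
    simp only [List.mem_cons, List.not_mem_nil, or_false, not_or] at ha
    rw [hσ2, Cmd.den, put_ne ha.2.2, hσ1, Cmd.den_frame _ (by simp [Cmd.writes, ha])]
  have hE2 : Env I m R tg mc σ2 := hE.of_frame e2 (by decide)
  have hX2 : SetIs I (σ2 22) (I.used S) := by
    intro x hx
    rw [hσ2, Cmd.den, put_ne (by decide), hcopy x hx]
    exact hu x hx
  have h29 : σ2 29 0 = 0 := by simp [hσ2, Cmd.den, Expr.eval, put_apply]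
  set ds := roundsOf gs b m R with hds
  have hlen : ds.length = R := by simp [hds, roundsOf]
  have hloop := Cmd.for_rule (x := 49) (lim := var 8) (P := findPath ;; markKey) (σ := σ2)
    (fun k τ => SetIs I (τ 22)
        ((ds.take k).foldl (I.searchStep tg (stepsOf gs b m)) (I.used S, none)).1 ∧
      FoundIs τ ((ds.take k).foldl (I.searchStep tg (stepsOf gs b m)) (I.used S, none)).2)
    (by decide)
    (by
      intro k τ i v h
      rw [put_ne (by decide)]
      exact ⟨h.1, h.2.congr (put_ne (by decide)) (put_ne (by decide)) (put_ne (by decide))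
        (put_ne (by decide))⟩)
    (by simpa [FoundIs] using ⟨hX2, h29⟩) (by
      -- Only the forbidden set is carried over; the previous pick is forgotten, since each round
      -- searches anew.
      rintro k hk τ hτ hkτ ⟨h1, -⟩
      have hEτ : Env I m R tg mc τ := hE2.of_frame hτ (by decide)
      simp only [Expr.eval, hE2.roundNum] at hk
      have t31 : τ 31 = gs := by rw [hτ 31 (by decide), e2 31 (by decide), hgs]
      have t32 : τ 32 0 = b := by rw [hτ 32 (by decide), e2 32 (by decide), hb]
      have hget : ds[k]? = some (gs (b + (m + 1 + (m + 1)) + k)) := by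
        rw [hds, roundsOf, List.getElem?_map, List.getElem?_range hk]
        rfl
      rw [List.take_add_one, hget, Option.toList_some, List.foldl_append, List.foldl_cons,
        List.foldl_nil, Cmd.den_seq]
      have h2 := findPath_spec hEτ t31 t32 h1
      refine ⟨?_, ?_⟩
      · exact markKey_spec (hEτ.den (P := findPath) (by decide))
          (by rw [Cmd.den_frame _ (by decide), t31]) (by rw [Cmd.den_frame _ (by decide), t32])
          (by rw [Cmd.den_frame _ (by decide), hkτ])
          (by rw [Cmd.den_frame _ (by decide)]; exact h1) h2
      · exact h2.congr (Cmd.den_frame _ (by decide)) (Cmd.den_frame _ (by decide))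
          (Cmd.den_frame _ (by decide)) (Cmd.den_frame _ (by decide)))
  simp only [Expr.eval, hE2.roundNum] at hloop
  rw [List.take_of_length_le hlen.le] at hloop
  obtain ⟨-, h2⟩ := hloop
  rw [Cmd.den_seq, Cmd.den_seq]
  set σ3 := Cmd.den (.rep 49 (var 8) (findPath ;; markKey)) σ2 with hσ3
  have hE3 : Env I m R tg mc σ3 := hE2.den (by decide)
  have e20 : σ3 20 = σ 20 := by rw [hσ3, Cmd.den_frame _ (by decide), e2 20 (by decide)]
  have e21 : σ3 21 = σ 21 := by rw [hσ3, Cmd.den_frame _ (by decide), e2 21 (by decide)]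
  have e32 : σ3 32 0 = b := by rw [hσ3, Cmd.den_frame _ (by decide), e2 32 (by decide), hb]
  set σ4 := Cmd.den (.ite (var 29) emit .skip) σ3 with hσ4
  have hE4 : Env I m R tg mc σ4 := hE3.den (by decide)
  have hmain : WordIs (σ4 20) (I.extend tg S (stepsOf gs b m, ds)) ∧
      SetIs I (σ4 21) (I.used (I.extend tg S (stepsOf gs b m, ds))) := by
    rw [hσ4, Cmd.den_ite, CDDP.extend]
    cases ho : (ds.foldl (I.searchStep tg (stepsOf gs b m)) (I.used S, none)).2 with
    | none =>
      rw [ho] at h2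
      have h29 : (var 29).eval σ3 = 0 := h2
      rw [if_neg (not_not.2 h29), Cmd.den, e20, e21]
      simpa using ⟨hw, hu⟩
    | some p =>
      rw [ho] at h2
      have h29 : (var 29).eval σ3 ≠ 0 := h2.1
      rw [if_pos h29]
      have hfree := CDDP.free_of_search (U := I.used S) ds (I.used S, none) subset_rfl (by simp) p ho
      exact emit_spec hE3 (c := p.1) (l := p.2) hfree.1 (by rw [e20]; exact hw)
        (by rw [e21]; exact hu) h2.2.1 h2.2.2.2 h2.2.2.1
  refine ⟨?_, ?_, ?_⟩
  · rw [Cmd.den_frame _ (by decide)]; exact hmain.1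
  · rw [Cmd.den_frame _ (by decide)]; exact hmain.2
  · have e32' : σ4 32 0 = b := by rw [hσ4, Cmd.den_frame _ (by decide), e32]
    simp only [Cmd.den, Expr.eval, put_self, if_true, e32', hE4.width]

/-- The guess that is described by the digits. -/
def guessOf (gs : ℕ → ℕ) (m R i : ℕ) : List (ℕ × ℕ) × List ℕ :=
  (stepsOf gs (i * (2 * (m + 1) + R)) m, roundsOf gs (i * (2 * (m + 1) + R)) m R)

/-- Follow one guess. -/
def oneGuess : Cmd := reset ;; .set 32 (.lit 0) (.lit 0) ;; .rep 50 (var 7) onePath ;; keepBest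

theorem oneGuess_spec {I : CDDP} {m R : ℕ} {tg mc : ℕ → ℕ} {σ : State} (hE : Env I m R tg mc σ)
    {gs : ℕ → ℕ} (hgs : σ 31 = gs) {O : List (ℕ × List ℕ)} (hO : I.IsPacking O)
    (ho : WordIs (σ 1) O) : ∃ O', I.IsPacking O' ∧ WordIs ((oneGuess.den σ) 1) O' ∧
      O.length ≤ O'.length ∧
      (((List.range (4 * m)).map (guessOf gs m R)).foldl (I.extend tg) []).length ≤ O'.length := by
  rw [oneGuess, Cmd.den_seq, Cmd.den_seq, Cmd.den_seq]
  obtain ⟨h1, h2⟩ := reset_spec hE.tab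
  set σ1 := Cmd.den (.set 32 (.lit 0) (.lit 0)) (reset.den σ) with hσ1
  have hE1 : Env I m R tg mc σ1 := (hE.den (by decide)).den (by decide)
  have h20 : σ1 20 = (reset.den σ) 20 := Cmd.den_frame _ (by decide)
  have h21 : σ1 21 = (reset.den σ) 21 := Cmd.den_frame _ (by decide)
  have h32 : σ1 32 0 = 0 := by simp [hσ1, Cmd.den, Expr.eval, put_apply]
  have h31 : σ1 31 = gs := by
    rw [hσ1, Cmd.den_frame _ (by decide), Cmd.den_frame _ (by decide), hgs]
  have hloop := Cmd.for_rule (x := 50) (lim := var 7) (P := onePath) (σ := σ1)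
    (fun k τ => WordIs (τ 20) (((List.range k).map (guessOf gs m R)).foldl (I.extend tg) []) ∧
      SetIs I (τ 21) (I.used (((List.range k).map (guessOf gs m R)).foldl (I.extend tg) [])) ∧
      τ 32 0 = k * (2 * (m + 1) + R)) (by decide)
    (by
      intro k τ i v h
      rw [put_ne (by decide), put_ne (by decide), put_ne (by decide)]
      exact h)
    (by
      rw [h20, h21, h32]
      simpa using ⟨h1, h2⟩) (by
      rintro k _ τ hτ _ ⟨g1, g2, g3⟩
      have hEτ : Env I m R tg mc τ := hE1.of_frame hτ (by decide)
      obtain ⟨g4, g5, g6⟩ := onePath_spec hEτ (gs := gs) (by rw [hτ 31 (by decide), h31]) g3 g1 g2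
      rw [List.range_succ, List.map_append, List.foldl_append]
      exact ⟨g4, g5, by rw [g6]; ring⟩)
  simp only [Expr.eval, hE1.paths] at hloop
  obtain ⟨g1, -, -⟩ := hloop
  refine keepBest_spec (hE1.den (by decide)) (CDDP.isPacking_foldl_extend _ ?_) hO g1 ?_
  · simp [CDDP.IsPacking]
  · rw [Cmd.den_frame _ (by decide), hσ1, Cmd.den_frame _ (by decide), Cmd.den_frame _ (by decide)]
    exact ho

/-! ### Enumeration of the guesses -/

theorem exists_digits {B : ℕ} (D : ℕ) (d : ℕ → ℕ) (hd : ∀ p < D, d p < B) :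
    ∃ g < B ^ D, ∀ p < D, g / B ^ p % B = d p := by
  induction D with
  | zero => exact ⟨0, by simp, by simp⟩
  | succ D ih =>
    obtain ⟨g, hg, h⟩ := ih fun p hp => hd p (by omega)
    have hD := hd D (by omega)
    have hB : 0 < B := by omega
    refine ⟨g + B ^ D * d D, ?_, fun p hp => ?_⟩
    · calc g + B ^ D * d D < B ^ D * 1 + B ^ D * d D := by omega
        _ = B ^ D * (d D + 1) := by ring
        _ ≤ B ^ D * B := Nat.mul_le_mul_left _ hD
        _ = B ^ (D + 1) := (pow_succ ..).symm
    · rcases Nat.lt_succ_iff_lt_or_eq.1 hp with hp | rfl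
      · obtain ⟨k, rfl⟩ := Nat.exists_eq_add_of_lt hp
        have e : B ^ (p + k + 1) * d (p + k + 1) = B ^ p * (B * (B ^ k * d (p + k + 1))) := by ring
        rw [e, Nat.add_mul_div_left _ _ (Nat.pow_pos hB), Nat.add_mul_mod_self_left, h p (by omega)]
      · rw [Nat.add_mul_div_left _ _ (Nat.pow_pos hB), Nat.div_eq_of_lt hg, zero_add,
          Nat.mod_eq_of_lt hD]

theorem succ_mod_of_lt {a B : ℕ} (h : a % B + 1 < B) : (a + 1) % B = a % B + 1 := by
  have : a + 1 = a % B + 1 + B * (a / B) := by have := Nat.mod_add_div a B; omega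
  rw [this, Nat.add_mul_mod_self_left, Nat.mod_eq_of_lt h]

theorem succ_mod_of_eq {a B : ℕ} (h : a % B + 1 = B) : (a + 1) % B = 0 := by
  have : a + 1 = a % B + 1 + B * (a / B) := by have := Nat.mod_add_div a B; omega
  rw [this, Nat.add_mul_mod_self_left, h, Nat.mod_self]

/-- The body of the loop of `nextGuess`. -/
def carryStep : Cmd :=
  .ite (var 35) (.ite (.sub (var 11) (.add (.get 31 (var 45)) (.lit 1)))
    (.set 31 (var 45) (.add (.get 31 (var 45)) (.lit 1)) ;; .set 35 (.lit 0) (.lit 0))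
    (.set 31 (var 45) (.lit 0))) .skip

/-- Go to the next list of digits. -/
def nextGuess : Cmd := .set 35 (.lit 0) (.lit 1) ;; .rep 45 (var 10) carryStep

/-- When `g` is increased by one, the carry reaches position `k` exactly if `B ^ k` divides `g + 1`,
which is also when the quotient by `B ^ k` goes up. The digit then increases, or it wraps to 0 and
passes the carry on. -/
theorem carryStep_spec {σ : State} {B k g : ℕ} (hB : 0 < B) (h11 : σ 11 0 = B) (h45 : σ 45 0 = k)
    (hc : σ 35 0 ≠ 0 ↔ B ^ k ∣ g + 1) (hk : σ 31 k = g / B ^ k % B) :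
    ((carryStep.den σ) 35 0 ≠ 0 ↔ B ^ (k + 1) ∣ g + 1) ∧
      (carryStep.den σ) 31 k = (g + 1) / B ^ k % B ∧
      ∀ p, p ≠ k → (carryStep.den σ) 31 p = σ 31 p := by
  have hlt : g / B ^ k % B < B := Nat.mod_lt _ hB
  have hdvd : B ^ (k + 1) ∣ g + 1 ↔ B ^ k ∣ g + 1 ∧ (g + 1) / B ^ k % B = 0 := by
    rw [← Nat.dvd_iff_mod_eq_zero]
    constructor
    · intro h
      have h1 : B ^ k ∣ g + 1 := (pow_dvd_pow B (Nat.le_succ k)).trans h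
      exact ⟨h1, (Nat.dvd_div_iff_mul_dvd h1).2 (by rwa [← pow_succ])⟩
    · rintro ⟨h1, h2⟩
      rw [pow_succ]
      exact (Nat.dvd_div_iff_mul_dvd h1).1 h2
  rw [carryStep, Cmd.den_ite]
  by_cases h : B ^ k ∣ g + 1
  · have hv : (var 35).eval σ ≠ 0 := hc.2 h
    have hs : (g + 1) / B ^ k = g / B ^ k + 1 := Nat.succ_div_of_dvd h
    rw [if_pos hv, Cmd.den_ite]
    have hb : (Expr.sub (var 11) (.add (.get 31 (var 45)) (.lit 1))).eval σ ≠ 0 ↔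
        g / B ^ k % B + 1 < B := by
      rw [Expr.eval_lt]
      simp only [Expr.eval, h11, h45, hk]
    by_cases h2 : g / B ^ k % B + 1 < B
    · rw [if_pos (hb.2 h2), hdvd, hs, succ_mod_of_lt h2]
      simp +contextual [Cmd.den, Expr.eval, put_apply, h45, hk]
    · rw [if_neg fun h => h2 (hb.1 h), hdvd, hs, succ_mod_of_eq (by omega)]
      have hv' : σ 35 0 ≠ 0 := hv
      simp +contextual [Cmd.den, Expr.eval, put_apply, h45, hv', h]
  · have hv : ¬ (var 35).eval σ ≠ 0 := fun hv => h (hc.1 hv)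
    rw [if_neg hv, hdvd, Nat.succ_div_of_not_dvd h]
    exact ⟨⟨fun h' => absurd h' hv, fun h' => absurd h'.1 h⟩, hk, fun _ _ => rfl⟩

theorem nextGuess_spec {σ : State} {B D g : ℕ} (hB : 0 < B) (h11 : σ 11 0 = B) (h10 : σ 10 0 = D)
    (h : ∀ p < D, σ 31 p = g / B ^ p % B) :
    ∀ p < D, (nextGuess.den σ) 31 p = (g + 1) / B ^ p % B := by
  rw [nextGuess, Cmd.den_seq]
  set σ1 := Cmd.den (.set 35 (.lit 0) (.lit 1)) σ with hσ1
  have e1 : ∀ a, a ≠ 35 → σ1 a = σ a := fun a ha => put_ne ha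
  have hloop := Cmd.for_rule (x := 45) (lim := var 10) (P := carryStep) (σ := σ1)
    (fun k τ => (τ 35 0 ≠ 0 ↔ B ^ k ∣ g + 1) ∧
      ∀ p < D, τ 31 p = if p < k then (g + 1) / B ^ p % B else g / B ^ p % B) (by decide)
    (by
      intro k τ i v h
      rw [put_ne (by decide), put_ne (by decide)]
      exact h)
    ⟨by simp [hσ1, Cmd.den, Expr.eval, put_apply], fun p hp => by
      rw [if_neg (by omega), e1 31 (by decide), h p hp]⟩ (by
      rintro k hk τ hτ hkτ ⟨g1, g2⟩
      simp only [Expr.eval, e1 10 (by decide), h10] at hk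
      obtain ⟨g3, g4, g5⟩ := carryStep_spec hB
        (by rw [hτ 11 (by decide), e1 11 (by decide), h11]) hkτ g1
        (by rw [g2 k hk, if_neg (by omega)])
      refine ⟨g3, fun p hp => ?_⟩
      by_cases hpk : p = k
      · subst hpk; rw [g4, if_pos (by omega)]
      · rw [g5 p hpk, g2 p hp]
        congr 1
        exact propext ⟨fun h => by omega, fun h => by omega⟩)
  simp only [Expr.eval, e1 10 (by decide), h10] at hloop
  intro p hp
  rw [hloop.2 p hp, if_pos hp]

theorem guessOf_congr {gs gs' : ℕ → ℕ} {m R i K : ℕ} (hi : i < K)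
    (h : ∀ p < K * (2 * (m + 1) + R), gs p = gs' p) : guessOf gs m R i = guessOf gs' m R i := by
  have hW : i * (2 * (m + 1) + R) + (2 * (m + 1) + R) ≤ K * (2 * (m + 1) + R) := by
    rw [← Nat.succ_mul]
    exact Nat.mul_le_mul_right _ hi
  unfold guessOf stepsOf roundsOf
  congr 1
  · refine List.map_congr_left fun j hj => ?_
    rw [List.mem_range] at hj
    rw [h _ (by omega), h _ (by omega)]
  · refine List.map_congr_left fun r hr => ?_
    rw [List.mem_range] at hr
    rw [h _ (by omega)]

/-- The digit at position `r` in the description of a guess. -/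
def guessDigit (m : ℕ) (g : List (ℕ × ℕ) × List ℕ) (r : ℕ) : ℕ :=
  if r < 2 * (m + 1) then
    if r % 2 = 0 then (g.1.getD (r / 2) (0, 0)).1 else (g.1.getD (r / 2) (0, 0)).2
  else g.2.getD (r - 2 * (m + 1)) 0

theorem guessOf_guessDigit {gs : ℕ → ℕ} {m R i : ℕ} {g : List (ℕ × ℕ) × List ℕ}
    (h1 : g.1.length = m + 1) (h2 : g.2.length = R)
    (h : ∀ r < 2 * (m + 1) + R, gs (i * (2 * (m + 1) + R) + r) = guessDigit m g r) :
    guessOf gs m R i = g := by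
  obtain ⟨g1, g2⟩ := g
  simp only at h1 h2
  unfold guessOf stepsOf roundsOf
  refine Prod.ext (List.ext_getElem (by simp [h1]) fun j hj hj' => ?_)
    (List.ext_getElem (by simp [h2]) fun r hr hr' => ?_)
  · simp only at hj' ⊢
    rw [List.getElem_map, List.getElem_range, add_assoc, h _ (by omega), h _ (by omega),
      guessDigit, guessDigit, if_pos (by omega), if_pos (by omega), if_pos (by omega),
      if_neg (by omega), show (j + j) / 2 = j by omega, show (j + j + 1) / 2 = j by omega,
      List.getD_eq_getElem _ _ hj']
  · simp only at hr' ⊢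
    rw [List.getElem_map, List.getElem_range, add_assoc, h _ (by omega), guessDigit,
      if_neg (by omega), show m + 1 + (m + 1) + r - 2 * (m + 1) = r by omega,
      List.getD_eq_getElem _ _ hr']

theorem getD_le {α : Type*} {f : α → ℕ} {b : ℕ} {l : List α} (h : ∀ x ∈ l, f x ≤ b) {d : α}
    (hd : f d ≤ b) (i : ℕ) : f (l.getD i d) ≤ b := by
  rcases Nat.lt_or_ge i l.length with hi | hi
  · rw [List.getD_eq_getElem _ _ hi]
    exact h _ (List.getElem_mem hi)
  · rwa [List.getD_eq_default _ _ hi]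

theorem guessDigit_le {m R : ℕ} {g : List (ℕ × ℕ) × List ℕ}
    (h1 : ∀ q ∈ g.1, q.1 ≤ m ∧ q.2 ≤ R + 2 * m + 1) (h2 : ∀ e ∈ g.2, e ≤ 2 * m + 4) (r : ℕ) :
    guessDigit m g r ≤ R + 2 * m + 4 := by
  unfold guessDigit
  split_ifs
  · exact (getD_le (f := Prod.fst) (fun x hx => (h1 x hx).1) (Nat.zero_le _) _).trans (by omega)
  · exact (getD_le (f := Prod.snd) (fun x hx => (h1 x hx).2) (Nat.zero_le _) _).trans (by omega)
  · exact (getD_le (f := id) h2 (Nat.zero_le _) _).trans (by omega)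

/-- The guesses are written one after the other in blocks of fixed width; the base exceeds every
digit that can occur. Blocks beyond the list are filled with zeros, and what they describe is
irrelevant because only a prefix is claimed. -/
theorem exists_guess_number {m R K : ℕ} {gl : List (List (ℕ × ℕ) × List ℕ)} (hK : gl.length ≤ K)
    (hgl : ∀ g ∈ gl, g.1.length = m + 1 ∧ g.2.length = R ∧
      (∀ q ∈ g.1, q.1 ≤ m ∧ q.2 ≤ R + 2 * m + 1) ∧ ∀ e ∈ g.2, e ≤ 2 * m + 4) :
    ∃ g < (R + 2 * m + 5) ^ (K * (2 * (m + 1) + R)), ∀ gs : ℕ → ℕ,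
      (∀ p < K * (2 * (m + 1) + R), gs p = g / (R + 2 * m + 5) ^ p % (R + 2 * m + 5)) →
      gl <+: (List.range K).map (guessOf gs m R) := by
  set W := 2 * (m + 1) + R with hW
  have hW0 : 0 < W := by omega
  obtain ⟨g, hg, hd⟩ := exists_digits (B := R + 2 * m + 5) (K * W)
    (fun p => guessDigit m (gl.getD (p / W) ([], [])) (p % W)) (by
      intro p _
      have : guessDigit m (gl.getD (p / W) ([], [])) (p % W) ≤ R + 2 * m + 4 := by
        rcases Nat.lt_or_ge (p / W) gl.length with hi | hi
        · rw [List.getD_eq_getElem _ _ hi]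
          have := hgl _ (List.getElem_mem hi)
          exact guessDigit_le this.2.2.1 this.2.2.2 _
        · rw [List.getD_eq_default _ _ hi]
          exact guessDigit_le (by simp) (by simp) _
      omega)
  refine ⟨g, hg, fun gs hgs => ?_⟩
  rw [List.prefix_iff_eq_take]
  refine List.ext_getElem (by simp [hK]) fun i hi hi' => ?_
  rw [List.getElem_take, List.getElem_map, List.getElem_range]
  have hgi := hgl _ (List.getElem_mem hi)
  refine (guessOf_guessDigit hgi.1 hgi.2.1 fun r hr => ?_).symm
  have hp : i * W + r < K * W := by
    have : i * W + W ≤ K * W := by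
      rw [← Nat.succ_mul]
      exact Nat.mul_le_mul_right _ (by omega)
    omega
  have h3 : (i * W + r) / W = i := by
    rw [mul_comm, Nat.mul_add_div hW0, Nat.div_eq_of_lt hr, add_zero]
  have h4 : (i * W + r) % W = r := by
    rw [mul_comm, Nat.mul_add_mod, Nat.mod_eq_of_lt hr]
  rw [hgs _ hp, hd _ hp, h3, h4, List.getD_eq_getElem _ _ hi]

theorem length_le_foldl_extend {I : CDDP} (tg : ℕ → ℕ) (gl : List (List (ℕ × ℕ) × List ℕ)) :
    ∀ S : List (ℕ × List ℕ), S.length ≤ (gl.foldl (I.extend tg) S).length := by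
  induction gl with
  | nil => exact fun S => le_rfl
  | cons g gl ih => exact fun S => (CDDP.length_extend tg S g).trans (ih _)

/-- Follow all guesses. -/
def allGuesses : Cmd := .rep 51 (var 12) (oneGuess ;; nextGuess)

theorem allGuesses_spec {I : CDDP} {m R B D N : ℕ} {tg mc : ℕ → ℕ} {σ : State}
    (hE : Env I m R tg mc σ) (hB : B = R + 2 * m + 5) (hD : D = 4 * m * (2 * (m + 1) + R))
    (hN : N = B ^ D) (h10 : σ 10 0 = D) (h11 : σ 11 0 = B) (h12 : σ 12 0 = N)
    (h31 : σ 31 = fun _ => 0) {O : List (ℕ × List ℕ)} (hO : I.IsPacking O) (ho : WordIs (σ 1) O) :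
    ∃ O', I.IsPacking O' ∧ WordIs ((allGuesses.den σ) 1) O' ∧ O.length ≤ O'.length ∧
      ∀ gl : List (List (ℕ × ℕ) × List ℕ), gl.length ≤ 4 * m →
        (∀ g ∈ gl, g.1.length = m + 1 ∧ g.2.length = R ∧
          (∀ q ∈ g.1, q.1 ≤ m ∧ q.2 ≤ R + 2 * m + 1) ∧ ∀ e ∈ g.2, e ≤ 2 * m + 4) →
        (gl.foldl (I.extend tg) []).length ≤ O'.length := by
  have hloop := Cmd.for_rule (x := 51) (lim := var 12) (P := oneGuess ;; nextGuess) (σ := σ)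
    -- The digits spell the number `k` of the round, and the best packing so far is at least as
    -- large as the result of every guess with a smaller number. The guess is quantified over all
    -- arrays with the right first `D` digits, as no other digits are read.
    (fun k τ => (∀ p < D, τ 31 p = k / B ^ p % B) ∧ ∃ O', I.IsPacking O' ∧ WordIs (τ 1) O' ∧
      O.length ≤ O'.length ∧ ∀ g < k, ∀ gs : ℕ → ℕ, (∀ p < D, gs p = g / B ^ p % B) →
        (((List.range (4 * m)).map (guessOf gs m R)).foldl (I.extend tg) []).length ≤ O'.length)
    (by decide)
    (by
      intro k τ i v h
      rw [put_ne (by decide), put_ne (by decide)]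
      exact h)
    ⟨fun p _ => by simp [h31], O, hO, ho, le_rfl, by simp⟩ (by
      rintro k _ τ hτ _ ⟨g1, O', g2, g3, g4, g5⟩
      have hEτ : Env I m R tg mc τ := hE.of_frame hτ (by decide)
      rw [Cmd.den_seq]
      obtain ⟨O'', f1, f2, f3, f4⟩ := oneGuess_spec hEτ (gs := τ 31) rfl g2 g3
      refine ⟨nextGuess_spec (by omega) ?_ ?_ ?_, O'', f1, ?_, g4.trans f3, ?_⟩
      · rw [Cmd.den_frame _ (by decide), hτ 11 (by decide), h11]
      · rw [Cmd.den_frame _ (by decide), hτ 10 (by decide), h10]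
      · intro p hp
        rw [Cmd.den_frame _ (by decide), g1 p hp]
      · rw [Cmd.den_frame _ (by decide)]
        exact f2
      · intro g hg gs hgs
        rcases Nat.lt_succ_iff_lt_or_eq.1 hg with hg | rfl
        · exact (g5 g hg gs hgs).trans f3
        · have : (List.range (4 * m)).map (guessOf gs m R) =
              (List.range (4 * m)).map (guessOf (τ 31) m R) := by
            refine List.map_congr_left fun i hi => ?_
            rw [List.mem_range] at hi
            refine guessOf_congr hi fun p hp => ?_
            rw [← hD] at hp
            rw [hgs p hp, g1 p hp]
          rw [this]
          exact f4)
  simp only [Expr.eval, h12] at hloop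
  obtain ⟨-, O', g2, g3, g4, g5⟩ := hloop
  refine ⟨O', g2, g3, g4, fun gl hgl hgl' => ?_⟩
  -- A run always uses `4 * m` guesses, of which `gl` is only a prefix; the surplus guesses can only
  -- add paths.
  obtain ⟨g, hg, hpre⟩ := exists_guess_number hgl hgl'
  have hpre' := hpre (fun p => g / B ^ p % B) fun p hp => by rw [hB]
  have h5 := g5 g (by rw [hN, hB, hD]; exact hg) (fun p => g / B ^ p % B) fun p hp => rfl
  obtain ⟨gl', h'⟩ := hpre'
  rw [← h', List.foldl_append] at h5
  exact (length_le_foldl_extend tg gl' _).trans h5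

/-! ### The algorithm -/

/-- Add `lim * e` to the scalar variable `a`. -/
abbrev accum (x a : ℕ) (lim e : Expr) : Cmd := .rep x lim (.set a (.lit 0) (.add (var a) e))

theorem accum_spec {x a : ℕ} {lim e : Expr} (σ : State) (hxa : x ≠ a)
    (he : ∀ b ∈ e.reads, b ≠ x ∧ b ≠ a) :
    ((accum x a lim e).den σ) a 0 = σ a 0 + lim.eval σ * e.eval σ := by
  refine Cmd.for_rule (x := x) (lim := lim) (P := .set a (.lit 0) (.add (var a) e)) (σ := σ)
    (fun k τ => τ a 0 = σ a 0 + k * e.eval σ) (by simpa [Cmd.writes] using hxa) ?_ (by simp) ?_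
  · intro k τ i v h
    rw [put_ne hxa.symm, h]
  · intro k _ τ hτ _ h
    have : e.eval τ = e.eval σ := Expr.eval_congr _ fun b hb => hτ b (by
      simpa [Cmd.writes] using he b hb)
    simp only [Cmd.den, Expr.eval, put_self, this, h, if_true]
    ring

/-- Find a vertex cover and a matching, and compute the bounds for the output and the number
of guessed paths. -/
def prepare : Cmd :=
  tables ;; cover ;; matching ;;
  .set 14 (.lit 0) (.lit 2) ;; accum 45 14 qE (.add nE (.lit 2)) ;;
  .set 7 (.lit 0) (.add (.add (var 6) (var 6)) (.add (var 6) (var 6)))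

/-- Compute the number of rounds and the range of the digits. -/
def countRounds : Cmd :=
  .set 8 (.lit 0) (.lit 1) ;; accum 45 8 (var 7) (.add (.add (var 6) (var 6)) (.lit 1)) ;;
  .set 9 (.lit 0) (.add (.add (.add (var 6) (.lit 1)) (.add (var 6) (.lit 1))) (var 8)) ;;
  .set 10 (.lit 0) (.lit 0) ;; accum 45 10 (var 7) (var 9) ;;
  .set 11 (.lit 0) (.add (.add (var 8) (.add (var 6) (var 6))) (.lit 5))

/-- Compute the number of guesses. -/
def countGuesses : Cmd :=
  .set 12 (.lit 0) (.lit 1) ;;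
  .rep 45 (var 10) (.set 13 (.lit 0) (.lit 0) ;; accum 46 13 (var 11) (var 12) ;;
    .set 12 (.lit 0) (var 13))

/-- Search for a solution. -/
def search : Cmd :=
  .set 1 (.lit 0) (.lit 1) ;; .set 1 (.lit 1) (.lit 0) ;; short ;; allGuesses

/-- The number of rounds in the search for one path, for a vertex cover of size `m`. -/
def roundCount (m : ℕ) : ℕ := 4 * m * (2 * m + 1) + 1

/-- The number of digits that describe a guess. -/
def digitCount (m : ℕ) : ℕ := 4 * m * (2 * (m + 1) + roundCount m)

/-- The range of the digits. -/
def digitBase (m : ℕ) : ℕ := roundCount m + 2 * m + 5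

/-- A bound for the number of guesses. -/
def guessBound (m : ℕ) : ℕ := digitBase m ^ (digitCount m + 1)

theorem guessBound_mono {m k : ℕ} (h : m ≤ k) : guessBound m ≤ guessBound k := by
  have h1 : roundCount m ≤ roundCount k := by unfold roundCount; gcongr
  have h2 : digitCount m ≤ digitCount k := by unfold digitCount; gcongr
  have h3 : digitBase m ≤ digitBase k := by unfold digitBase; gcongr
  exact (Nat.pow_le_pow_left h3 _).trans (Nat.pow_le_pow_right (by unfold digitBase; omega)
    (by omega))

/-- The additional one in the exponent of `guessBound` is needed here: for `m = 0` there are no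
digits. -/
theorem digitBase_le (m : ℕ) : digitBase m ≤ guessBound m :=
  Nat.le_self_pow (Nat.succ_ne_zero _) _

theorem pow_digitCount_le (m : ℕ) : digitBase m ^ digitCount m ≤ guessBound m :=
  Nat.pow_le_pow_right (by unfold digitBase; omega) (Nat.le_succ _)

theorem digitCount_le (m : ℕ) : digitCount m ≤ guessBound m :=
  (Nat.lt_pow_self (by unfold digitBase; omega)).le.trans (pow_digitCount_le m)

theorem roundCount_le (m : ℕ) : roundCount m ≤ guessBound m :=
  le_trans (by unfold digitBase; omega) (digitBase_le m)

theorem four_mul_le (m : ℕ) : 4 * m ≤ guessBound m := by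
  refine le_trans ?_ (roundCount_le m)
  unfold roundCount
  nlinarith

theorem computable_guessBound (C d : ℕ) : Computable fun k => C * guessBound (2 * k) ^ d := by
  have hpow : Primrec₂ ((· ^ ·) : ℕ → ℕ → ℕ) := Primrec₂.unpaired'.1 Nat.Primrec.pow
  have hadd {f g : ℕ → ℕ} (hf : Primrec f) (hg : Primrec g) : Primrec fun k => f k + g k :=
    Primrec.nat_add.comp hf hg
  have hmul {f g : ℕ → ℕ} (hf : Primrec f) (hg : Primrec g) : Primrec fun k => f k * g k :=
    Primrec.nat_mul.comp hf hg
  have hc (n : ℕ) : Primrec fun _ : ℕ => n := Primrec.const n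
  have h1 : Primrec roundCount := hadd (hmul (hmul (hc 4) .id) (hadd (hmul (hc 2) .id) (hc 1))) (hc 1)
  have h2 : Primrec digitCount :=
    hmul (hmul (hc 4) .id) (hadd (hmul (hc 2) (hadd .id (hc 1))) h1)
  have h3 : Primrec digitBase := hadd (hadd h1 (hmul (hc 2) .id)) (hc 5)
  have h4 : Primrec guessBound := hpow.comp h3 (hadd h2 (hc 1))
  have h5 : Primrec fun k => guessBound (2 * k) := h4.comp (hmul (hc 2) .id)
  have h6 : Primrec fun k => guessBound (2 * k) ^ d := hpow.comp h5 (hc d)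
  exact (hmul (hc C) h6).to_comp

/-- The memory after the preparation, for a vertex cover `C`. -/
structure Prepared (I : CDDP) (C : Finset ℕ) (σ : State) : Prop where
  cov : CovInv I C σ
  isCover : ∀ u v : Fin I.n, I.G.Adj u v → (u : ℕ) ∈ C ∨ (v : ℕ) ∈ C
  mat : MatchInv I σ
  stable : I.IsStable (σ 15)
  wordBound : σ 14 0 = I.q * (I.n + 2) + 2
  paths : σ 7 0 = 4 * C.card

theorem prepare_spec {I : CDDP} : ∃ C, Prepared I C (prepare.den (init I.encode)) := by
  rw [prepare, Cmd.den_seq, Cmd.den_seq, Cmd.den_seq]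
  have hz : ∀ a ≠ 0, init I.encode a = fun _ => 0 := fun a ha => by
    funext i; simp [init, ha]
  have h1 := tables_spec (I := I) (σ := init I.encode) rfl (by rw [hz 3 (by decide)])
  set σ1 := tables.den (init I.encode) with hσ1
  have e1 : ∀ a ∉ tables.writes, a ≠ 0 → σ1 a = fun _ => 0 := fun a h ha => by
    rw [hσ1, Cmd.den_frame _ h, hz a ha]
  obtain ⟨C, h2, h3⟩ := cover_spec h1 (e1 4 (by decide) (by decide)) (e1 5 (by decide) (by decide))
    (e1 6 (by decide) (by decide))
  set σ2 := cover.den σ1 with hσ2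
  have h4 := matching_spec (σ := σ2) (h1.congr (Cmd.den_frame _ (by decide))
      (Cmd.den_frame _ (by decide)) (Cmd.den_frame _ (by decide)))
    (by rw [hσ2, Cmd.den_frame _ (by decide), e1 15 (by decide) (by decide)])
    (by rw [hσ2, Cmd.den_frame _ (by decide), e1 16 (by decide) (by decide)])
  set σ3 := matching.den σ2 with hσ3
  have h5 : CovInv I C σ3 := h2.congr (Cmd.den_frame _ (by decide)) (Cmd.den_frame _ (by decide))
    (Cmd.den_frame _ (by decide))
  set P : Cmd := .set 14 (.lit 0) (.lit 2) ;; accum 45 14 qE (.add nE (.lit 2)) ;;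
    .set 7 (.lit 0) (.add (.add (var 6) (var 6)) (.add (var 6) (var 6))) with hP
  have e3 : ∀ a ∉ P.writes, P.den σ3 a = σ3 a := fun a ha => Cmd.den_frame _ ha
  refine ⟨C, h5.congr (e3 4 (by decide)) (e3 5 (by decide)) (e3 6 (by decide)), h3,
    ⟨h4.1.tab.congr (e3 0 (by decide)) (e3 2 (by decide)) (e3 3 (by decide)), ?_, ?_⟩, ?_, ?_, ?_⟩
  · rw [e3 15 (by decide)]; exact h4.1.isMatch
  · rw [e3 15 (by decide), e3 16 (by decide)]; exact h4.1.used
  · rw [e3 15 (by decide)]; exact h4.2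
  · rw [hP, Cmd.den_seq, Cmd.den_seq, Cmd.den, put_ne (by decide),
      accum_spec _ (by decide) (by decide)]
    simp only [Cmd.den, Expr.eval, put_apply, h4.1.tab.n, h4.1.tab.q]
    simp
    ring
  · rw [hP, Cmd.den_seq, Cmd.den_seq]
    have h6 : ∀ τ : State, τ 6 = σ3 6 → (Cmd.den (.set 7 (.lit 0)
        (.add (.add (var 6) (var 6)) (.add (var 6) (var 6)))) τ) 7 0 = 4 * C.card := by
      intro τ hτ
      simp only [Cmd.den, Expr.eval, put_self, hτ, h5.card, if_true]
      ring
    exact h6 _ ((Cmd.den_frame _ (by decide)).trans (Cmd.den_frame _ (by decide)))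

theorem countRounds_spec {σ : State} {m : ℕ} (h6 : σ 6 0 = m) (h7 : σ 7 0 = 4 * m) :
    (countRounds.den σ) 8 0 = roundCount m ∧
    (countRounds.den σ) 9 0 = 2 * (m + 1) + roundCount m ∧
    (countRounds.den σ) 10 0 = digitCount m ∧ (countRounds.den σ) 11 0 = digitBase m := by
  rw [countRounds, Cmd.den_seq, Cmd.den_seq, Cmd.den_seq, Cmd.den_seq, Cmd.den_seq]
  set σ1 := Cmd.den (accum 45 8 (var 7) (.add (.add (var 6) (var 6)) (.lit 1)))
    (Cmd.den (.set 8 (.lit 0) (.lit 1)) σ) with hσ1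
  have e1 : ∀ a ∉ [45, 8], σ1 a = σ a := fun a ha =>
    (Cmd.den_frame _ (by simpa [Cmd.writes] using ha)).trans
      (Cmd.den_frame _ (by simp [Cmd.writes] at ha ⊢; tauto))
  have h8 : σ1 8 0 = roundCount m := by
    rw [hσ1, accum_spec _ (by decide) (by decide)]
    simp [Cmd.den, Expr.eval, put_apply, h6, h7, roundCount]
    ring
  set σ2 := Cmd.den (.set 9 (.lit 0) (.add (.add (.add (var 6) (.lit 1)) (.add (var 6) (.lit 1)))
    (var 8))) σ1 with hσ2
  have e2 : ∀ a ∉ [9], σ2 a = σ1 a := fun a ha => Cmd.den_frame _ (by simpa [Cmd.writes] using ha)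
  have h9 : σ2 9 0 = 2 * (m + 1) + roundCount m := by
    simp only [hσ2, Cmd.den, Expr.eval, put_self, h8, e1 6 (by decide), h6, if_true]
    ring
  set σ3 := Cmd.den (accum 45 10 (var 7) (var 9)) (Cmd.den (.set 10 (.lit 0) (.lit 0)) σ2) with hσ3
  have e3 : ∀ a ∉ [45, 10], σ3 a = σ2 a := fun a ha =>
    (Cmd.den_frame _ (by simpa [Cmd.writes] using ha)).trans
      (Cmd.den_frame _ (by simp [Cmd.writes] at ha ⊢; tauto))
  have h10 : σ3 10 0 = digitCount m := by
    rw [hσ3, accum_spec _ (by decide) (by decide)]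
    simp only [Cmd.den, Expr.eval, put_apply, h9, e2 7 (by decide), e1 7 (by decide), h7]
    simp [digitCount]
  refine ⟨?_, ?_, ?_, ?_⟩
  · rw [Cmd.den_frame _ (by decide), e3 8 (by decide), e2 8 (by decide), h8]
  · rw [Cmd.den_frame _ (by decide), e3 9 (by decide), h9]
  · rw [Cmd.den_frame _ (by decide), h10]
  · simp only [Cmd.den, Expr.eval, put_self, e3 8 (by decide), e2 8 (by decide), h8,
      e3 6 (by decide), e2 6 (by decide), e1 6 (by decide), h6, if_true, digitBase]
    ring

theorem countGuesses_spec {σ : State} {B D : ℕ} (h10 : σ 10 0 = D) (h11 : σ 11 0 = B) :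
    (countGuesses.den σ) 12 0 = B ^ D := by
  rw [countGuesses, Cmd.den_seq]
  set σ1 := Cmd.den (.set 12 (.lit 0) (.lit 1)) σ with hσ1
  have e1 : ∀ a, a ≠ 12 → σ1 a = σ a := fun a ha => put_ne ha
  have hloop := Cmd.for_rule (x := 45) (lim := var 10) (P := .set 13 (.lit 0) (.lit 0) ;;
      accum 46 13 (var 11) (var 12) ;; .set 12 (.lit 0) (var 13)) (σ := σ1)
    (fun k τ => τ 12 0 = B ^ k) (by decide)
    (by intro k τ i v h; rw [put_ne (by decide), h])
    (by simp [hσ1, Cmd.den, Expr.eval, put_apply]) (by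
      intro k _ τ hτ _ h
      rw [Cmd.den_seq, Cmd.den_seq, Cmd.den, put_self]
      simp only [Expr.eval, if_true]
      rw [accum_spec _ (by decide) (by decide)]
      simp only [Cmd.den, Expr.eval, put_apply, h, hτ 11 (by decide), e1 11 (by decide), h11]
      simp [pow_succ, mul_comm])
  simp only [Expr.eval, e1 10 (by decide), h10] at hloop
  exact hloop

end RAM

/-! ### Size estimates, correctness and running time of the algorithm -/

namespace CDDP

open RAM

theorem two_le_n (I : CDDP) : 2 ≤ I.n := by
  have h1 := I.s.2
  have h2 := I.t.2
  have h3 : (I.s : ℕ) ≠ I.t := fun h => I.s_ne_t (Fin.ext h)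
  omega

theorem wordBound_le_size (I : CDDP) : I.q * (I.n + 2) + 2 ≤ I.size := by
  have h := I.two_le_n
  rw [size_eq]
  have h1 : I.n + 2 ≤ I.n * I.n := by nlinarith
  have h2 : I.q * (I.n + 2) ≤ I.q * (I.n * I.n) := Nat.mul_le_mul_left _ h1
  nlinarith

theorem n_add_q_le_size (I : CDDP) : I.n + I.q + 1 ≤ I.size := by
  have h := I.two_le_n
  rw [size_eq]
  have h1 : I.n + 2 ≤ I.n * I.n := by nlinarith
  have h2 : I.q * 1 ≤ I.q * (I.n * I.n) := Nat.mul_le_mul_left _ (by omega)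
  nlinarith

end CDDP

namespace RAM

open RAM.Expr (var nE qE sE tE)

theorem prepare_lims {I : CDDP} {M : ℕ} (hM : I.size ≤ M) :
    ∀ e ∈ prepare.lims, e.eval (init I.encode) ≤ M := by
  have hs := I.n_add_q_le_size
  have h1 : init I.encode 0 1 ≤ M := show I.n ≤ M by omega
  have h2 : init I.encode 0 2 ≤ M := show I.q ≤ M by omega
  have h3 : init I.encode 0 2 + 1 ≤ M := show I.q + 1 ≤ M by omega
  simp [prepare, accum, Cmd.lims, tables, cover, coverStep, matching, augOne, augThree, Expr.eval,
    h1, h2, h3]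

theorem countRounds_lims {σ : State} {M : ℕ} (h7 : σ 7 0 ≤ M) :
    ∀ e ∈ countRounds.lims, e.eval σ ≤ M := by
  simp [countRounds, accum, Cmd.lims, Expr.eval, h7]

theorem countGuesses_lims {σ : State} {M : ℕ} (h10 : σ 10 0 ≤ M) (h11 : σ 11 0 ≤ M) :
    ∀ e ∈ countGuesses.lims, e.eval σ ≤ M := by
  simp [countGuesses, accum, Cmd.lims, Expr.eval, h10, h11]

theorem search_lims {σ : State} {M : ℕ} (h0 : σ 0 1 + σ 0 2 ≤ M) (h6 : σ 6 0 + 1 ≤ M)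
    (h7 : σ 7 0 ≤ M) (h8 : σ 8 0 ≤ M) (h10 : σ 10 0 ≤ M) (h12 : σ 12 0 ≤ M) (h14 : σ 14 0 ≤ M) :
    ∀ e ∈ search.lims, e.eval σ ≤ M := by
  have h1 : σ 0 1 ≤ M := by omega
  have h2 : σ 0 2 ≤ M := by omega
  simp [search, Cmd.lims, short, allGuesses, reset, keepBest, emit, loadShort, oneGuess, nextGuess,
    carryStep, onePath, findPath, markKey, build, buildStep, connect, push, check, checkPos,
    Expr.eval, h0, h1, h2, h6, h7, h8, h10, h12, h14]

/-- The memory before the search. -/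
structure Ready (I : CDDP) (C : Finset ℕ) (σ : State) : Prop where
  env : Env I C.card (roundCount C.card) (σ 5) (σ 15) σ
  isCover : I.Covers C
  list : ∀ v ∈ C, ∃ j ≤ C.card, σ 5 j = v ∧ j ≠ 0
  isMatch : I.IsMatch (σ 15)
  stable : I.IsStable (σ 15)
  digits : σ 10 0 = digitCount C.card
  base : σ 11 0 = digitBase C.card
  guesses : σ 12 0 = digitBase C.card ^ digitCount C.card
  zero : σ 31 = fun _ => 0

theorem Prepared.ready {I : CDDP} {C : Finset ℕ} {σ : State} (h : Prepared I C σ)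
    (h31 : σ 31 = fun _ => 0) : Ready I C (countGuesses.den (countRounds.den σ)) := by
  obtain ⟨h8, h9, h10, h11⟩ := countRounds_spec h.cov.card h.paths
  have h12 := countGuesses_spec h10 h11
  set σ1 := countRounds.den σ with hσ1
  set σ2 := countGuesses.den σ1 with hσ2
  have e2 : ∀ a ∉ countGuesses.writes, σ2 a = σ1 a := fun a ha => Cmd.den_frame _ ha
  have e1 : ∀ a, a ∉ countRounds.writes ∧ a ∉ countGuesses.writes → σ2 a = σ a := fun a ha =>
    (e2 a ha.2).trans (Cmd.den_frame _ ha.1)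
  have e5 : σ2 5 = σ 5 := e1 5 (by decide)
  have e15 : σ2 15 = σ 15 := e1 15 (by decide)
  exact {
    env := {
      tab := h.mat.tab.congr (e1 0 (by decide)) (e1 2 (by decide)) (e1 3 (by decide))
      target := rfl
      target_zero := by rw [e5, h.cov.zero]
      target_lt := by rw [e5]; exact h.cov.lt
      coverSize := by rw [e1 6 (by decide), h.cov.card]
      paths := by rw [e1 7 (by decide), h.paths]
      roundNum := by rw [e2 8 (by decide), h8]
      width := by rw [e2 9 (by decide), h9]
      wordBound := by rw [e1 14 (by decide), h.wordBound]
      mate := rfl }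
    isCover := fun c u v huv => by
      obtain ⟨hu, hv, hcq, hc⟩ := huv
      exact h.isCover ⟨u, hu⟩ ⟨v, hv⟩ hc.1
    list := by rw [e5]; exact h.cov.list
    isMatch := by rw [e15]; exact h.mat.isMatch
    stable := by rw [e15]; exact h.stable
    digits := by rw [e2 10 (by decide), h10]
    base := by rw [e2 11 (by decide), h11]
    guesses := h12
    zero := by rw [e1 31 (by decide), h31] }

/-- Both methods are run and the larger packing is kept, so the unknown value of `opt` enters only
the analysis: beyond `4 * |C|` the matching is good enough, and up to this value the guesses reach
an optimal solution. -/
theorem Ready.search {I : CDDP} {C : Finset ℕ} {σ : State} (h : Ready I C σ) :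
    ∃ O, I.IsPacking O ∧ WordIs ((search.den σ) 1) O ∧ I.opt ≤ 2 * O.length := by
  rw [RAM.search, Cmd.den_seq, Cmd.den_seq, Cmd.den_seq]
  set σ1 := Cmd.den (.set 1 (.lit 1) (.lit 0)) (Cmd.den (.set 1 (.lit 0) (.lit 1)) σ) with hσ1
  have e1 : ∀ a, a ≠ 1 → σ1 a = σ a := fun a ha => (put_ne ha).trans (put_ne ha)
  have hE1 := (h.env.den (P := .set 1 (.lit 0) (.lit 1)) (by decide)).den
    (P := .set 1 (.lit 1) (.lit 0)) (by decide)
  rw [← hσ1] at hE1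
  have hw : WordIs (σ1 1) [] := by
    rw [WordIs, CDDP.word, holds_cons, holds_cons]
    refine ⟨?_, ?_, ?_⟩
    · simp [hσ1, Cmd.den, Expr.eval, put_apply]
    · simp [hσ1, Cmd.den, Expr.eval, put_apply]
    · exact holds_nil
  obtain ⟨O1, f1, f2, f3⟩ := short_spec hE1 h.isMatch (by simp [CDDP.IsPacking]) hw
  set σ2 := short.den σ1 with hσ2
  have e2 : ∀ a ∉ short.writes, a ≠ 1 → σ2 a = σ a := fun a ha h1 =>
    (Cmd.den_frame _ ha).trans (e1 a h1)
  obtain ⟨O2, g1, g2, g3, g4⟩ := allGuesses_spec (hE1.den (P := short) (by decide))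
    (B := digitBase C.card) (D := digitCount C.card) (N := digitBase C.card ^ digitCount C.card)
    rfl rfl rfl
    (by rw [← h.digits]; exact congrFun (e2 10 (by decide) (by decide)) 0)
    (by rw [← h.base]; exact congrFun (e2 11 (by decide) (by decide)) 0)
    (by rw [← h.guesses]; exact congrFun (e2 12 (by decide) (by decide)) 0)
    ((e2 31 (by decide) (by decide)).trans h.zero) f1 f2
  refine ⟨O2, g1, g2, ?_⟩
  obtain ⟨S, hS, hSlen⟩ := I.opt_isGreatest.1
  have hP := hS.isPacking
  rcases Nat.lt_or_ge (4 * C.card) I.opt with hlt | hle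
  -- With `μ` edges in the stable matching, `opt ≤ |C| + |A|` and `2 * |A| ≤ 3 * μ` give `6 * μ ≥ 4
  -- * opt - 4 * |C| > 3 * opt`.
  · obtain ⟨A, hA, hA1, hA2, hA3⟩ := h.isCover.split hP
    rw [List.length_map, hSlen] at hA3
    have := h.stable.two_card_le h.isMatch A hA hA1 hA2
    omega
  -- The search starts from the empty packing, with all of an optimal solution still to be replaced.
  -- The number of rounds is chosen just above `4 * |C|` paths times `2 * |C| + 1` keys.
  · obtain ⟨gs, k1, k2, k3⟩ := CDDP.exists_guess (R := roundCount C.card) h.isCover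
      h.env.target_zero h.list (S.map I.raw) [] hP (by simp [CDDP.IsPacking])
      (by simp [CDDP.used]) (by
        rw [List.length_nil, List.length_map, hSlen, zero_add, roundCount]
        exact Nat.lt_succ_of_le (Nat.mul_le_mul_right _ hle))
    have := g4 gs (by rw [k1, List.length_map, hSlen]; exact hle) k2
    rw [k3, List.length_nil, List.length_map, hSlen] at this
    omega

/-- The approximation algorithm. -/
def algorithm : Prog :=
  .seq prepare.toProg (.seq countRounds.toProg (.seq countGuesses.toProg search.toProg))

/-- The exponent of the bound for the running time. -/
def timeExp : ℕ := prepare.depth + countRounds.depth + countGuesses.depth + search.depth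

/-- The factor of the bound for the running time. -/
def timeCoeff : ℕ := prepare.coeff + countRounds.coeff + countGuesses.coeff + search.coeff

/-- The bound `exec_den` needs limits that stay fixed during a program, whereas the limits of later
loops are computed first. Hence there are four programs in sequence, each with limits that are known
when it starts. -/
theorem exec_algorithm (I : CDDP) : ∃ T τ O, Exec algorithm (init I.encode) T τ ∧
    T ≤ timeCoeff * guessBound (2 * I.vc) ^ timeExp * I.size ^ timeExp ∧
    I.IsPacking O ∧ WordIs (τ 1) O ∧ I.opt ≤ 2 * O.length := by
  obtain ⟨C, hp⟩ := prepare_spec (I := I)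
  have hr := hp.ready (by
    rw [Cmd.den_frame _ (by decide)]
    funext i
    simp [init])
  obtain ⟨O, hO, hw, hopt⟩ := hr.search
  set σ0 := init I.encode with hσ0
  set σ1 := prepare.den σ0 with hσ1
  set σ2 := countRounds.den σ1 with hσ2
  set σ3 := countGuesses.den σ2 with hσ3
  -- A common bound for all loop limits. As it is a product, its power splits into a factor
  -- depending on the vertex cover number and a power of the input size.
  set M := guessBound (2 * I.vc) * I.size with hM
  have hmono := guessBound_mono hp.cov.card_le
  have hq := I.n_add_q_le_size
  have hg : 5 ≤ guessBound (2 * I.vc) := le_trans (by unfold digitBase; omega) (digitBase_le _)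
  have hsM : I.size ≤ M := Nat.le_mul_of_pos_left _ (by omega)
  have hgM : guessBound C.card ≤ M := hmono.trans (Nat.le_mul_of_pos_right _ (by omega))
  have hM1 : 1 ≤ M := by omega
  have h4 := four_mul_le C.card
  have hdc := digitCount_le C.card
  have hdb := digitBase_le C.card
  have hrc := roundCount_le C.card
  have hpd := pow_digitCount_le C.card
  obtain ⟨-, -, h10, h11⟩ := countRounds_spec hp.cov.card hp.paths
  obtain ⟨T1, x1, t1⟩ := prepare.exec_den (by decide) hM1 σ0 (prepare_lims hsM)
  obtain ⟨T2, x2, t2⟩ := countRounds.exec_den (by decide) hM1 σ1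
    (countRounds_lims (by rw [hp.paths]; omega))
  obtain ⟨T3, x3, t3⟩ := countGuesses.exec_den (by decide) hM1 σ2
    (countGuesses_lims (by rw [hσ2, h10]; omega) (by rw [hσ2, h11]; omega))
  obtain ⟨T4, x4, t4⟩ := search.exec_den (by decide) hM1 σ3
    (search_lims (by rw [hr.env.tab.n, hr.env.tab.q]; omega)
      (by rw [hr.env.coverSize]; unfold digitBase at hdb; omega) (by rw [hr.env.paths]; omega)
      (by rw [hr.env.roundNum]; omega) (by rw [hr.digits]; omega) (by rw [hr.guesses]; omega)
      (by rw [hr.env.wordBound]; exact I.wordBound_le_size.trans hsM))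
  refine ⟨_, _, O, .seq x1 (.seq x2 (.seq x3 x4)), ?_, hO, hw, hopt⟩
  rw [mul_assoc, ← mul_pow, ← hM]
  have hpow : ∀ d ≤ timeExp, M ^ d ≤ M ^ timeExp := fun d hd => Nat.pow_le_pow_right hM1 hd
  calc T1 + (T2 + (T3 + T4)) ≤ prepare.coeff * M ^ timeExp + (countRounds.coeff * M ^ timeExp +
        (countGuesses.coeff * M ^ timeExp + search.coeff * M ^ timeExp)) := by
        refine add_le_add (t1.trans ?_) (add_le_add (t2.trans ?_) (add_le_add (t3.trans ?_)
          (t4.trans ?_))) <;>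
        exact Nat.mul_le_mul_left _ (hpow _ (by unfold timeExp; omega))
    _ = timeCoeff * M ^ timeExp := by unfold timeCoeff; ring

end RAM

theorem mainTheorem8 :
    ∃ (P : RAM.Prog) (f : ℕ → ℕ) (c : ℕ), Computable f ∧
      ∀ I : CDDP, ∃ (S : List (I.G.Path I.s I.t × Fin I.q)) (T : ℕ),
        RAM.RunsTo P I.encode (I.encodeSolution S) T ∧
        T ≤ f I.vc * I.size ^ c ∧
        I.IsSolution S ∧
        (1 / 2 : ℚ) * (I.opt : ℚ) ≤ (S.length : ℚ) := by
  refine ⟨RAM.algorithm, fun k => RAM.timeCoeff * RAM.guessBound (2 * k) ^ RAM.timeExp,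
    RAM.timeExp, RAM.computable_guessBound _ _, fun I => ?_⟩
  obtain ⟨T, τ, O, hx, hT, hO, hw, hopt⟩ := RAM.exec_algorithm I
  obtain ⟨S, hS, rfl⟩ := hO.exists_solution
  refine ⟨S, T, ⟨τ, hx, fun i hi => ?_⟩, hT, hS, ?_⟩
  · simp only [CDDP.encodeSolution_eq] at hi ⊢
    exact hw.get hi
  · rw [List.length_map] at hopt
    have : (I.opt : ℚ) ≤ 2 * S.length := by exact_mod_cast hopt
    linarith
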